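/- **Model.** Let $p$ be a positive integer, $1<\alpha_R<2$, and $1<\alpha_D^{(j)}<2$ with $\alpha_R<\alpha_D^{(j)}$ for $j=1,\dots,p$. Let $F_R$ and $F_D^{(1)},\dots,F_D^{(p)}$ be probability distributions on $(0,\infty)$ whose right tails are regularly varying, $1-F_R\in RV_{-\alpha_R}$ and $1-F_D^{(j)}\in RV_{-\alpha_D^{(j)}}$; let $\mu_R$, $\mu_D^{(j)}$ be their means and let $D^{(j)}$ denote a random variable with law $F_D^{(j)}$. For $T>0$ let $\lambda^{(j)}=\lambda^{(j)}(T)>0$ and $\lambda=\lambda(T)=\sum_j\lambda^{(j)}(T)$, and assume $\lambda(T)T\to\infty$ as $T\to\infty$. Let $b_R(y)=\inf\{x:F_R(x)\ge 1-1/y\}$. For each $T>0$ let $N^{(1)},\dots,N^{(p)}$ be independent Poisson random measures on $\mathbb R\times(0,\infty)^2$, where $N^{(j)}$ has mean measure $\lambda^{(j)}(T)\,ds\,F_D^{(j)}(du)\,F_R(dr)$ (a point $(s,u,r)$ is a session with starting time $s$, duration $u$ and rate $r$), and let $N=\sum_jN^{(j)}$. With $L_t(s,u)=\big|[0,t]\cap[s,s+u]\big|$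 put $A^{(j)}(t)=\int rL_t(s,u)\,N^{(j)}(ds,du,dr)$ and $A(t)=\int rL_t(s,u)\,N(ds,du,dr)$, and for $t\ge0$ $$A^{(j)}_{cs}(t)=\frac{A^{(j)}(Tt)-\lambda^{(j)}\mu_D^{(j)}\mu_R Tt}{b_R(\lambda T)},\qquad A_{cs}(t)=\frac{A(Tt)-\lambda\mu_D\mu_R Tt}{b_R(\lambda T)},\qquad \mu_D=\sum_{j=1}^p\frac{\lambda^{(j)}}{\lambda}\mu_D^{(j)} .$$ **Stable objects.** For $\alpha\in(1,2)$ let $S_\alpha(\sigma,1,0)$ be the law with characteristic function $z\mapsto\exp\{-\sigma^\alpha|z|^\alpha(1-i\,\mathrm{sign}(z)\tan\frac{\pi\alpha}{2})\}$. Let $\kappa=\big((-\cos\frac{\pi\alpha_R}{2})\frac{\Gamma(2-\alpha_R)}{\alpha_R-1}\big)^{1/\alpha_R}$. Let $\Lambda^{(1)},\dots,\Lambda^{(p)}$ be independent $\alpha_R$-stable Lévy motions totally skewed to the right: $\Lambda^{(j)}(0)=0$ a.s., the increments are independent, and $\Lambda^{(j)}(t)-\Lambda^{(j)}(s)\sim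 S_{\alpha_R}(\kappa(t-s)^{1/\alpha_R},1,0)$ for $0\le s\le t$ (so that the Lévy measure is $\alpha_R u^{-\alpha_R-1}du$ on $(0,\infty)$). For a distribution $G$ on $(0,\infty)$, let $M_G$ denote an $\alpha_R$-stable random measure, totally skewed to the right, with control measure $m(ds,du)=ds\,G(du)$, that is, an independently scattered, a.s. $\sigma$-additive random set function with $M_G(B)\sim S_{\alpha_R}(m(B)^{1/\alpha_R},1,0)$ whenever $m(B)<\infty$. For weights $v=(v_1,\dots,v_p)$, $v_j\ge0$, put $$X_v(t)=\sum_{j=1}^p v_j^{1/\alpha_R}\,E\big[(D^{(j)})^{\alpha_R}\big]^{1/\alpha_R}\,\Lambda^{(j)}(t),\qquad t\ge0 .$$ **Theorem.** The logarithm of the characteristic function $\varphi(z_1,\dots,z_m)$ of a finite-dimensional distribution (fidi) means the unique continuous function $\psi$ on $\mathbb R^m$ with $e^{\psi}=\varphi$ and $\psi(0)=0$; below, these logarithms exist for all $T>0$. For all $m$, all $t_1,\dots,t_m\ge0$ and all real $z_1,\dots,z_m$: 1. For each $j$, the log fidi characteristic function of $A^{(j)}_{cs}$ minus that of $\big(\lambda^{(j)}/\lambda\big)^{1/\alpha_R}E[(D^{(j)})^{\alpha_R}]^{1/\alpha_R}\Lambda^{(j)}(\cdot)$,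 both at times $t_1,\dots,t_m$ and at $(z_1,\dots,z_m)$, tends to $0$ as $T\to\infty$. 2. With $v_j=\lambda^{(j)}/\lambda$ (depending on $T$), the log fidi characteristic function of $A_{cs}$ minus that of $X_v$ tends to $0$ as $T\to\infty$. Moreover, for every $T>0$, the process $X_v$ has the same finite-dimensional distributions as $\kappa\int_{-\infty}^\infty\int_0^\infty 1_{[0,t]}(s)\,u\,M_{F_D}(ds,du)$, $t\ge 0$, where $F_D=\sum_j(\lambda^{(j)}/\lambda)F_D^{(j)}$. 3. If $w^{(j)}=\lim_{T\to\infty}\lambda^{(j)}/\lambda$ exists for every $j$, then the fidi characteristic functions of $A_{cs}$ converge to those of $X_w$, and $A_{cs}$ converges to $X_w$ in finite-dimensional distributions, as $T\to\infty$; and $X_w$ has the same finite-dimensional distributions as $\kappa\int_{-\infty}^\infty\int_0^\infty 1_{[0,t]}(s)\,u\,M_{G}(ds,du)$, $t\ge0$, with $G=\sum_jw^{(j)}F_D^{(j)}$. -/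

import Mathlib

open MeasureTheory ProbabilityTheory Filter Topology
open scoped NNReal ENNReal BoundedContinuousFunction

noncomputable section

namespace Traffic

/-! ### Regular variation and quantiles -/

/-- `f ∈ RV_ρ`: `f` is measurable, eventually positive, and `f (x u) / f x → u ^ ρ` as `x → ∞`,
for every `u > 0`. -/
def RegVar (f : ℝ → ℝ) (ρ : ℝ) : Prop :=
  Measurable f ∧ (∀ᶠ x in atTop, 0 < f x) ∧
    ∀ u : ℝ, 0 < u → Tendsto (fun x => f (x * u) / f x) atTop (𝓝 (u ^ ρ))

/-- The right tail `1 - F` of the distribution `μ`. -/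
def rightTail (μ : Measure ℝ) (x : ℝ) : ℝ := 1 - cdf μ x

/-- The left continuous inverse `F^←(y) = inf {x : F x ≥ y}`. -/
def leftInv (F : ℝ → ℝ) (y : ℝ) : ℝ := sInf {x : ℝ | y ≤ F x}

/-- The quantile function `b(t) = F^←(1 - 1/t)` of the distribution `μ`. -/
def quantile (μ : Measure ℝ) (t : ℝ) : ℝ := leftInv (cdf μ) (1 - 1 / t)

/-! ### Poisson random measures -/

/-- `N` is a Poisson random measure with mean measure `m` on the probability space `(Ω, P)`. -/
structure IsPoissonRandomMeasure {Ω E : Type*} [MeasurableSpace Ω] [MeasurableSpace E]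
    (P : Measure Ω) (N : Ω → Measure E) (m : Measure E) : Prop where
  measurable : Measurable N
  poisson : ∀ A : Set E, MeasurableSet A → m A ≠ ∞ →
    P.map (fun ω => N ω A) = (poissonMeasure (m A).toNNReal).map (fun k : ℕ => (k : ℝ≥0∞))
  eq_top : ∀ A : Set E, MeasurableSet A → m A = ∞ → ∀ᵐ ω ∂P, N ω A = ∞
  indep : ∀ (n : ℕ) (A : Fin n → Set E), (∀ i, MeasurableSet (A i)) →
    Pairwise (fun i k => Disjoint (A i) (A k)) → iIndepFun (fun i ω => N ω (A i)) P

/-! ### The traffic model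

A session is a point `(s, u, r)`: starting time, duration, transmission rate. -/

/-- Length of the part of `[0, t]` during which a session `(s, u, r)` transmits. -/
def sessionLength (t s u : ℝ) : ℝ := (volume (Set.Icc 0 t ∩ Set.Icc s (s + u))).toReal

/-- Cumulative input in `[0, t]` of a configuration `N` of sessions. -/
def load (N : Measure (ℝ × ℝ × ℝ)) (t : ℝ) : ℝ :=
  ∫ x, x.2.2 * sessionLength t x.1 x.2.1 ∂N

/-- The measure `l ds G(du) H(dr)`, the mean measure of the sessions of a stream with
arrival intensity `l`, duration law `G` and rate law `H`. -/
def sessionIntensity (l : ℝ) (G H : Measure ℝ) : Measure (ℝ × ℝ × ℝ) :=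
  (ENNReal.ofReal l • (volume : Measure ℝ)).prod (G.prod H)

/-- The mean of a distribution. -/
def mean (μ : Measure ℝ) : ℝ := ∫ x, x ∂μ

/-- The total arrival intensity at time scale `T`. -/
def totalRate {p : ℕ} (lam : Fin p → ℝ → ℝ) (T : ℝ) : ℝ := ∑ j, lam j T

/-- The proportion of sessions that belong to stream `j` at time scale `T`. -/
def proportion {p : ℕ} (lam : Fin p → ℝ → ℝ) (j : Fin p) (T : ℝ) : ℝ :=
  lam j T / totalRate lam T

/-- The mixture `∑ j, w j F j` of distributions. -/
def mixture {p : ℕ} (w : Fin p → ℝ) (F : Fin p → Measure ℝ) : Measure ℝ :=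
  ∑ j, ENNReal.ofReal (w j) • F j

/-- The process `t ↦ (load of N in [0, T t] - l μ_D μ_R T t) / a`. -/
def centredLoad {Ω : Type*} (N : Ω → Measure (ℝ × ℝ × ℝ)) (l μD μR T a : ℝ)
    (t : ℝ≥0) (ω : Ω) : ℝ :=
  (load (N ω) (T * t) - l * μD * μR * (T * t)) / a

/-- Centred input of stream `j` at time scale `T`, normalised by `b_R(λ T)`. -/
def streamInput {p : ℕ} {Ω : Type*} (N : Fin p → Ω → Measure (ℝ × ℝ × ℝ))
    (lam : Fin p → ℝ → ℝ) (FD : Fin p → Measure ℝ) (FR : Measure ℝ) (j : Fin p) (T : ℝ) :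
    ℝ≥0 → Ω → ℝ :=
  centredLoad (N j) (lam j T) (mean (FD j)) (mean FR) T (quantile FR (totalRate lam T * T))

/-- Centred input of the superposition of all streams at time scale `T`, normalised by
`b_R(λ T)`; the mean session duration is `∑ j, (λ_j / λ) μ_D^j`. -/
def aggregateInput {p : ℕ} {Ω : Type*} (N : Fin p → Ω → Measure (ℝ × ℝ × ℝ))
    (lam : Fin p → ℝ → ℝ) (FD : Fin p → Measure ℝ) (FR : Measure ℝ) (T : ℝ) :
    ℝ≥0 → Ω → ℝ :=
  centredLoad (fun ω => ∑ j, N j ω) (totalRate lam T) (∑ j, proportion lam j T * mean (FD j))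
    (mean FR) T (quantile FR (totalRate lam T * T))

/-! ### Finite-dimensional distributions -/

/-- `E exp (i ∑ k, z k * X (t k))`. -/
def fidiChf {Ω : Type*} [MeasurableSpace Ω] (P : Measure Ω) (X : ℝ≥0 → Ω → ℝ) {n : ℕ}
    (t : Fin n → ℝ≥0) (z : Fin n → ℝ) : ℂ :=
  ∫ ω, Complex.exp (Complex.I * ((∑ k, z k * X (t k) ω : ℝ) : ℂ)) ∂P

/-- `ψ` is the logarithm of the characteristic function `φ`: the (unique) continuous function
with `exp ψ = φ` that vanishes at the origin. -/
structure IsLogChf {n : ℕ} (φ ψ : (Fin n → ℝ) → ℂ) : Prop where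
  continuous : Continuous ψ
  zero : ψ 0 = 0
  exp_eq : ∀ z, Complex.exp (ψ z) = φ z

/-- For every choice of times, the logarithms of the fidi characteristic functions of `X T` and
of `Y T` exist for all `T > 0`, and their difference tends to zero pointwise as `T → ∞`. -/
def LogFidiChfAsymptotic {Ω : ℝ → Type*} [∀ T, MeasurableSpace (Ω T)]
    (P : ∀ T, Measure (Ω T)) (X : ∀ T, ℝ≥0 → Ω T → ℝ)
    {Ω' : Type*} [MeasurableSpace Ω'] (P' : Measure Ω') (Y : ℝ → ℝ≥0 → Ω' → ℝ) : Prop :=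
  ∀ (n : ℕ) (t : Fin n → ℝ≥0), ∃ ψ η : ℝ → (Fin n → ℝ) → ℂ,
    (∀ T, 0 < T → IsLogChf (fidiChf (P T) (X T) t) (ψ T)) ∧
    (∀ T, 0 < T → IsLogChf (fidiChf P' (Y T) t) (η T)) ∧
    ∀ z, Tendsto (fun T => ψ T z - η T z) atTop (𝓝 0)

/-- Convergence of the fidi characteristic functions of `X T` to those of `Y` as `T → ∞`. -/
def FidiChfTendsto {Ω : ℝ → Type*} [∀ T, MeasurableSpace (Ω T)]
    (P : ∀ T, Measure (Ω T)) (X : ∀ T, ℝ≥0 → Ω T → ℝ)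
    {Ω' : Type*} [MeasurableSpace Ω'] (P' : Measure Ω') (Y : ℝ≥0 → Ω' → ℝ) : Prop :=
  ∀ (n : ℕ) (t : Fin n → ℝ≥0) (z : Fin n → ℝ),
    Tendsto (fun T => fidiChf (P T) (X T) t z) atTop (𝓝 (fidiChf P' Y t z))

/-- Weak convergence of the finite-dimensional distributions of `X T` to those of `Y`
as `T → ∞`. -/
def FidiTendsto {Ω : ℝ → Type*} [∀ T, MeasurableSpace (Ω T)]
    (P : ∀ T, Measure (Ω T)) (X : ∀ T, ℝ≥0 → Ω T → ℝ)
    {Ω' : Type*} [MeasurableSpace Ω'] (P' : Measure Ω') (Y : ℝ≥0 → Ω' → ℝ) : Prop :=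
  ∀ (n : ℕ) (t : Fin n → ℝ≥0) (f : (Fin n → ℝ) →ᵇ ℝ),
    Tendsto (fun T => ∫ ω, f (fun k => X T (t k) ω) ∂(P T)) atTop
      (𝓝 (∫ ω, f (fun k => Y (t k) ω) ∂P'))

/-- Equality of all finite-dimensional distributions. -/
def SameFidi {Ω Ω' : Type*} [MeasurableSpace Ω] [MeasurableSpace Ω']
    (P : Measure Ω) (X : ℝ≥0 → Ω → ℝ) (P' : Measure Ω') (Y : ℝ≥0 → Ω' → ℝ) : Prop :=
  ∀ (n : ℕ) (t : Fin n → ℝ≥0),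
    P.map (fun ω (k : Fin n) => X (t k) ω) = P'.map (fun ω (k : Fin n) => Y (t k) ω)

/-! ### Totally right-skewed stable laws, Lévy motions, random measures and integrals -/

/-- The characteristic function of the stable law `S_α(σ, 1, 0)`, for `α ≠ 1`. -/
def stableChf (α σ z : ℝ) : ℂ :=
  Complex.exp (-((σ ^ α * |z| ^ α : ℝ) : ℂ) *
    (1 - Complex.I * ((Real.sign z * Real.tan (Real.pi * α / 2) : ℝ) : ℂ)))

/-- `L` is an `α`-stable Lévy motion, totally skewed to the right, with `L 1 ~ S_α(σ, 1, 0)`. -/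
structure IsStableLevyMotion {Ω : Type*} [MeasurableSpace Ω] (P : Measure Ω)
    (L : ℝ≥0 → Ω → ℝ) (α σ : ℝ) : Prop where
  measurable : ∀ t, Measurable (L t)
  zero : ∀ᵐ ω ∂P, L 0 ω = 0
  indep : HasIndepIncrements L P
  stable : ∀ s t : ℝ≥0, s ≤ t → ∀ z : ℝ,
    charFun (P.map (fun ω => L t ω - L s ω)) z
      = stableChf α (σ * ((t : ℝ) - (s : ℝ)) ^ (1 / α)) z

/-- The scale for which the stable Lévy motion has Lévy measure
`α u^{-α-1} du` on `(0, ∞)`, namely `((-cos (π α / 2)) Γ(2 - α) / (α - 1)) ^ (1 / α)`. -/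
def stableScale (α : ℝ) : ℝ :=
  (-Real.cos (Real.pi * α / 2) * Real.Gamma (2 - α) / (α - 1)) ^ (1 / α)

/-- `M` is an `α`-stable random measure, totally skewed to the right, with control measure `m`:
it is independently scattered and `σ`-additive on sets of finite control measure, and
`M A ~ S_α((m A) ^ (1 / α), 1, 0)`. -/
structure IsStableRandomMeasure {Ω E : Type*} [MeasurableSpace Ω] [MeasurableSpace E]
    (P : Measure Ω) (M : Set E → Ω → ℝ) (α : ℝ) (m : Measure E) : Prop where
  measurable : ∀ A, MeasurableSet A → m A ≠ ∞ → Measurable (M A)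
  stable : ∀ A, MeasurableSet A → m A ≠ ∞ → ∀ z : ℝ,
    charFun (P.map (M A)) z = stableChf α ((m A).toReal ^ (1 / α)) z
  indep : ∀ (n : ℕ) (A : Fin n → Set E), (∀ i, MeasurableSet (A i)) → (∀ i, m (A i) ≠ ∞) →
    Pairwise (fun i k => Disjoint (A i) (A k)) → iIndepFun (fun i => M (A i)) P
  sigma_additive : ∀ A : ℕ → Set E, (∀ i, MeasurableSet (A i)) →
    Pairwise (fun i k => Disjoint (A i) (A k)) → m (⋃ i, A i) ≠ ∞ →
    ∀ᵐ ω ∂P, Tendsto (fun n => ∑ i ∈ Finset.range n, M (A i) ω) atTop (𝓝 (M (⋃ i, A i) ω))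

/-- The integral of a simple function with respect to a random measure. -/
def simpleIntegral {Ω E : Type*} [MeasurableSpace E] (M : Set E → Ω → ℝ) (f : SimpleFunc E ℝ)
    (ω : Ω) : ℝ :=
  ∑ y ∈ f.range, y * M (f ⁻¹' {y}) ω

/-- `X = ∫ f dM` for an `α`-stable random measure `M` with control measure `m`: `X` is the limit
in probability of integrals of simple functions that converge to `f` in `L^α(m)`. -/
def IsStableIntegral {Ω E : Type*} [MeasurableSpace Ω] [MeasurableSpace E] (P : Measure Ω)
    (M : Set E → Ω → ℝ) (α : ℝ) (m : Measure E) (f : E → ℝ) (X : Ω → ℝ) : Prop :=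
  ∃ g : ℕ → SimpleFunc E ℝ, (∀ n, (g n).FinMeasSupp m) ∧
    Tendsto (fun n => ∫⁻ x, ENNReal.ofReal (|g n x - f x| ^ α) ∂m) atTop (𝓝 0) ∧
    TendstoInMeasure P (fun n => simpleIntegral M (g n)) atTop X

/-- `I t = ∫∫ 1_{[0,t]}(s) u M(ds, du)` for all `t ≥ 0`, where `M` is an `α`-stable random measure,
totally skewed to the right, with control measure `ds G(du)`. -/
def IsStableIntegralProcess {Ω : Type*} [MeasurableSpace Ω] (P : Measure Ω)
    (M : Set (ℝ × ℝ) → Ω → ℝ) (α : ℝ) (G : Measure ℝ) (I : ℝ≥0 → Ω → ℝ) : Prop :=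
  IsStableRandomMeasure P M α (volume.prod G) ∧
  ∀ t : ℝ≥0, IsStableIntegral P M α (volume.prod G)
    (fun x => (Set.Icc (0 : ℝ) t).indicator (fun _ => (1 : ℝ)) x.1 * x.2) (I t)

/-- `E[D ^ α] ^ (1 / α)` for `D` with distribution `G`. -/
def momentNorm (α : ℝ) (G : Measure ℝ) : ℝ := (∫ u, u ^ α ∂G) ^ (1 / α)

/-- The process `∑ j, w_j ^ (1 / α) E[D_j ^ α] ^ (1 / α) L_j`, where `D_j` has law `F j`. -/
def stableSum {p : ℕ} {Ω : Type*} (α : ℝ) (w : Fin p → ℝ) (F : Fin p → Measure ℝ)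
    (L : Fin p → ℝ≥0 → Ω → ℝ) (t : ℝ≥0) (ω : Ω) : ℝ :=
  ∑ j, w j ^ (1 / α) * momentNorm α (F j) * L j t ω

end Traffic

end

/-!
The theorem is a statement about logarithms of characteristic functions, all of which are explicit.

*Traffic.* By the exponential formula for Poisson random measures
(`IsPoissonRandomMeasure.integral_cexp`), the logarithm for one stream is the integral of
`e ^ (i f) - 1 - i f` against the mean measure, where `f` is the contribution of a session to the
linear combination of the normalised loads (`streamExponent`). Integrating out the rate and
substituting `T s` for the starting time turns it into `λ_j / λ` times an integral over `ds G(du)`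
of the rescaled transform `n ∫ (e ^ (i r y / b(n)) - 1 - i r y / b(n)) F_R(dr)`, with `n = λ T` and
`y` the combined session length (`streamExponent_eq`).

*The limit.* Regular variation makes the rescaled tail `n (1 - F_R) (b(n) x)` converge to
`x ^ (-α_R)`, so the rescaled transform converges, continuously in `y`, to the exponent of the
stable law with Lévy measure `α_R x ^ (-α_R - 1) dx` (`tendsto_scaledTransform`), whose constant
comes from Euler's integral rotated to the imaginary axis (`integral_stable`). At large `T` a
session that starts at `T s` lies entirely inside or entirely outside of `[0, T t]`, so `y` tends
to `u` times a step function of `s`. Potter bounds give a majorant in `u ^ β` and `u ^ γ` with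
`1 < β < α_R < γ < α_D`, which is integrable since the durations have lighter tails than the rates
(`tendsto_integral_scaledTransform`). The factor `λ_j / λ ≤ 1` is never passed to the limit,
hence the difference of the logarithms tends to zero without any assumption on the proportions
(`tendsto_streamExponent`). Independence makes the exponents of the streams add up.

*Stable processes.* By homogeneity of the stable exponent, both the weighted sum of Lévy motions
and the stable integral have as logarithm a constant multiple of the same function
`levyExponent α_R t`. For the Lévy motions this follows by summation by parts over independent
increments (`fidiChf_sum_levy`), for the stable integral by approximation with simple functions
(`fidiChf_stableIntegralProcess`); the two constants agree since the moment of a mixture is the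
mixture of the moments. Convergence of the finite-dimensional distributions is then Lévy's
continuity theorem (`FidiChfTendsto.fidiTendsto`).
-/

namespace Traffic

/-! ### Monotone regularly varying functions: bounds of Potter type -/

/-- Iterating `f (2 x) ≤ 2 ^ (-β) f x` and interpolating by monotonicity bounds the ratio
`f y / f x` from above by a multiple of `(y / x) ^ (-β)`, for every `β < α`. -/
theorem RegVar.potter_upper {f : ℝ → ℝ} {α β : ℝ} (hf : RegVar f (-α)) (hanti : Antitone f)
    (hβ0 : 0 ≤ β) (hβ : β < α) :
    ∃ x₀ : ℝ, 0 < x₀ ∧ ∀ x y, x₀ ≤ x → x ≤ y →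
      f y ≤ (2 : ℝ) ^ β * (y / x) ^ (-β) * f x := by
  obtain ⟨-, hpos, hlim⟩ := hf
  have h2 : ∀ᶠ x in atTop, f (x * 2) / f x < (2 : ℝ) ^ (-β) :=
    (hlim 2 (by norm_num)).eventually_lt_const
      (Real.rpow_lt_rpow_of_exponent_lt (by norm_num) (by linarith))
  obtain ⟨a, ha⟩ := eventually_atTop.1 (hpos.and h2)
  refine ⟨max a 1, by positivity, fun x y hx hxy => ?_⟩
  have hx1 : 1 ≤ x := le_trans (le_max_right _ _) hx
  have hxa : a ≤ x := le_trans (le_max_left _ _) hx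
  have hiter : ∀ k : ℕ, f (x * 2 ^ k) ≤ ((2 : ℝ) ^ (-β)) ^ k * f x := by
    intro k
    induction k with
    | zero => simp
    | succ k ih =>
      have hle : a ≤ x * 2 ^ k :=
        hxa.trans (le_mul_of_one_le_right (by linarith) (one_le_pow₀ (by norm_num)))
      obtain ⟨hp, hr⟩ := ha _ hle
      rw [div_lt_iff₀ hp] at hr
      calc f (x * 2 ^ (k + 1)) = f (x * 2 ^ k * 2) := by rw [pow_succ, mul_assoc]
        _ ≤ (2 : ℝ) ^ (-β) * f (x * 2 ^ k) := hr.le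
        _ ≤ (2 : ℝ) ^ (-β) * (((2 : ℝ) ^ (-β)) ^ k * f x) := by gcongr
        _ = _ := by ring
  have hx0 : 0 < x := by linarith
  obtain ⟨k, hk1, hk2⟩ := exists_nat_pow_near ((one_le_div hx0).2 hxy) (one_lt_two (α := ℝ))
  have hfx : 0 ≤ f x := (ha x hxa).1.le
  calc f y ≤ f (x * 2 ^ k) := hanti (by rwa [le_div_iff₀ hx0, mul_comm] at hk1)
    _ ≤ ((2 : ℝ) ^ (-β)) ^ k * f x := hiter k
    _ = (2 : ℝ) ^ β * ((2 : ℝ) ^ (k + 1)) ^ (-β) * f x := by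
        congr 1
        rw [← Real.rpow_natCast, ← Real.rpow_natCast, ← Real.rpow_mul (by norm_num),
          ← Real.rpow_mul (by norm_num), ← Real.rpow_add (by norm_num)]
        congr 1; push_cast; ring
    _ ≤ _ := by
        gcongr ?_ * ?_ * _
        exact Real.rpow_le_rpow_of_nonpos (div_pos (hx0.trans_le hxy) hx0) hk2.le (by linarith)

/-- The lower counterpart of `RegVar.potter_upper`, stated as a bound on the value at the
smaller argument. -/
theorem RegVar.potter_lower {f : ℝ → ℝ} {α γ : ℝ} (hf : RegVar f (-α)) (hanti : Antitone f)
    (hγ0 : 0 ≤ γ) (hγ : α < γ) :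
    ∃ x₀ : ℝ, 0 < x₀ ∧ ∀ x y, x₀ ≤ y → y ≤ x →
      f y ≤ (2 : ℝ) ^ γ * (y / x) ^ (-γ) * f x := by
  obtain ⟨-, hpos, hlim⟩ := hf
  have h2 : ∀ᶠ x in atTop, (2 : ℝ) ^ (-γ) < f (x * 2) / f x :=
    (hlim 2 (by norm_num)).eventually_const_lt
      (Real.rpow_lt_rpow_of_exponent_lt (by norm_num) (by linarith))
  obtain ⟨a, ha⟩ := eventually_atTop.1 (hpos.and h2)
  refine ⟨max a 1, by positivity, fun x y hy hxy => ?_⟩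
  have hy1 : 1 ≤ y := le_trans (le_max_right _ _) hy
  have hya : a ≤ y := le_trans (le_max_left _ _) hy
  have hiter : ∀ k : ℕ, f y ≤ ((2 : ℝ) ^ γ) ^ k * f (y * 2 ^ k) := by
    intro k
    induction k with
    | zero => simp
    | succ k ih =>
      have hle : a ≤ y * 2 ^ k :=
        hya.trans (le_mul_of_one_le_right (by linarith) (one_le_pow₀ (by norm_num)))
      obtain ⟨hp, hr⟩ := ha _ hle
      rw [lt_div_iff₀ hp, Real.rpow_neg (by norm_num), inv_mul_lt_iff₀ (by positivity)] at hr
      calc f y ≤ ((2 : ℝ) ^ γ) ^ k * f (y * 2 ^ k) := ih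
        _ ≤ ((2 : ℝ) ^ γ) ^ k * ((2 : ℝ) ^ γ * f (y * 2 ^ k * 2)) := by gcongr
        _ = _ := by rw [pow_succ, pow_succ, mul_assoc, ← mul_assoc y]; ring
  have hy0 : 0 < y := by linarith
  have hx0 : 0 < x := by linarith
  obtain ⟨k, hk1, hk2⟩ := exists_nat_pow_near ((one_le_div hy0).2 hxy) (one_lt_two (α := ℝ))
  have hfx : 0 ≤ f x := (ha x (hya.trans hxy)).1.le
  calc f y ≤ ((2 : ℝ) ^ γ) ^ (k + 1) * f (y * 2 ^ (k + 1)) := hiter _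
    _ ≤ ((2 : ℝ) ^ γ) ^ (k + 1) * f x := by
        gcongr
        refine hanti ?_
        rw [div_lt_iff₀ hy0, mul_comm] at hk2
        exact hk2.le
    _ = (2 : ℝ) ^ γ * ((2 : ℝ) ^ k) ^ γ * f x := by
        congr 1
        rw [← Real.rpow_natCast, ← Real.rpow_natCast, ← Real.rpow_mul (by norm_num),
          ← Real.rpow_mul (by norm_num), ← Real.rpow_add (by norm_num)]
        congr 1; push_cast; ring
    _ ≤ _ := by
        gcongr ?_ * ?_ * _
        rw [Real.rpow_neg (by positivity), ← Real.inv_rpow (by positivity), inv_div]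
        exact Real.rpow_le_rpow (by positivity) hk1 hγ0

/-! ### Tails, moments and quantiles of a distribution with regularly varying tail -/

theorem rightTail_eq_real (μ : Measure ℝ) [IsProbabilityMeasure μ] (x : ℝ) :
    rightTail μ x = μ.real (Set.Ioi x) := by
  rw [rightTail, cdf_eq_real, ← probReal_compl_eq_one_sub measurableSet_Iic, Set.compl_Iic]

theorem rightTail_antitone (μ : Measure ℝ) : Antitone (rightTail μ) :=
  fun _ _ h => sub_le_sub_left (monotone_cdf μ h) 1

theorem rightTail_nonneg (μ : Measure ℝ) (x : ℝ) : 0 ≤ rightTail μ x :=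
  sub_nonneg.2 (cdf_le_one μ x)

theorem rightTail_le_one (μ : Measure ℝ) (x : ℝ) : rightTail μ x ≤ 1 :=
  sub_le_self _ (cdf_nonneg μ x)

/-- A distribution on `(0, ∞)` whose tail is regularly varying of index `-α` has finite moments
of all orders less than `α`. -/
theorem integrable_rpow_of_regVar {μ : Measure ℝ} [IsProbabilityMeasure μ]
    (hpos : ∀ᵐ r ∂μ, 0 < r) {α β : ℝ} (hμ : RegVar (rightTail μ) (-α)) (hβ0 : 0 < β)
    (hβ : β < α) : Integrable (fun r => r ^ β) μ := by
  obtain ⟨γ, hβγ, hγα⟩ := exists_between hβ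
  obtain ⟨x₀, hx₀, hpot⟩ := hμ.potter_upper (rightTail_antitone μ) (by linarith) hγα
  refine ⟨by fun_prop, ?_⟩
  rw [hasFiniteIntegral_iff_ofReal
    (by filter_upwards [hpos] with r hr using Real.rpow_nonneg hr.le _),
    lintegral_rpow_eq_lintegral_meas_lt_mul (f := fun r : ℝ => r) μ
    (by filter_upwards [hpos] with r hr using hr.le) aemeasurable_id' hβ0]
  refine ENNReal.mul_lt_top ENNReal.ofReal_lt_top ?_
  rw [← Set.Ioc_union_Ioi_eq_Ioi hx₀.le,
    lintegral_union measurableSet_Ioi Set.Ioc_disjoint_Ioi_same]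
  refine ENNReal.add_lt_top.2 ⟨?_, ?_⟩
  · have h1 : IntegrableOn (fun t : ℝ => t ^ (β - 1)) (Set.Ioc 0 x₀) :=
      (intervalIntegrable_iff_integrableOn_Ioc_of_le hx₀.le).1
        (intervalIntegral.intervalIntegrable_rpow' (by linarith))
    refine lt_of_le_of_lt (setLIntegral_mono' measurableSet_Ioc fun t ht => ?_)
      ((hasFiniteIntegral_iff_ofReal ?_).1 h1.2)
    · exact mul_le_of_le_one_left zero_le prob_le_one
    · filter_upwards [ae_restrict_mem measurableSet_Ioc] with t ht
        using Real.rpow_nonneg ht.1.le _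
  · have h2 : IntegrableOn (fun t : ℝ => (2 : ℝ) ^ γ * x₀ ^ γ * t ^ (β - 1 - γ)) (Set.Ioi x₀) :=
      (integrableOn_Ioi_rpow_of_lt (by linarith) hx₀).const_mul _
    refine lt_of_le_of_lt (setLIntegral_mono' measurableSet_Ioi fun t ht => ?_)
      ((hasFiniteIntegral_iff_ofReal ?_).1 h2.2)
    · have ht0 : 0 < t := hx₀.trans ht
      have : μ {a | t < a} = ENNReal.ofReal (rightTail μ t) := by
        rw [rightTail_eq_real, ofReal_measureReal]; rfl
      rw [this, ← ENNReal.ofReal_mul (rightTail_nonneg _ _)]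
      refine ENNReal.ofReal_le_ofReal ?_
      calc rightTail μ t * t ^ (β - 1)
          ≤ ((2 : ℝ) ^ γ * (t / x₀) ^ (-γ) * rightTail μ x₀) * t ^ (β - 1) := by
            gcongr
            exact hpot _ _ le_rfl (le_of_lt ht)
        _ ≤ ((2 : ℝ) ^ γ * (t / x₀) ^ (-γ) * 1) * t ^ (β - 1) := by
            gcongr
            exact rightTail_le_one _ _
        _ = _ := by
            rw [Real.div_rpow ht0.le hx₀.le, Real.rpow_neg hx₀.le, div_inv_eq_mul,
              sub_eq_add_neg _ γ, Real.rpow_add ht0]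
            ring
    · filter_upwards [ae_restrict_mem measurableSet_Ioi] with t ht
      have ht0 : 0 < t := hx₀.trans ht
      positivity

/-- To the left of the quantile the tail still exceeds `1 / n`. Positivity of the distribution makes
the infimum that defines the quantile an infimum of a set bounded below. -/
theorem one_le_mul_rightTail_of_lt_quantile {μ : Measure ℝ} {n x : ℝ} (hn : 1 < n)
    (hμ0 : cdf μ 0 = 0) (hx : x < quantile μ n) : 1 ≤ n * rightTail μ x := by
  have hbdd : BddBelow {x : ℝ | 1 - 1 / n ≤ cdf μ x} := by
    refine ⟨0, fun y hy => ?_⟩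
    by_contra! hlt
    have h1 : cdf μ y ≤ 0 := hμ0 ▸ monotone_cdf μ hlt.le
    have h2 : 1 / n < 1 := (div_lt_one (by linarith)).2 hn
    have h3 : 1 - 1 / n ≤ cdf μ y := hy
    linarith
  have h := notMem_of_lt_csInf hx hbdd
  simp only [Set.mem_ofPred_eq, not_le] at h
  have : 1 / n < rightTail μ x := by rw [rightTail]; linarith
  rw [div_lt_iff₀ (by linarith)] at this
  linarith

theorem mul_rightTail_quantile_le_one {μ : Measure ℝ} {n : ℝ} (hn : 1 < n) :
    n * rightTail μ (quantile μ n) ≤ 1 := by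
  have hne : {x : ℝ | 1 - 1 / n ≤ cdf μ x}.Nonempty := by
    have h1 : 1 - 1 / n < 1 := sub_lt_self _ (by positivity)
    obtain ⟨x, hx⟩ := ((tendsto_cdf_atTop μ).eventually_const_lt h1).exists
    exact ⟨x, hx.le⟩
  -- points to the right of the quantile satisfy the defining inequality; let them decrease
  have hright : ∀ y, quantile μ n < y → 1 - 1 / n ≤ cdf μ y := fun y hy => by
    obtain ⟨x, hx, hxy⟩ := exists_lt_of_csInf_lt hne hy
    exact le_trans hx (monotone_cdf μ hxy.le)
  have hc : Tendsto (cdf μ) (𝓝[>] (quantile μ n)) (𝓝 (cdf μ (quantile μ n))) :=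
    ((cdf μ).right_continuous _).tendsto.mono_left (nhdsWithin_mono _ Set.Ioi_subset_Ici_self)
  have h := ge_of_tendsto hc (eventually_mem_nhdsWithin.mono hright)
  have : rightTail μ (quantile μ n) ≤ 1 / n := by rw [rightTail]; linarith
  rwa [le_div_iff₀ (by linarith), mul_comm] at this

theorem cdf_zero_of_ae_pos {μ : Measure ℝ} [IsProbabilityMeasure μ] (hpos : ∀ᵐ r ∂μ, 0 < r) :
    cdf μ 0 = 0 := by
  rw [cdf_eq_real, measureReal_eq_zero_iff]
  simpa [ae_iff, Set.Iic] using hpos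

theorem tendsto_quantile_atTop {μ : Measure ℝ} {α : ℝ}
    (hμ : RegVar (rightTail μ) (-α)) : Tendsto (quantile μ) atTop atTop := by
  refine tendsto_atTop.2 fun x => ?_
  obtain ⟨y, hxy, hy⟩ := ((eventually_ge_atTop x).and hμ.2.1).exists
  filter_upwards [eventually_gt_atTop 1, eventually_gt_atTop (1 / rightTail μ y)] with n hn1 hn
  by_contra! hlt
  have h1 := mul_rightTail_quantile_le_one (μ := μ) hn1
  have h2 := rightTail_antitone μ (hlt.le.trans hxy)
  rw [div_lt_iff₀ hy] at hn
  nlinarith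

/-- The rescaled tail `n (1 - F) (b(n) x)`. -/
noncomputable def scaledTail (μ : Measure ℝ) (n x : ℝ) : ℝ := n * rightTail μ (quantile μ n * x)

/-- The tail may jump at the quantile, but regular variation makes the jumps negligible. -/
theorem tendsto_scaledTail_one {μ : Measure ℝ} {α : ℝ} (hμ0 : cdf μ 0 = 0)
    (hμ : RegVar (rightTail μ) (-α)) :
    Tendsto (fun n => n * rightTail μ (quantile μ n)) atTop (𝓝 1) := by
  have hb := tendsto_quantile_atTop hμ
  refine tendsto_order.2 ⟨fun c hc => ?_, fun c hc => ?_⟩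
  · -- choose `δ < 1` with `δ ^ α` close to one, and compare with the tail at `δ b(n)`
    have hcont : Tendsto (fun δ : ℝ => δ ^ (-α)) (𝓝[<] 1) (𝓝 1) := by
      have : Tendsto (fun δ : ℝ => δ ^ (-α)) (𝓝 1) (𝓝 (1 ^ (-α))) :=
        (Real.continuousAt_rpow_const 1 (-α) (Or.inl one_ne_zero)).tendsto
      rw [Real.one_rpow] at this
      exact this.mono_left nhdsWithin_le_nhds
    have hmul : Tendsto (fun δ : ℝ => c * δ ^ (-α)) (𝓝[<] 1) (𝓝 (c * 1)) := hcont.const_mul c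
    have hlt : c * 1 < 1 := by linarith
    have hIoo : ∀ᶠ δ : ℝ in 𝓝[<] 1, δ ∈ Set.Ioo (0 : ℝ) 1 :=
      Ioo_mem_nhdsLT (by norm_num)
    obtain ⟨δ, hδ, hδ0, hδ1⟩ := ((hmul.eventually_lt_const hlt).and hIoo).exists
    have hrat := (hμ.2.2 δ hδ0).comp hb
    have hev : ∀ᶠ n in atTop, c * (rightTail μ (quantile μ n * δ) / rightTail μ (quantile μ n))
        < 1 := (hrat.const_mul c).eventually_lt_const hδ
    filter_upwards [hev, hb.eventually hμ.2.1, hb.eventually_gt_atTop 0,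
      eventually_gt_atTop 1] with n h1 h2 h3 hn
    have h4 := one_le_mul_rightTail_of_lt_quantile (x := quantile μ n * δ) hn hμ0
      (by nlinarith)
    rw [← mul_div_assoc, div_lt_one h2] at h1
    by_cases hc0 : c ≤ 0
    · exact hc0.trans_lt (mul_pos (by linarith) h2)
    · push Not at hc0
      calc c = c * 1 := by ring
        _ ≤ c * (n * rightTail μ (quantile μ n * δ)) := by gcongr
        _ = n * (c * rightTail μ (quantile μ n * δ)) := by ring
        _ < n * rightTail μ (quantile μ n) := by
          have : (0 : ℝ) < n := by linarith
          gcongr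
  · filter_upwards [eventually_gt_atTop 1] with n hn
    exact (mul_rightTail_quantile_le_one hn).trans_lt hc

theorem tendsto_scaledTail {μ : Measure ℝ} {α : ℝ} (hμ0 : cdf μ 0 = 0)
    (hμ : RegVar (rightTail μ) (-α)) {x : ℝ} (hx : 0 < x) :
    Tendsto (fun n => scaledTail μ n x) atTop (𝓝 (x ^ (-α))) := by
  have hb := tendsto_quantile_atTop hμ
  have h := (tendsto_scaledTail_one hμ0 hμ).mul ((hμ.2.2 x hx).comp hb)
  rw [one_mul] at h
  refine h.congr' ?_
  filter_upwards [hb.eventually hμ.2.1] with n hn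
  simp only [Function.comp, scaledTail]
  field_simp

/-- A bound on the rescaled tails that does not depend on `n`. Above the threshold of the Potter
bounds it follows from them; below it, `n` itself is at most a multiple of `b(n) ^ γ`. -/
theorem exists_scaledTail_le {μ : Measure ℝ} {α β γ : ℝ}
    (hμ : RegVar (rightTail μ) (-α)) (hβ0 : 0 ≤ β) (hβ : β < α) (hγ : α < γ) :
    ∃ C : ℝ, 0 < C ∧ ∀ᶠ n in atTop, ∀ x, 0 < x →
      scaledTail μ n x ≤ C * (x ^ (-β) + x ^ (-γ)) := by
  have hb := tendsto_quantile_atTop hμ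
  have hγ0 : 0 ≤ γ := by linarith
  obtain ⟨x₁, hx₁, hup⟩ := hμ.potter_upper (rightTail_antitone μ) hβ0 hβ
  obtain ⟨x₂, hx₂, hlow⟩ := hμ.potter_lower (rightTail_antitone μ) hγ0 hγ
  obtain ⟨x₃, hx₃⟩ := eventually_atTop.1 hμ.2.1
  set x₀ := max x₂ x₃ with hx₀
  have hx₀pos : 0 < x₀ := lt_of_lt_of_le hx₂ (le_max_left _ _)
  have hF₀ : 0 < rightTail μ x₀ := hx₃ _ (le_max_right _ _)
  refine ⟨2 ^ β + 2 ^ γ + 2 ^ γ / rightTail μ x₀, by positivity, ?_⟩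
  filter_upwards [hb.eventually_ge_atTop (max x₁ x₀), eventually_gt_atTop 1] with n hn hn1 x hx
  have hbx₁ : x₁ ≤ quantile μ n := (le_max_left _ _).trans hn
  have hbx₀ : x₀ ≤ quantile μ n := (le_max_right _ _).trans hn
  have hb0 : 0 < quantile μ n := hx₀pos.trans_le hbx₀
  have hone := mul_rightTail_quantile_le_one (μ := μ) hn1
  have hn0 : 0 < n := by linarith
  have hxβ : 0 < x ^ (-β) := Real.rpow_pos_of_pos hx _
  have hxγ : 0 < x ^ (-γ) := Real.rpow_pos_of_pos hx _
  have h2β : (0 : ℝ) < 2 ^ β := by positivity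
  have h2γ : (0 : ℝ) < 2 ^ γ := by positivity
  have h2γF : (0 : ℝ) < 2 ^ γ / rightTail μ x₀ := by positivity
  rw [scaledTail]
  rcases le_total 1 x with h1x | hx1
  · have h := hup _ (quantile μ n * x) hbx₁ (le_mul_of_one_le_right hb0.le h1x)
    rw [mul_div_cancel_left₀ _ hb0.ne'] at h
    calc n * rightTail μ (quantile μ n * x)
        ≤ n * ((2 : ℝ) ^ β * x ^ (-β) * rightTail μ (quantile μ n)) := by gcongr
      _ = (2 : ℝ) ^ β * x ^ (-β) * (n * rightTail μ (quantile μ n)) := by ring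
      _ ≤ (2 : ℝ) ^ β * x ^ (-β) * 1 := by gcongr
      _ ≤ _ := by nlinarith [mul_pos h2β hxγ, mul_pos h2γ hxβ, mul_pos h2γF hxβ,
                    mul_pos h2γF hxγ, mul_pos h2γ hxγ]
  · rcases le_total x₀ (quantile μ n * x) with hge | hle
    · have h := hlow (quantile μ n) _ ((le_max_left _ _).trans hge)
        (mul_le_of_le_one_right hb0.le hx1)
      rw [mul_div_cancel_left₀ _ hb0.ne'] at h
      calc n * rightTail μ (quantile μ n * x)
          ≤ n * ((2 : ℝ) ^ γ * x ^ (-γ) * rightTail μ (quantile μ n)) := by gcongr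
        _ = (2 : ℝ) ^ γ * x ^ (-γ) * (n * rightTail μ (quantile μ n)) := by ring
        _ ≤ (2 : ℝ) ^ γ * x ^ (-γ) * 1 := by gcongr
        _ ≤ _ := by nlinarith [mul_pos h2β hxγ, mul_pos h2γ hxβ, mul_pos h2γF hxβ,
                    mul_pos h2γF hxγ, mul_pos h2β hxβ]
    · have h := hlow (quantile μ n) x₀ (le_max_left _ _) hbx₀
      have hxle : x ≤ x₀ / quantile μ n := by rwa [le_div_iff₀ hb0, mul_comm]
      have hpow : (x₀ / quantile μ n) ^ (-γ) ≤ x ^ (-γ) :=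
        Real.rpow_le_rpow_of_nonpos hx hxle (by linarith)
      have hn' : n * rightTail μ x₀ ≤ 2 ^ γ * x ^ (-γ) := by
        calc n * rightTail μ x₀
            ≤ n * ((2 : ℝ) ^ γ * (x₀ / quantile μ n) ^ (-γ) * rightTail μ (quantile μ n)) := by
              gcongr
          _ = (2 : ℝ) ^ γ * (x₀ / quantile μ n) ^ (-γ) * (n * rightTail μ (quantile μ n)) := by
              ring
          _ ≤ (2 : ℝ) ^ γ * x ^ (-γ) * 1 := by
              have := mul_nonneg hn0.le (rightTail_nonneg μ (quantile μ n))
              gcongr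
          _ = _ := by ring
      have hn'' : n ≤ 2 ^ γ / rightTail μ x₀ * x ^ (-γ) := by
        rw [div_mul_eq_mul_div, le_div_iff₀ hF₀]; exact hn'
      calc n * rightTail μ (quantile μ n * x) ≤ n * 1 := by
            gcongr; exact rightTail_le_one _ _
        _ ≤ 2 ^ γ / rightTail μ x₀ * x ^ (-γ) := by linarith
        _ ≤ _ := by nlinarith [mul_pos h2β hxγ, mul_pos h2γ hxβ, mul_pos h2γF hxβ,
                    mul_pos h2γ hxγ, mul_pos h2β hxβ]

/-! ### The integral that produces the stable exponent -/

/-- Euler's integral with a complex rate: both sides are analytic in the right half plane and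
agree on the positive real axis. -/
theorem integral_rpow_mul_cexp_neg_mul {a : ℝ} (ha : 0 < a) {s : ℂ} (hs : 0 < s.re) :
    ∫ x in Set.Ioi (0 : ℝ), ((x ^ (a - 1) : ℝ) : ℂ) * Complex.exp (-(s * x))
      = s ^ (-(a : ℂ)) * (Real.Gamma a : ℂ) := by
  set μ : Measure ℝ := (volume.restrict (Set.Ioi 0)).withDensity
    (fun x => ENNReal.ofReal (x ^ (a - 1))) with hμ
  have hmgf : ∀ z : ℂ, complexMGF id μ z
      = ∫ x in Set.Ioi (0 : ℝ), ((x ^ (a - 1) : ℝ) : ℂ) * Complex.exp (z * x) := fun z => by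
    rw [complexMGF, hμ, integral_withDensity_eq_integral_toReal_smul (by fun_prop)
      (ae_of_all _ fun _ => ENNReal.ofReal_lt_top)]
    refine setIntegral_congr_fun measurableSet_Ioi fun x hx => ?_
    have hx0 : (0 : ℝ) < x := hx
    simp only [id]
    rw [ENNReal.toReal_ofReal (by positivity), Complex.real_smul]
  have hset : Set.Iio (0 : ℝ) ⊆ integrableExpSet id μ := fun t ht => by
    have ht0 : t < 0 := ht
    simp only [integrableExpSet, Set.mem_ofPred_eq, id]
    rw [hμ, integrable_withDensity_iff_integrable_smul' (by fun_prop)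
      (ae_of_all _ fun _ => ENNReal.ofReal_lt_top)]
    have h := integrableOn_rpow_mul_exp_neg_mul_rpow (p := 1) (s := a - 1) (b := -t)
      (by linarith) zero_lt_one (by linarith)
    refine IntegrableOn.congr_fun h (fun x hx => ?_) measurableSet_Ioi
    have hx0 : (0 : ℝ) < x := hx
    simp only [smul_eq_mul]
    rw [ENNReal.toReal_ofReal (by positivity), Real.rpow_one, neg_neg]
  have hU : IsPreconnected {z : ℂ | z.re < 0} := (convex_halfSpace_re_lt 0).isPreconnected
  have hf : AnalyticOnNhd ℂ (complexMGF id μ) {z : ℂ | z.re < 0} :=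
    analyticOnNhd_complexMGF.mono fun z hz =>
      interior_mono hset (by rw [isOpen_Iio.interior_eq]; exact hz)
  have hg : AnalyticOnNhd ℂ (fun z : ℂ => (-z) ^ (-(a : ℂ)) * (Real.Gamma a : ℂ))
      {z : ℂ | z.re < 0} := fun z hz => by
    have : -z ∈ Complex.slitPlane := Or.inl (by simpa using hz)
    exact (analyticAt_id.neg.cpow analyticAt_const this).mul analyticAt_const
  have hreal : ∀ r : ℝ, 0 < r → complexMGF id μ (-(r : ℂ))
      = (-(-(r : ℂ))) ^ (-(a : ℂ)) * (Real.Gamma a : ℂ) := fun r hr => by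
    have h := Complex.integral_cpow_mul_exp_neg_mul_Ioi (a := a) (by simpa using ha) hr
    rw [hmgf, neg_neg, ← Complex.Gamma_ofReal]
    rw [one_div, Complex.inv_cpow _ _ (by
      rw [Complex.arg_ofReal_of_nonneg hr.le]; exact Real.pi_pos.ne), ← Complex.cpow_neg] at h
    rw [← h]
    refine setIntegral_congr_fun measurableSet_Ioi fun x hx => ?_
    have hx0 : (0 : ℝ) < x := hx
    rw [Complex.ofReal_cpow hx0.le]
    push_cast
    ring_nf
  have hfreq : ∃ᶠ z in 𝓝[≠] (-1 : ℂ), complexMGF id μ z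
      = (-z) ^ (-(a : ℂ)) * (Real.Gamma a : ℂ) := by
    have ht : Tendsto (fun r : ℝ => -(r : ℂ)) (𝓝[≠] 1) (𝓝[≠] (-1 : ℂ)) := by
      refine tendsto_nhdsWithin_iff.2 ⟨?_, ?_⟩
      · have : Tendsto (fun r : ℝ => -(r : ℂ)) (𝓝 1) (𝓝 (-((1 : ℝ) : ℂ))) :=
          (by fun_prop : Continuous fun r : ℝ => -(r : ℂ)).tendsto 1
        simpa using this.mono_left nhdsWithin_le_nhds
      · filter_upwards [self_mem_nhdsWithin] with r hr
        simp only [Set.mem_compl_iff, Set.mem_singleton_iff, neg_inj] at hr ⊢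
        exact_mod_cast hr
    refine ht.frequently (Eventually.frequently ?_)
    filter_upwards [nhdsWithin_le_nhds (Ioi_mem_nhds (zero_lt_one' ℝ))] with r hr
      using hreal r hr
  have key := hf.eqOn_of_preconnected_of_frequently_eq hg hU
    (show (-1 : ℂ) ∈ {z : ℂ | z.re < 0} by simp) hfreq
    (show -s ∈ {z : ℂ | z.re < 0} by simpa using hs)
  simp only [neg_neg] at key
  rw [← key, hmgf]
  simp only [neg_mul]

theorem norm_cexp_sub_one_le_of_re_nonpos {w : ℂ} (hw : w.re ≤ 0) :
    ‖Complex.exp w - 1‖ ≤ ‖w‖ := by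
  have h := (convex_halfSpace_re_le 0).norm_image_sub_le_of_norm_hasDerivWithin_le
    (f := Complex.exp) (f' := Complex.exp) (C := 1) (x := 0) (y := w)
    (fun z _ => (Complex.hasDerivAt_exp z).hasDerivWithinAt)
    (fun z hz => by
      rw [Complex.norm_exp]; exact Real.exp_le_one_iff.2 hz) (by simp) hw
  simpa using h

theorem norm_cexp_sub_one_le_two {w : ℂ} (hw : w.re ≤ 0) : ‖Complex.exp w - 1‖ ≤ 2 := by
  refine (norm_sub_le _ _).trans ?_
  rw [Complex.norm_exp, norm_one]
  linarith [Real.exp_le_one_iff.2 hw]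

theorem integrableOn_rpow_mul_min {α : ℝ} (hα : 1 < α ∧ α < 2) (K : ℝ) (hK : 0 ≤ K) :
    IntegrableOn (fun x : ℝ => x ^ (-α) * min 2 (K * x)) (Set.Ioi 0) := by
  rw [← Set.Ioc_union_Ioi_eq_Ioi (zero_le_one' ℝ)]
  refine IntegrableOn.union ?_ ?_
  · have h : IntegrableOn (fun x : ℝ => K * x ^ (1 - α)) (Set.Ioc 0 1) :=
      ((intervalIntegrable_iff_integrableOn_Ioc_of_le zero_le_one).1
        (intervalIntegral.intervalIntegrable_rpow' (by linarith))).const_mul K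
    refine Integrable.mono' h (by fun_prop) ?_
    filter_upwards [ae_restrict_mem measurableSet_Ioc] with x hx
    have hx0 : 0 < x := hx.1
    rw [Real.norm_of_nonneg (by positivity)]
    calc x ^ (-α) * min 2 (K * x) ≤ x ^ (-α) * (K * x) := by gcongr; exact min_le_right _ _
      _ = K * (x ^ (-α) * x ^ (1 : ℝ)) := by rw [Real.rpow_one]; ring
      _ = K * x ^ (1 - α) := by rw [← Real.rpow_add hx0]; ring_nf
  · have h : IntegrableOn (fun x : ℝ => x ^ (-α) * 2) (Set.Ioi 1) :=
      (integrableOn_Ioi_rpow_of_lt (by linarith) zero_lt_one).mul_const 2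
    refine Integrable.mono' h (by fun_prop) ?_
    filter_upwards [ae_restrict_mem measurableSet_Ioi] with x hx
    have hx0 : 0 < x := zero_lt_one.trans hx
    rw [Real.norm_of_nonneg (by positivity)]
    gcongr
    exact min_le_left _ _

theorem norm_rpow_mul_cexp_sub_one_le {α K : ℝ} {s : ℂ} (hs : 0 ≤ s.re) (hK : ‖s‖ ≤ K)
    {x : ℝ} (hx : 0 < x) :
    ‖((x ^ (-α) : ℝ) : ℂ) * (Complex.exp (-(s * x)) - 1)‖ ≤ x ^ (-α) * min 2 (K * x) := by
  have hre : (-(s * (x : ℂ))).re ≤ 0 := by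
    simp only [Complex.neg_re, Complex.re_mul_ofReal]
    nlinarith
  rw [norm_mul, Complex.norm_real, Real.norm_of_nonneg (by positivity)]
  gcongr
  refine le_min (norm_cexp_sub_one_le_two hre) ((norm_cexp_sub_one_le_of_re_nonpos hre).trans ?_)
  rw [norm_neg, norm_mul, Complex.norm_real, Real.norm_of_nonneg hx.le]
  gcongr

/-- Integration by parts reduces the compensated integral to Euler's integral. -/
theorem integral_rpow_mul_cexp_sub_one {α : ℝ} (hα : 1 < α ∧ α < 2) {s : ℂ} (hs : 0 < s.re) :
    ∫ x in Set.Ioi (0 : ℝ), ((x ^ (-α) : ℝ) : ℂ) * (Complex.exp (-(s * x)) - 1)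
      = -((Real.Gamma (2 - α) / (α - 1) : ℝ) : ℂ) * s ^ ((α : ℂ) - 1) := by
  have hs0 : s ≠ 0 := fun h => by simp [h] at hs
  have h1α : ((1 - α : ℝ) : ℂ) ≠ 0 := by exact_mod_cast (by linarith : (1 - α : ℝ) ≠ 0)
  have hdv : ∀ x ∈ Set.Ioi (0 : ℝ), HasDerivAt
      (fun x : ℝ => ((x ^ (1 - α) / (1 - α) : ℝ) : ℂ)) (((x ^ (-α) : ℝ) : ℂ)) x := fun x hx => by
    have hx0 : (0 : ℝ) < x := hx
    have h := ((Real.hasDerivAt_rpow_const (x := x) (p := 1 - α) (Or.inl hx0.ne')).div_const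
      (1 - α)).ofReal_comp
    convert h using 2
    rw [mul_div_cancel_left₀ _ (by linarith : (1 - α : ℝ) ≠ 0)]
    ring_nf
  have hdu : ∀ x ∈ Set.Ioi (0 : ℝ), HasDerivAt
      (fun x : ℝ => Complex.exp (-(s * x)) - 1) (-s * Complex.exp (-(s * x))) x := fun x hx => by
    have h : HasDerivAt (fun z : ℂ => Complex.exp (-(s * z)) - 1)
        (Complex.exp (-(s * x)) * (-(s * 1))) (x : ℂ) :=
      (((hasDerivAt_id _).const_mul s).neg.cexp).sub_const 1
    convert h.comp_ofReal using 1
    ring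
  have hint1 : IntegrableOn ((fun x : ℝ => Complex.exp (-(s * x)) - 1) *
      fun x : ℝ => ((x ^ (-α) : ℝ) : ℂ)) (Set.Ioi 0) := by
    refine Integrable.mono' (integrableOn_rpow_mul_min hα ‖s‖ (norm_nonneg _))
      (by fun_prop) ?_
    filter_upwards [ae_restrict_mem measurableSet_Ioi] with x hx
    rw [Pi.mul_apply, mul_comm]
    exact norm_rpow_mul_cexp_sub_one_le hs.le le_rfl hx
  have hint2 : IntegrableOn ((fun x : ℝ => -s * Complex.exp (-(s * x))) *
      fun x : ℝ => ((x ^ (1 - α) / (1 - α) : ℝ) : ℂ)) (Set.Ioi 0) := by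
    have h := (integrableOn_rpow_mul_exp_neg_mul_rpow (p := 1) (s := 1 - α) (b := s.re)
      (by linarith [hα.2]) zero_lt_one hs).const_mul (‖s‖ / (α - 1))
    refine Integrable.mono' h (by fun_prop) ?_
    filter_upwards [ae_restrict_mem measurableSet_Ioi] with x hx
    have hx0 : (0 : ℝ) < x := hx
    have : |1 - α| = α - 1 := by rw [abs_sub_comm, abs_of_pos]; linarith [hα.1]
    rw [Pi.mul_apply, norm_mul, norm_mul, norm_neg, Complex.norm_exp, Complex.norm_real,
      norm_div, Real.norm_of_nonneg (Real.rpow_nonneg hx0.le _), Real.norm_eq_abs, this]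
    simp only [Complex.neg_re, Complex.re_mul_ofReal, Real.rpow_one]
    apply le_of_eq
    ring_nf
  have hbound : ∀ x : ℝ, 0 < x → ‖(Complex.exp (-(s * x)) - 1) *
      ((x ^ (1 - α) / (1 - α) : ℝ) : ℂ)‖ ≤ min 2 (‖s‖ * x) * (x ^ (1 - α) / (α - 1)) := by
    intro x hx
    have : |1 - α| = α - 1 := by rw [abs_sub_comm, abs_of_pos]; linarith [hα.1]
    have h := norm_rpow_mul_cexp_sub_one_le (α := 0) hs.le le_rfl hx
    simp only [neg_zero, Real.rpow_zero, Complex.ofReal_one, one_mul] at h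
    rw [norm_mul, Complex.norm_real, norm_div, Real.norm_of_nonneg (Real.rpow_nonneg hx.le _),
      Real.norm_eq_abs, this]
    have : 0 < α - 1 := by linarith [hα.1]
    gcongr
  have hα1 : 0 < α - 1 := by linarith [hα.1]
  have hzero : Tendsto ((fun x : ℝ => Complex.exp (-(s * x)) - 1) *
      fun x : ℝ => ((x ^ (1 - α) / (1 - α) : ℝ) : ℂ)) (𝓝[>] 0) (𝓝 0) := by
    have hlim : Tendsto (fun x : ℝ => ‖s‖ / (α - 1) * x ^ (2 - α)) (𝓝[>] 0) (𝓝 0) := by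
      have h : Tendsto (fun x : ℝ => ‖s‖ / (α - 1) * x ^ (2 - α)) (𝓝 0)
          (𝓝 (‖s‖ / (α - 1) * 0 ^ (2 - α))) :=
        ((Real.continuousAt_rpow_const 0 (2 - α) (Or.inr (by linarith))).tendsto).const_mul _
      rw [Real.zero_rpow (by linarith), mul_zero] at h
      exact h.mono_left nhdsWithin_le_nhds
    refine squeeze_zero_norm' ?_ hlim
    filter_upwards [self_mem_nhdsWithin] with x hx
    have hx0 : (0 : ℝ) < x := hx
    refine (hbound x hx0).trans ?_
    calc min 2 (‖s‖ * x) * (x ^ (1 - α) / (α - 1))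
        ≤ (‖s‖ * x) * (x ^ (1 - α) / (α - 1)) := by gcongr; exact min_le_right _ _
      _ = ‖s‖ / (α - 1) * (x ^ (1 : ℝ) * x ^ (1 - α)) := by rw [Real.rpow_one]; ring
      _ = _ := by rw [← Real.rpow_add hx0]; ring_nf
  have hinfty : Tendsto ((fun x : ℝ => Complex.exp (-(s * x)) - 1) *
      fun x : ℝ => ((x ^ (1 - α) / (1 - α) : ℝ) : ℂ)) atTop (𝓝 0) := by
    have hlim : Tendsto (fun x : ℝ => 2 / (α - 1) * x ^ (-(α - 1))) atTop (𝓝 0) := by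
      simpa using (tendsto_rpow_neg_atTop hα1).const_mul (2 / (α - 1))
    refine squeeze_zero_norm' ?_ hlim
    filter_upwards [eventually_gt_atTop 0] with x hx0
    refine (hbound x hx0).trans ?_
    calc min 2 (‖s‖ * x) * (x ^ (1 - α) / (α - 1))
        ≤ 2 * (x ^ (1 - α) / (α - 1)) := by gcongr; exact min_le_left _ _
      _ = _ := by ring_nf
  have hparts := integral_Ioi_mul_deriv_eq_deriv_mul hdu hdv hint1 hint2 hzero hinfty
  have hG := integral_rpow_mul_cexp_neg_mul (a := 2 - α) (by linarith) hs
  have hpow : s ^ ((α : ℂ) - 1) = s * s ^ (-((2 - α : ℝ) : ℂ)) := by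
    nth_rewrite 2 [← Complex.cpow_one s]
    rw [← Complex.cpow_add _ _ hs0]
    congr 1; push_cast; ring
  calc ∫ x in Set.Ioi (0 : ℝ), ((x ^ (-α) : ℝ) : ℂ) * (Complex.exp (-(s * x)) - 1)
      = ∫ x in Set.Ioi (0 : ℝ), (Complex.exp (-(s * x)) - 1) * ((x ^ (-α) : ℝ) : ℂ) := by
        simp_rw [mul_comm]
    _ = - ∫ x in Set.Ioi (0 : ℝ), -s * Complex.exp (-(s * x)) *
          ((x ^ (1 - α) / (1 - α) : ℝ) : ℂ) := by rw [hparts]; simp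
    _ = (s / ((1 - α : ℝ) : ℂ)) * ∫ x in Set.Ioi (0 : ℝ),
          ((x ^ (2 - α - 1) : ℝ) : ℂ) * Complex.exp (-(s * x)) := by
        rw [← integral_neg, ← integral_const_mul]
        congr 1; ext x
        rw [show 2 - α - 1 = 1 - α by ring]
        push_cast
        ring
    _ = _ := by
        rw [hG, hpow]
        have : ((α : ℂ) - 1) ≠ 0 := by exact_mod_cast hα1.ne'
        push_cast at h1α ⊢
        field_simp
        ring

/-- The boundary case `s = -i`, reached from the half plane by dominated convergence. -/
theorem integral_rpow_mul_cexp_I_sub_one {α : ℝ} (hα : 1 < α ∧ α < 2) :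
    ∫ x in Set.Ioi (0 : ℝ), ((x ^ (-α) : ℝ) : ℂ) * (Complex.exp (Complex.I * x) - 1)
      = -((Real.Gamma (2 - α) / (α - 1) : ℝ) : ℂ) * (-Complex.I) ^ ((α : ℂ) - 1) := by
  have hs : Tendsto (fun δ : ℝ => (δ : ℂ) - Complex.I) (𝓝[>] 0) (𝓝 (-Complex.I)) := by
    have : Tendsto (fun δ : ℝ => (δ : ℂ) - Complex.I) (𝓝 0) (𝓝 (((0 : ℝ) : ℂ) - Complex.I)) :=
      (by fun_prop : Continuous fun δ : ℝ => (δ : ℂ) - Complex.I).tendsto 0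
    rw [Complex.ofReal_zero, zero_sub] at this
    exact this.mono_left nhdsWithin_le_nhds
  have hleft : Tendsto (fun δ : ℝ => ∫ x in Set.Ioi (0 : ℝ), ((x ^ (-α) : ℝ) : ℂ) *
      (Complex.exp (-(((δ : ℂ) - Complex.I) * x)) - 1)) (𝓝[>] 0)
      (𝓝 (∫ x in Set.Ioi (0 : ℝ), ((x ^ (-α) : ℝ) : ℂ) *
        (Complex.exp (-((-Complex.I) * x)) - 1))) := by
    refine tendsto_integral_filter_of_dominated_convergence
      (fun x => x ^ (-α) * min 2 (2 * x)) (Eventually.of_forall fun δ => by fun_prop) ?_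
      (integrableOn_rpow_mul_min hα 2 (by norm_num)) ?_
    · have hI : ∀ᶠ δ : ℝ in 𝓝[>] 0, δ ∈ Set.Ioo (0 : ℝ) 1 := Ioo_mem_nhdsGT (by norm_num)
      filter_upwards [hI] with δ hδ
      filter_upwards [ae_restrict_mem measurableSet_Ioi] with x hx
      refine norm_rpow_mul_cexp_sub_one_le (by simpa using hδ.1.le) ?_ hx
      refine (norm_sub_le _ _).trans ?_
      rw [Complex.norm_real, Complex.norm_I, Real.norm_of_nonneg hδ.1.le]
      linarith [hδ.2]
    · refine ae_of_all _ fun x => ?_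
      have hc : Continuous fun s : ℂ => ((x ^ (-α) : ℝ) : ℂ) * (Complex.exp (-(s * x)) - 1) := by
        fun_prop
      exact (hc.tendsto _).comp hs
  have hright : Tendsto (fun δ : ℝ => -((Real.Gamma (2 - α) / (α - 1) : ℝ) : ℂ) *
      ((δ : ℂ) - Complex.I) ^ ((α : ℂ) - 1)) (𝓝[>] 0)
      (𝓝 (-((Real.Gamma (2 - α) / (α - 1) : ℝ) : ℂ) * (-Complex.I) ^ ((α : ℂ) - 1))) := by
    refine Tendsto.const_mul _ ?_
    have hc : ContinuousAt (fun s : ℂ => s ^ ((α : ℂ) - 1)) (-Complex.I) :=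
      continuousAt_id.cpow continuousAt_const (Or.inr (by simp))
    exact hc.tendsto.comp hs
  have heq := tendsto_nhds_unique (hleft.congr' ?_) hright
  · simpa using heq
  · filter_upwards [self_mem_nhdsWithin] with δ hδ
    exact integral_rpow_mul_cexp_sub_one hα (by simpa using hδ)

/-- The characteristic exponent `-|y| ^ α (1 - i sign(y) tan (π α / 2))` of `S_α(1, 1, 0)`. -/
noncomputable def stableExponent (α y : ℝ) : ℂ :=
  -((|y| ^ α : ℝ) : ℂ) *
    (1 - Complex.I * ((Real.sign y * Real.tan (Real.pi * α / 2) : ℝ) : ℂ))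

theorem stableScale_base_pos {α : ℝ} (hα : 1 < α ∧ α < 2) :
    0 < -Real.cos (Real.pi * α / 2) * Real.Gamma (2 - α) / (α - 1) := by
  have hcos : Real.cos (Real.pi * α / 2) < 0 :=
    Real.cos_neg_of_pi_div_two_lt_of_lt (by nlinarith [Real.pi_pos, hα.1])
      (by nlinarith [Real.pi_pos, hα.2])
  have hG : 0 < Real.Gamma (2 - α) := Real.Gamma_pos_of_pos (by linarith [hα.2])
  exact div_pos (mul_pos (by linarith) hG) (by linarith [hα.1])

theorem stableScale_pos {α : ℝ} (hα : 1 < α ∧ α < 2) : 0 < stableScale α :=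
  Real.rpow_pos_of_pos (stableScale_base_pos hα) _

theorem stableScale_rpow {α : ℝ} (hα : 1 < α ∧ α < 2) :
    stableScale α ^ α = -Real.cos (Real.pi * α / 2) * Real.Gamma (2 - α) / (α - 1) := by
  rw [stableScale, ← Real.rpow_mul (stableScale_base_pos hα).le,
    one_div_mul_cancel (by linarith [hα.1]), Real.rpow_one]

theorem integral_stable_of_pos {α : ℝ} (hα : 1 < α ∧ α < 2) {y : ℝ} (hy : 0 < y) :
    ∫ x in Set.Ioi (0 : ℝ), ((x ^ (-α) : ℝ) : ℂ) *
        (y * Complex.I * (Complex.exp (Complex.I * ((x * y : ℝ) : ℂ)) - 1))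
      = ((stableScale α ^ α : ℝ) : ℂ) * stableExponent α y := by
  have hα1 : α - 1 ≠ 0 := by linarith [hα.1]
  have hcos : Real.cos (Real.pi * α / 2) ≠ 0 := fun h => by
    have := stableScale_base_pos hα
    simp [h] at this
  have hsub := integral_comp_mul_left_Ioi (fun x : ℝ => ((x ^ (-α) : ℝ) : ℂ) *
    (Complex.exp (Complex.I * x) - 1)) 0 hy
  rw [mul_zero, integral_rpow_mul_cexp_I_sub_one hα] at hsub
  have hstep : ∀ x ∈ Set.Ioi (0 : ℝ), ((x ^ (-α) : ℝ) : ℂ) *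
        (y * Complex.I * (Complex.exp (Complex.I * ((x * y : ℝ) : ℂ)) - 1))
      = (Complex.I * ((y ^ (1 + α) : ℝ) : ℂ)) * ((((y * x) ^ (-α) : ℝ) : ℂ) *
        (Complex.exp (Complex.I * ((y * x : ℝ) : ℂ)) - 1)) := fun x hx => by
    have hx0 : (0 : ℝ) < x := hx
    have : x ^ (-α) * y = y ^ (1 + α) * (y * x) ^ (-α) := by
      rw [Real.mul_rpow hy.le hx0.le, ← mul_assoc, ← Real.rpow_add hy]
      simp [mul_comm]
    rw [mul_comm x y]
    calc _ = ((x ^ (-α) * y : ℝ) : ℂ) * (Complex.I *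
          (Complex.exp (Complex.I * ((y * x : ℝ) : ℂ)) - 1)) := by push_cast; ring
      _ = _ := by rw [this]; push_cast; ring
  rw [setIntegral_congr_fun measurableSet_Ioi hstep, integral_const_mul]
  have hI : (-Complex.I) ^ ((α : ℂ) - 1)
      = Complex.I * (((Real.cos (Real.pi * α / 2) : ℝ) : ℂ)
        - Complex.I * ((Real.sin (Real.pi * α / 2) : ℝ) : ℂ)) := by
    rw [Complex.cpow_def_of_ne_zero (neg_ne_zero.2 Complex.I_ne_zero), Complex.log_neg_I]
    have : -(Real.pi / 2 : ℂ) * Complex.I * ((α : ℂ) - 1)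
        = Real.pi / 2 * Complex.I + ((-(Real.pi * α / 2) : ℝ) : ℂ) * Complex.I := by
      push_cast; ring
    rw [this, Complex.exp_add, Complex.exp_pi_div_two_mul_I, Complex.exp_mul_I,
      ← Complex.ofReal_cos, ← Complex.ofReal_sin, Real.cos_neg, Real.sin_neg]
    push_cast; ring
  rw [hsub, hI, stableScale_rpow hα, stableExponent, Real.sign_of_pos hy, abs_of_pos hy,
    Real.tan_eq_sin_div_cos]
  have hypow : y ^ (1 + α) = y * y ^ α := by rw [Real.rpow_add hy, Real.rpow_one]
  rw [hypow, Complex.real_smul]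
  have hcosC : ((Real.cos (Real.pi * α / 2) : ℝ) : ℂ) ≠ 0 := by exact_mod_cast hcos
  have hα1C : ((α : ℂ) - 1) ≠ 0 := by exact_mod_cast hα1
  have hyC : (y : ℂ) ≠ 0 := by exact_mod_cast hy.ne'
  generalize Real.cos (Real.pi * α / 2) = c at *
  generalize Real.sin (Real.pi * α / 2) = d at *
  push_cast
  field_simp
  ring_nf
  rw [Complex.I_pow_three]
  linear_combination (-(((y ^ α : ℝ) : ℂ) * (Real.Gamma (2 - α) : ℂ) * c)) * Complex.I_sq

theorem stableExponent_neg (α y : ℝ) :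
    stableExponent α (-y) = (starRingEnd ℂ) (stableExponent α y) := by
  simp only [stableExponent, Real.sign_neg, abs_neg, map_mul, map_neg, map_sub, map_one,
    Complex.conj_ofReal, Complex.conj_I]
  push_cast; ring

/-- The stable exponent as an integral against the tail `x ^ (-α)` of the Lévy measure. -/
theorem integral_stable {α : ℝ} (hα : 1 < α ∧ α < 2) (y : ℝ) :
    ∫ x in Set.Ioi (0 : ℝ), ((x ^ (-α) : ℝ) : ℂ) *
        (y * Complex.I * (Complex.exp (Complex.I * ((x * y : ℝ) : ℂ)) - 1))
      = ((stableScale α ^ α : ℝ) : ℂ) * stableExponent α y := by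
  rcases lt_trichotomy y 0 with hy | rfl | hy
  · have h := congrArg (starRingEnd ℂ) (integral_stable_of_pos hα (neg_pos.2 hy))
    rw [map_mul, ← stableExponent_neg, neg_neg, Complex.conj_ofReal, ← integral_conj] at h
    rw [← h]
    congr 1; ext x
    simp only [map_mul, map_sub, map_one, Complex.conj_ofReal, Complex.conj_I, ← Complex.exp_conj]
    push_cast
    ring_nf
  · have : (0 : ℝ) ^ α = 0 := Real.zero_rpow (by linarith [hα.1])
    simp [stableExponent, this]
  · exact integral_stable_of_pos hα hy

/-! ### The compensated transform of the rate distribution -/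

/-- `∫ (e ^ (i r y) - 1 - i r y) μ(dr)`. -/
noncomputable def compensatedTransform (μ : Measure ℝ) (y : ℝ) : ℂ :=
  ∫ r, (Complex.exp (Complex.I * ((r * y : ℝ) : ℂ)) - 1 - Complex.I * ((r * y : ℝ) : ℂ)) ∂μ

/-- The derivative of `x ↦ e ^ (i x y) - 1 - i x y`. -/
noncomputable def tailKernel (y x : ℝ) : ℂ :=
  y * Complex.I * (Complex.exp (Complex.I * ((x * y : ℝ) : ℂ)) - 1)

theorem continuous_tailKernel : Continuous fun p : ℝ × ℝ => tailKernel p.1 p.2 := by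
  unfold tailKernel; fun_prop

theorem continuous_tailKernel_right (y : ℝ) : Continuous (tailKernel y) :=
  continuous_tailKernel.comp (by fun_prop : Continuous fun x : ℝ => (y, x))

theorem norm_tailKernel_le {x y : ℝ} (hx : 0 ≤ x) :
    ‖tailKernel y x‖ ≤ |y| * min 2 (|y| * x) := by
  have hre : (Complex.I * ((x * y : ℝ) : ℂ)).re ≤ 0 := by simp
  rw [tailKernel, norm_mul, norm_mul, Complex.norm_I, mul_one, Complex.norm_real,
    Real.norm_eq_abs]
  gcongr
  refine le_min (norm_cexp_sub_one_le_two hre) ((norm_cexp_sub_one_le_of_re_nonpos hre).trans ?_)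
  rw [norm_mul, Complex.norm_I, one_mul, Complex.norm_real, Real.norm_eq_abs, abs_mul,
    abs_of_nonneg hx, mul_comm]

theorem intervalIntegral_tailKernel (y r : ℝ) :
    ∫ x in (0 : ℝ)..r, tailKernel y x
      = Complex.exp (Complex.I * ((r * y : ℝ) : ℂ)) - 1 - Complex.I * ((r * y : ℝ) : ℂ) := by
  have hd : ∀ x ∈ Set.uIcc 0 r, HasDerivAt (fun x : ℝ =>
      Complex.exp (Complex.I * ((x * y : ℝ) : ℂ)) - 1 - Complex.I * ((x * y : ℝ) : ℂ))
      (tailKernel y x) x := fun x _ => by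
    have h0 : HasDerivAt (fun x : ℝ => Complex.I * ((x * y : ℝ) : ℂ))
        (Complex.I * ((1 * y : ℝ) : ℂ)) x :=
      (((hasDerivAt_id x).mul_const y).ofReal_comp).const_mul Complex.I
    refine ((h0.cexp.sub_const 1).sub h0).congr_deriv ?_
    unfold tailKernel; push_cast; ring
  rw [intervalIntegral.integral_eq_sub_of_hasDerivAt hd
    ((continuous_tailKernel_right y).intervalIntegrable _ _)]
  simp

/-- Fubini's theorem expresses the compensated transform through the tail of the distribution. -/
theorem compensatedTransform_eq_integral_rightTail {μ : Measure ℝ} [IsProbabilityMeasure μ]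
    (hpos : ∀ᵐ r ∂μ, 0 < r) (hint : Integrable (fun r => r) μ) (y : ℝ) :
    compensatedTransform μ y
      = ∫ x in Set.Ioi (0 : ℝ), (rightTail μ x : ℂ) * tailKernel y x := by
  set g : ℝ × ℝ → ℂ := fun p => {q : ℝ × ℝ | q.2 < q.1}.indicator (fun q => tailKernel y q.2) p
    with hg
  have hgm : Measurable g :=
    ((continuous_tailKernel_right y).measurable.comp measurable_snd).indicator
      (measurableSet_lt measurable_snd measurable_fst)
  have hslice : ∀ r : ℝ, (fun x => g (r, x)) = (Set.Iio r).indicator (tailKernel y) := fun r => by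
    ext x; simp [hg, Set.indicator]
  have hIio : ∀ r : ℝ, Set.Ioi (0 : ℝ) ∩ Set.Iio r = Set.Ioo 0 r := fun r => by
    ext; simp
  have hbound : ∀ r : ℝ, 0 < r → ∫ x in Set.Ioi (0 : ℝ), ‖g (r, x)‖ ≤ 2 * |y| * r := by
    intro r hr
    have : ∀ x, ‖g (r, x)‖ = (Set.Iio r).indicator (fun x => ‖tailKernel y x‖) x := fun x => by
      rw [← norm_indicator_eq_indicator_norm, ← hslice]
    simp_rw [this]
    rw [setIntegral_indicator measurableSet_Iio, hIio]
    have h := norm_setIntegral_le_of_norm_le_const (μ := volume) (s := Set.Ioo 0 r)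
      (f := fun x => ‖tailKernel y x‖) (C := 2 * |y|) measure_Ioo_lt_top (fun x hx => by
        rw [norm_norm]
        refine (norm_tailKernel_le hx.1.le).trans ?_
        rw [mul_comm]
        gcongr
        exact min_le_left _ _)
    rw [Real.norm_of_nonneg (integral_nonneg fun _ => norm_nonneg _)] at h
    simpa [Measure.real, hr.le] using h
  have hgint : Integrable g (μ.prod (volume.restrict (Set.Ioi 0))) := by
    rw [integrable_prod_iff hgm.aestronglyMeasurable]
    constructor
    · refine ae_of_all _ fun r => ?_
      rw [hslice, integrable_indicator_iff measurableSet_Iio, IntegrableOn,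
        Measure.restrict_restrict measurableSet_Iio, Set.inter_comm, hIio]
      exact ((continuous_tailKernel_right y).integrableOn_Icc).mono_set Set.Ioo_subset_Icc_self
    · refine Integrable.mono' (hint.const_mul (2 * |y|))
        hgm.norm.aestronglyMeasurable.integral_prod_right' ?_
      filter_upwards [hpos] with r hr
      rw [Real.norm_of_nonneg (integral_nonneg fun _ => norm_nonneg _)]
      exact hbound r hr
  calc compensatedTransform μ y = ∫ r, (∫ x in Set.Ioi (0 : ℝ), g (r, x)) ∂μ := by
        rw [compensatedTransform]
        refine integral_congr_ae ?_
        filter_upwards [hpos] with r hr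
        rw [← intervalIntegral_tailKernel]
        simp only [hslice]
        rw [setIntegral_indicator measurableSet_Iio, hIio,
          intervalIntegral.integral_of_le hr.le, integral_Ioc_eq_integral_Ioo]
    _ = ∫ x in Set.Ioi (0 : ℝ), ∫ r, g (r, x) ∂μ :=
        integral_integral_swap (f := fun r x => g (r, x)) hgint
    _ = _ := by
        refine setIntegral_congr_fun measurableSet_Ioi fun x _ => ?_
        have : (fun r => g (r, x)) = (Set.Ioi x).indicator (fun _ => tailKernel y x) := by
          ext r; simp [hg, Set.indicator]
        simp only [this]
        rw [integral_indicator_const _ measurableSet_Ioi, ← rightTail_eq_real,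
          Complex.real_smul]

/-- `n ∫ (e ^ (i r y / b(n)) - 1 - i r y / b(n)) μ(dr)`, the rescaled compensated transform. -/
noncomputable def scaledTransform (μ : Measure ℝ) (n y : ℝ) : ℂ :=
  n * compensatedTransform μ (y / quantile μ n)

theorem scaledTransform_eq_integral {μ : Measure ℝ} [IsProbabilityMeasure μ]
    (hpos : ∀ᵐ r ∂μ, 0 < r) (hint : Integrable (fun r => r) μ) {n : ℝ}
    (hb : 0 < quantile μ n) (y : ℝ) :
    scaledTransform μ n y
      = ∫ x in Set.Ioi (0 : ℝ), (scaledTail μ n x : ℂ) * tailKernel y x := by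
  rw [scaledTransform, compensatedTransform_eq_integral_rightTail hpos hint]
  have h := integral_comp_mul_left_Ioi (fun x : ℝ => (rightTail μ x : ℂ) *
    tailKernel (y / quantile μ n) x) 0 hb
  rw [mul_zero] at h
  have hbC : (quantile μ n : ℂ) ≠ 0 := by exact_mod_cast hb.ne'
  rw [eq_inv_smul_iff₀ hb.ne', Complex.real_smul] at h
  rw [← h, ← mul_assoc, ← integral_const_mul]
  congr 1; ext x
  have hxy : quantile μ n * x * (y / quantile μ n) = x * y := by field_simp
  simp only [scaledTail, tailKernel, hxy]
  push_cast
  field_simp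

theorem integral_rpow_mul_min_scale (β : ℝ) {y : ℝ} (hy : 0 < y) :
    ∫ x in Set.Ioi (0 : ℝ), x ^ (-β) * (y * min 2 (y * x))
      = y ^ β * ∫ x in Set.Ioi (0 : ℝ), x ^ (-β) * min 2 x := by
  have h := integral_comp_mul_left_Ioi (fun x : ℝ => x ^ (-β) * min 2 x) 0 hy
  rw [mul_zero, eq_inv_smul_iff₀ hy.ne', smul_eq_mul] at h
  rw [← h, ← integral_const_mul, ← integral_const_mul]
  refine setIntegral_congr_fun measurableSet_Ioi fun x hx => ?_
  have hx0 : (0 : ℝ) < x := hx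
  rw [Real.mul_rpow hy.le hx0.le, Real.rpow_neg hy.le]
  have : y ^ β ≠ 0 := (Real.rpow_pos_of_pos hy _).ne'
  field_simp

theorem integrableOn_tail_majorant {β γ : ℝ} (hβ : 1 < β ∧ β < 2) (hγ : 1 < γ ∧ γ < 2)
    (C : ℝ) {y : ℝ} (hy : 0 ≤ y) :
    IntegrableOn (fun x : ℝ => C * (x ^ (-β) + x ^ (-γ)) * (y * min 2 (y * x))) (Set.Ioi 0) := by
  have h := ((integrableOn_rpow_mul_min hβ y hy).add
    (integrableOn_rpow_mul_min hγ y hy)).const_mul (C * y)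
  refine h.congr (ae_of_all _ fun x => ?_)
  simp only [Pi.add_apply]; ring

theorem scaledTail_nonneg (μ : Measure ℝ) {n : ℝ} (hn : 0 ≤ n) (x : ℝ) :
    0 ≤ scaledTail μ n x :=
  mul_nonneg hn (rightTail_nonneg _ _)

theorem measurable_scaledTail (μ : Measure ℝ) (n : ℝ) : Measurable (scaledTail μ n) :=
  ((rightTail_antitone μ).measurable.comp (measurable_const_mul _)).const_mul n

/-- A bound on the rescaled transforms that does not depend on `n`. -/
theorem exists_norm_scaledTransform_le {μ : Measure ℝ} [IsProbabilityMeasure μ]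
    (hpos : ∀ᵐ r ∂μ, 0 < r) {α β γ : ℝ} (hμ : RegVar (rightTail μ) (-α))
    (hβ1 : 1 < β) (hβ : β < α) (hγ : α < γ) (hγ2 : γ < 2) :
    ∃ C : ℝ, 0 < C ∧ ∀ᶠ n in atTop, ∀ y,
      ‖scaledTransform μ n y‖ ≤ C * (|y| ^ β + |y| ^ γ) := by
  have hint : Integrable (fun r => r) μ := by
    simpa using integrable_rpow_of_regVar hpos hμ zero_lt_one (by linarith)
  have hμ0 := cdf_zero_of_ae_pos hpos
  obtain ⟨C, hC, hev⟩ := exists_scaledTail_le hμ (by linarith) hβ hγ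
  set c : ℝ → ℝ := fun β => ∫ x in Set.Ioi (0 : ℝ), x ^ (-β) * min 2 x
  have hc : ∀ β, 0 ≤ c β := fun β => setIntegral_nonneg measurableSet_Ioi fun x hx => by
    have : (0 : ℝ) < x := hx
    positivity
  refine ⟨C * (c β + c γ + 1), by have := hc β; have := hc γ; positivity, ?_⟩
  filter_upwards [hev, (tendsto_quantile_atTop hμ).eventually_gt_atTop 0,
    eventually_gt_atTop 0] with n hn hb hn0 y
  rw [scaledTransform_eq_integral hpos hint hb]
  rcases eq_or_ne y 0 with rfl | hy
  · simp only [tailKernel, Complex.ofReal_zero, zero_mul, mul_zero, integral_zero, norm_zero]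
    have := hc β; have := hc γ
    positivity
  have hy0 : 0 < |y| := abs_pos.2 hy
  have hβ2 : 1 < β ∧ β < 2 := ⟨hβ1, by linarith⟩
  have hγ12 : 1 < γ ∧ γ < 2 := ⟨by linarith, hγ2⟩
  refine (norm_integral_le_of_norm_le (integrableOn_tail_majorant hβ2 hγ12 C hy0.le) ?_).trans ?_
  · filter_upwards [ae_restrict_mem measurableSet_Ioi] with x hx
    have hx0 : (0 : ℝ) < x := hx
    rw [norm_mul, Complex.norm_real, Real.norm_of_nonneg (scaledTail_nonneg μ hn0.le x)]
    gcongr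
    · exact hn x hx0
    · exact norm_tailKernel_le hx0.le
  · have hsplit : ∫ x in Set.Ioi (0 : ℝ), C * (x ^ (-β) + x ^ (-γ)) * (|y| * min 2 (|y| * x))
        = C * (|y| ^ β * c β + |y| ^ γ * c γ) := by
      rw [← integral_rpow_mul_min_scale β hy0, ← integral_rpow_mul_min_scale γ hy0,
        ← integral_add, ← integral_const_mul]
      · congr 1; ext x; ring
      · refine ((integrableOn_rpow_mul_min hβ2 |y| hy0.le).const_mul |y|).congr
          (ae_of_all _ fun x => ?_)
        simp only; ring
      · refine ((integrableOn_rpow_mul_min hγ12 |y| hy0.le).const_mul |y|).congr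
          (ae_of_all _ fun x => ?_)
        simp only; ring
    rw [hsplit, mul_assoc]
    have h1 := hc β
    have h2 := hc γ
    have h3 : 0 ≤ |y| ^ β := by positivity
    have h4 : 0 ≤ |y| ^ γ := by positivity
    gcongr
    nlinarith [mul_nonneg h1 h4, mul_nonneg h2 h3, mul_nonneg h1 h3, mul_nonneg h2 h4]

/-- The rescaled transforms converge continuously to the exponent of the stable law with
Lévy measure `α x ^ (-α - 1) dx`. -/
theorem tendsto_scaledTransform {μ : Measure ℝ} [IsProbabilityMeasure μ]
    (hpos : ∀ᵐ r ∂μ, 0 < r) {α : ℝ} (hα : 1 < α ∧ α < 2) (hμ : RegVar (rightTail μ) (-α))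
    {ι : Type*} {l : Filter ι} [l.IsCountablyGenerated] {n y : ι → ℝ} {y₀ : ℝ}
    (hn : Tendsto n l atTop) (hy : Tendsto y l (𝓝 y₀)) :
    Tendsto (fun i => scaledTransform μ (n i) (y i)) l
      (𝓝 (((stableScale α ^ α : ℝ) : ℂ) * stableExponent α y₀)) := by
  have hint : Integrable (fun r => r) μ := by
    simpa using integrable_rpow_of_regVar hpos hμ zero_lt_one (by linarith)
  have hμ0 := cdf_zero_of_ae_pos hpos
  obtain ⟨β, hβ1, hβ⟩ := exists_between hα.1
  obtain ⟨γ, hγ, hγ2⟩ := exists_between hα.2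
  obtain ⟨C, hC, hev⟩ := exists_scaledTail_le hμ (by linarith) hβ hγ
  have hlim : Tendsto (fun i => ∫ x in Set.Ioi (0 : ℝ),
      (scaledTail μ (n i) x : ℂ) * tailKernel (y i) x) l
      (𝓝 (∫ x in Set.Ioi (0 : ℝ), ((x ^ (-α) : ℝ) : ℂ) * tailKernel y₀ x)) := by
    refine tendsto_integral_filter_of_dominated_convergence
      (fun x => C * (x ^ (-β) + x ^ (-γ)) * ((|y₀| + 1) * min 2 ((|y₀| + 1) * x)))
      (Eventually.of_forall fun i => ?_) ?_
      (integrableOn_tail_majorant ⟨hβ1, by linarith⟩ ⟨by linarith, hγ2⟩ C (by positivity)) ?_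
    · exact ((Complex.measurable_ofReal.comp (measurable_scaledTail μ _)).mul
        (continuous_tailKernel_right _).measurable).aestronglyMeasurable
    · have hyb : ∀ᶠ i in l, |y i| < |y₀| + 1 :=
        hy.abs.eventually_lt_const (lt_add_one _)
      filter_upwards [hn.eventually hev, hyb, hn.eventually_gt_atTop 0] with i h1 h2 h3
      filter_upwards [ae_restrict_mem measurableSet_Ioi] with x hx
      have hx0 : (0 : ℝ) < x := hx
      rw [norm_mul, Complex.norm_real, Real.norm_of_nonneg (scaledTail_nonneg μ h3.le x)]
      refine mul_le_mul (h1 x hx0) ((norm_tailKernel_le hx0.le).trans ?_) (norm_nonneg _)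
        (by positivity)
      gcongr
    · filter_upwards [ae_restrict_mem measurableSet_Ioi] with x hx
      have h1 : Tendsto (fun i => scaledTail μ (n i) x) l (𝓝 (x ^ (-α))) :=
        (tendsto_scaledTail hμ0 hμ hx).comp hn
      have h2 : Tendsto (fun y => tailKernel y x) (𝓝 y₀) (𝓝 (tailKernel y₀ x)) :=
        (continuous_tailKernel.comp (by fun_prop : Continuous fun y : ℝ => (y, x))).tendsto y₀
      exact h1.ofReal.mul (h2.comp hy)
  rw [← integral_stable hα y₀]
  refine hlim.congr' ?_
  filter_upwards [hn.eventually ((tendsto_quantile_atTop hμ).eventually_gt_atTop 0)] with i hi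
  rw [scaledTransform_eq_integral hpos hint hi]

/-! ### Integrals with respect to Poisson random measures -/

theorem lintegral_natCast_poissonMeasure (r : ℝ≥0) :
    ∫⁻ k : ℕ, (k : ℝ≥0∞) ∂(poissonMeasure r) = r := by
  have h1 := (hasSum_one_poissonMeasure r).tsum_eq
  have hterm : ∀ k : ℕ, ENNReal.ofReal (Real.exp (-r) * r ^ (k + 1) / (k + 1).factorial)
      * ((k + 1 : ℕ) : ℝ≥0∞) = r * ENNReal.ofReal (Real.exp (-r) * r ^ k / k.factorial) := by
    intro k
    rw [← ENNReal.ofReal_natCast, ← ENNReal.ofReal_mul (by positivity),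
      ← ENNReal.ofReal_coe_nnreal, ← ENNReal.ofReal_mul (by positivity)]
    congr 1
    rw [Nat.factorial_succ]
    push_cast
    have : (k.factorial : ℝ) ≠ 0 := by positivity
    field_simp
    ring
  rw [poissonMeasure, lintegral_sum_measure]
  simp only [lintegral_smul_measure, lintegral_dirac, smul_eq_mul]
  rw [tsum_eq_zero_add' ENNReal.summable]
  simp_rw [hterm]
  rw [ENNReal.tsum_mul_left, ← ENNReal.ofReal_tsum_of_nonneg (fun n => by positivity)
    (hasSum_one_poissonMeasure r).summable, h1]
  simp

section Poisson

variable {Ω E : Type*} [MeasurableSpace Ω] [MeasurableSpace E] {P : Measure Ω}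
  {N : Ω → Measure E} {m : Measure E}

theorem IsPoissonRandomMeasure.integral_cexp_count (hN : IsPoissonRandomMeasure P N m) {A : Set E}
    (hA : MeasurableSet A) (hm : m A ≠ ∞) (y : ℝ) :
    ∫ ω, Complex.exp (Complex.I * (((N ω A).toReal * y : ℝ) : ℂ)) ∂P
      = Complex.exp ((m.real A : ℂ) * (Complex.exp (Complex.I * y) - 1)) := by
  have hmeas : Measurable fun ω => N ω A := (Measure.measurable_coe hA).comp hN.measurable
  have hc : Measurable fun x : ℝ≥0∞ => Complex.exp (Complex.I * ((x.toReal * y : ℝ) : ℂ)) := by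
    fun_prop
  have h := integral_map (μ := P) hmeas.aemeasurable hc.aestronglyMeasurable
  rw [← h, hN.poisson A hA hm, integral_map (by fun_prop) hc.aestronglyMeasurable]
  have h2 := charFun_map_cast_poissonMeasure (m A).toNNReal y
  rw [charFun_apply, integral_map .of_discrete (by fun_prop)] at h2
  simp only [Real.inner_apply] at h2
  rw [mul_comm Complex.I (y : ℂ)]
  calc _ = _ := by
        congr 1; ext k
        simp only [ENNReal.toReal_natCast]
        rw [mul_comm]
    _ = _ := h2
    _ = _ := rfl

variable [IsProbabilityMeasure P]

/-- Campbell's formula: the mean measure of a Poisson random measure is its intensity. -/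
theorem IsPoissonRandomMeasure.bind_eq (hN : IsPoissonRandomMeasure P N m) : P.bind N = m := by
  ext A hA
  rw [Measure.bind_apply hA hN.measurable.aemeasurable]
  by_cases hm : m A = ∞
  · rw [lintegral_congr_ae (hN.eq_top A hA hm), lintegral_const, measure_univ, mul_one, hm]
  · have hmeas : Measurable fun ω => N ω A := (Measure.measurable_coe hA).comp hN.measurable
    have h := lintegral_map (μ := P) (f := fun x : ℝ≥0∞ => x) measurable_id hmeas
    rw [← h, hN.poisson A hA hm, lintegral_map (f := fun x : ℝ≥0∞ => x) measurable_id
      .of_discrete]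
    simp only [lintegral_natCast_poissonMeasure, ENNReal.coe_toNNReal hm]

theorem IsPoissonRandomMeasure.ae_integrable (hN : IsPoissonRandomMeasure P N m) {f : E → ℝ}
    (hf : Measurable f) (hfm : Integrable f m) : ∀ᵐ ω ∂P, Integrable f (N ω) := by
  have h : ∫⁻ ω, ∫⁻ x, ‖f x‖ₑ ∂(N ω) ∂P = ∫⁻ x, ‖f x‖ₑ ∂m := by
    rw [← Measure.lintegral_bind hN.measurable.aemeasurable (by fun_prop), hN.bind_eq]
  have hmeas : Measurable fun ω => ∫⁻ x, ‖f x‖ₑ ∂(N ω) :=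
    (Measure.measurable_lintegral hf.enorm).comp hN.measurable
  have hfin : ∫⁻ ω, ∫⁻ x, ‖f x‖ₑ ∂(N ω) ∂P ≠ ∞ := by rw [h]; exact hfm.2.ne
  filter_upwards [ae_lt_top hmeas hfin] with ω hω
  exact ⟨hf.aestronglyMeasurable, hω⟩

/-- A version of `∫ f dμ` that is a measurable function of the measure `μ`. -/
noncomputable def measurableIntegral (f : E → ℝ) (μ : Measure E) : ℝ :=
  (∫⁻ x, ENNReal.ofReal (f x) ∂μ).toReal - (∫⁻ x, ENNReal.ofReal (-f x) ∂μ).toReal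

theorem measurable_measurableIntegral {f : E → ℝ} (hf : Measurable f) :
    Measurable (measurableIntegral f) :=
  ((Measure.measurable_lintegral hf.ennreal_ofReal).ennreal_toReal).sub
    (Measure.measurable_lintegral hf.neg.ennreal_ofReal).ennreal_toReal

theorem IsPoissonRandomMeasure.integral_ae_eq (hN : IsPoissonRandomMeasure P N m) {f : E → ℝ}
    (hf : Measurable f) (hfm : Integrable f m) :
    (fun ω => ∫ x, f x ∂(N ω)) =ᵐ[P] fun ω => measurableIntegral f (N ω) := by
  filter_upwards [hN.ae_integrable hf hfm] with ω hω
  exact integral_eq_lintegral_pos_part_sub_lintegral_neg_part hω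

theorem IsPoissonRandomMeasure.aemeasurable_integral (hN : IsPoissonRandomMeasure P N m)
    {f : E → ℝ} (hf : Measurable f) (hfm : Integrable f m) :
    AEMeasurable (fun ω => ∫ x, f x ∂(N ω)) P :=
  ⟨_, (measurable_measurableIntegral hf).comp hN.measurable, hN.integral_ae_eq hf hfm⟩

theorem norm_cexp_I_mul (x : ℝ) : ‖Complex.exp (Complex.I * (x : ℂ))‖ = 1 := by
  rw [Complex.norm_exp_I_mul_ofReal]

/-- The characteristic functional of a Poisson random measure at a simple function. -/
theorem IsPoissonRandomMeasure.integral_cexp_simpleFunc (hN : IsPoissonRandomMeasure P N m)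
    (f : SimpleFunc E ℝ) (hf : Integrable f m) :
    ∫ ω, Complex.exp (Complex.I * ((∫ x, f x ∂(N ω) : ℝ) : ℂ)) ∂P
      = Complex.exp (∫ x, (Complex.exp (Complex.I * (f x : ℂ)) - 1) ∂m) := by
  set g : ℝ → ℂ := fun y => Complex.exp (Complex.I * (y : ℂ)) - 1 with hg
  have hright : ∫ x, (Complex.exp (Complex.I * (f x : ℂ)) - 1) ∂m
      = ∑ y ∈ f.range, (m.real (f ⁻¹' {y}) : ℂ) * g y := by
    have hgi : Integrable (f.map g) m := by
      refine hf.mono (f.map g).aestronglyMeasurable (ae_of_all _ fun x => ?_)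
      refine (norm_cexp_sub_one_le_of_re_nonpos (by simp)).trans ?_
      rw [norm_mul, Complex.norm_I, one_mul, Complex.norm_real]
    rw [show (∫ x, (Complex.exp (Complex.I * (f x : ℂ)) - 1) ∂m) = ∫ x, (f.map g) x ∂m from rfl,
      ← SimpleFunc.integral_eq_integral _ hgi, SimpleFunc.map_integral f g hf (by simp [hg])]
    simp
  -- the value `0` may have a level set of infinite measure; it contributes a factor one
  set e := f.range.equivFin
  set A : Fin f.range.card → Set E := fun i => f ⁻¹' {((e.symm i : f.range) : ℝ)} with hA
  have hind := hN.indep _ A (fun i => f.measurableSet_preimage _) (fun i k hik => by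
    refine Disjoint.preimage _ (Set.disjoint_singleton.2 fun h => hik ?_)
    exact e.symm.injective (Subtype.ext h))
  have hAm : ∀ i, MeasurableSet (A i) := fun i => f.measurableSet_preimage _
  have hmeas : ∀ i, Measurable fun ω => N ω (A i) := fun i =>
    (Measure.measurable_coe (hAm i)).comp hN.measurable
  have hsum : ∀ F : ℝ → ℂ, ∑ y ∈ f.range, F y = ∑ i, F (e.symm i : f.range) := fun F => by
    rw [← Finset.sum_coe_sort f.range]
    exact (Equiv.sum_comp e.symm (fun y : f.range => F y)).symm
  have hfactor : ∀ i, ∫ ω, Complex.exp (Complex.I *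
      (((N ω (A i)).toReal * ((e.symm i : f.range) : ℝ) : ℝ) : ℂ)) ∂P
      = Complex.exp ((m.real (A i) : ℂ) * g ((e.symm i : f.range) : ℝ)) := fun i => by
    by_cases h0 : ((e.symm i : f.range) : ℝ) = 0
    · simp [h0, hg]
    · refine hN.integral_cexp_count (hAm i) ?_ _
      exact (SimpleFunc.measure_preimage_lt_top_of_integrable f hf h0).ne
  rw [hright, hsum (fun y => (m.real (f ⁻¹' {y}) : ℂ) * g y), Complex.exp_sum]
  calc ∫ ω, Complex.exp (Complex.I * ((∫ x, f x ∂(N ω) : ℝ) : ℂ)) ∂P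
      = ∫ ω, ∏ i, Complex.exp (Complex.I *
          (((N ω (A i)).toReal * ((e.symm i : f.range) : ℝ) : ℝ) : ℂ)) ∂P := by
        refine integral_congr_ae ?_
        filter_upwards [hN.ae_integrable f.measurable hf] with ω hω
        rw [← Complex.exp_sum, ← Finset.mul_sum]
        congr 2
        rw [SimpleFunc.integral_eq_sum f hω]
        push_cast
        rw [hsum (fun y => ((N ω).real (f ⁻¹' {y}) • y : ℝ))]
        simp only [smul_eq_mul, Complex.ofReal_mul]
        rfl
    _ = ∏ i, ∫ ω, Complex.exp (Complex.I *
          (((N ω (A i)).toReal * ((e.symm i : f.range) : ℝ) : ℝ) : ℂ)) ∂P := by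
        refine hind.integral_fun_prod_comp (f := fun i (x : ℝ≥0∞) => Complex.exp (Complex.I *
          ((x.toReal * ((e.symm i : f.range) : ℝ) : ℝ) : ℂ)))
          (fun i => (hmeas i).aemeasurable) (fun i => ?_)
        exact Measurable.aestronglyMeasurable (by fun_prop)
    _ = _ := Finset.prod_congr rfl fun i _ => hfactor i

/-- The characteristic functional of a Poisson random measure. -/
theorem IsPoissonRandomMeasure.integral_cexp (hN : IsPoissonRandomMeasure P N m) {f : E → ℝ}
    (hf : Measurable f) (hfm : Integrable f m) :
    ∫ ω, Complex.exp (Complex.I * ((∫ x, f x ∂(N ω) : ℝ) : ℂ)) ∂P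
      = Complex.exp (∫ x, (Complex.exp (Complex.I * (f x : ℂ)) - 1) ∂m) := by
  set F : ℕ → SimpleFunc E ℝ := fun n => SimpleFunc.approxOn f hf Set.univ 0 (Set.mem_univ _) n
  have hFle : ∀ n x, ‖F n x‖ ≤ 2 * ‖f x‖ := fun n x => by
    rw [two_mul]; exact SimpleFunc.norm_approxOn_zero_le hf (Set.mem_univ _) x n
  have hFlim : ∀ x, Tendsto (fun n => F n x) atTop (𝓝 (f x)) := fun x =>
    SimpleFunc.tendsto_approxOn hf (Set.mem_univ _) (by simp)
  have hFint : ∀ (μ : Measure E), Integrable f μ → ∀ n, Integrable (F n) μ := fun μ hμ n =>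
    (hμ.norm.const_mul 2).mono' (F n).aestronglyMeasurable (ae_of_all _ fun x => hFle n x)
  have hexp : Continuous fun x : ℝ => Complex.exp (Complex.I * (x : ℂ)) := by fun_prop
  have hleft : Tendsto (fun n => ∫ ω, Complex.exp (Complex.I * ((∫ x, F n x ∂(N ω) : ℝ) : ℂ)) ∂P)
      atTop (𝓝 (∫ ω, Complex.exp (Complex.I * ((∫ x, f x ∂(N ω) : ℝ) : ℂ)) ∂P)) := by
    refine tendsto_integral_of_dominated_convergence (fun _ => (1 : ℝ)) (fun n => ?_)
      (integrable_const _) (fun n => ae_of_all _ fun ω => (norm_cexp_I_mul _).le) ?_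
    · exact (hexp.measurable.comp_aemeasurable
        (hN.aemeasurable_integral (F n).measurable (hFint m hfm n))).aestronglyMeasurable
    · filter_upwards [hN.ae_integrable hf hfm] with ω hω
      refine (hexp.tendsto _).comp ?_
      exact tendsto_integral_of_dominated_convergence (fun x => 2 * ‖f x‖)
        (fun n => (F n).aestronglyMeasurable) (hω.norm.const_mul 2)
        (fun n => ae_of_all _ fun x => hFle n x) (ae_of_all _ hFlim)
  have hright : Tendsto (fun n => Complex.exp (∫ x, (Complex.exp (Complex.I * (F n x : ℂ)) - 1) ∂m))
      atTop (𝓝 (Complex.exp (∫ x, (Complex.exp (Complex.I * (f x : ℂ)) - 1) ∂m))) := by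
    refine (Complex.continuous_exp.tendsto _).comp ?_
    refine tendsto_integral_of_dominated_convergence (fun x => 2 * ‖f x‖) (fun n => ?_)
      (hfm.norm.const_mul 2) (fun n => ae_of_all _ fun x => ?_) (ae_of_all _ fun x => ?_)
    · exact ((hexp.measurable.comp (F n).measurable).sub_const 1).aestronglyMeasurable
    · refine (norm_cexp_sub_one_le_of_re_nonpos (by simp)).trans ?_
      rw [norm_mul, Complex.norm_I, one_mul, Complex.norm_real]
      exact hFle n x
    · exact ((hexp.tendsto _).comp (hFlim x)).sub_const 1
  refine tendsto_nhds_unique hleft (hright.congr fun n => ?_)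
  exact (hN.integral_cexp_simpleFunc (F n) (hFint m hfm n)).symm

end Poisson

/-! ### The geometry of a session -/

theorem sessionLength_eq (t s u : ℝ) :
    sessionLength t s u = max (min t (s + u) - max 0 s) 0 := by
  rw [sessionLength, Set.Icc_inter_Icc, Real.volume_Icc, ENNReal.toReal_ofReal']

theorem continuous_sessionLength (t : ℝ) :
    Continuous fun p : ℝ × ℝ => sessionLength t p.1 p.2 := by
  simp only [sessionLength_eq]
  fun_prop

theorem sessionLength_nonneg (t s u : ℝ) : 0 ≤ sessionLength t s u := ENNReal.toReal_nonneg

/-- A bound on the rescaled session length that does not depend on the time scale. A session that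
starts at `T s < 0` meets `[0, T t]` only if `T |s| < u`, and then `T t ≤ u t / |s|`. -/
theorem sessionLength_mul_le {T t s u : ℝ} (hT : 0 < T) (ht : 0 ≤ t) (hu : 0 ≤ u) :
    sessionLength (T * t) (T * s) u ≤ u * (1 + t) * (1 + |s|)⁻¹ := by
  rw [← div_eq_mul_inv, le_div_iff₀ (by positivity), sessionLength_eq]
  rcases le_total 0 s with hs | hs
  · rw [abs_of_nonneg hs, max_eq_right (mul_nonneg hT.le hs)]
    rcases le_total s t with hst | hst
    · have h1 : max (min (T * t) (T * s + u) - T * s) 0 ≤ u :=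
        max_le (by linarith [min_le_right (T * t) (T * s + u)]) hu
      calc _ ≤ u * (1 + s) := by gcongr
        _ ≤ u * (1 + t) := by gcongr
    · have h1 : min (T * t) (T * s + u) - T * s ≤ 0 := by
        nlinarith [min_le_left (T * t) (T * s + u)]
      rw [max_eq_right h1, zero_mul]
      positivity
  · rw [abs_of_nonpos hs, max_eq_left (mul_nonpos_of_nonneg_of_nonpos hT.le hs), sub_zero]
    rcases le_total (T * s + u) 0 with hneg | hpos
    · rw [max_eq_right ((min_le_right _ _).trans hneg), zero_mul]
      positivity
    · have hm : 0 ≤ min (T * t) (T * s + u) := le_min (by positivity) hpos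
      rw [max_eq_left hm]
      have h1 : min (T * t) (T * s + u) ≤ u :=
        (min_le_right _ _).trans (by nlinarith)
      have h2 : min (T * t) (T * s + u) * (-s) ≤ T * t * (-s) :=
        mul_le_mul_of_nonneg_right (min_le_left _ _) (by linarith)
      nlinarith

/-- At large time scales the sessions that overlap the ends of the observation window are
negligible: a session that starts at `T s` contributes its whole duration or nothing. -/
theorem tendsto_sessionLength_mul {t s u : ℝ} (hs0 : s ≠ 0) (hst : s ≠ t) (hu : 0 ≤ u) :
    Tendsto (fun T : ℝ => sessionLength (T * t) (T * s) u) atTop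
      (𝓝 ((Set.Icc (0 : ℝ) t).indicator (fun _ => (1 : ℝ)) s * u)) := by
  refine tendsto_const_nhds.congr' ?_
  simp only [sessionLength_eq]
  rcases lt_or_gt_of_ne hs0 with hs | hs
  · filter_upwards [eventually_gt_atTop 0, eventually_ge_atTop (u / (-s))] with T hT hTs
    rw [div_le_iff₀ (by linarith)] at hTs
    have h1 : min (T * t) (T * s + u) - max 0 (T * s) ≤ 0 := by
      have := min_le_right (T * t) (T * s + u)
      have := le_max_left 0 (T * s)
      linarith
    rw [max_eq_right h1, Set.indicator_of_notMem (fun h => absurd h.1 (not_le.2 hs)), zero_mul]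
  · rcases lt_or_gt_of_ne hst with hlt | hgt
    · filter_upwards [eventually_gt_atTop 0, eventually_ge_atTop (u / (t - s))] with T hT hTs
      rw [div_le_iff₀ (by linarith)] at hTs
      rw [Set.indicator_of_mem (show s ∈ Set.Icc 0 t from ⟨hs.le, hlt.le⟩), one_mul,
        min_eq_right (by linarith : T * s + u ≤ T * t),
        max_eq_right (mul_nonneg hT.le hs.le),
        add_sub_cancel_left, max_eq_left hu]
    · filter_upwards [eventually_gt_atTop 0] with T hT
      have h1 : min (T * t) (T * s + u) - max 0 (T * s) ≤ 0 := by
        have := min_le_left (T * t) (T * s + u)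
        have := le_max_right 0 (T * s)
        nlinarith
      rw [max_eq_right h1, Set.indicator_of_notMem (fun h => absurd h.2 (not_le.2 hgt)), zero_mul]

theorem lintegral_sessionLength {t u : ℝ} (hu : 0 ≤ u) :
    ∫⁻ s, ENNReal.ofReal (sessionLength t s u) = ENNReal.ofReal (t * u) := by
  set S : Set (ℝ × ℝ) := {p | (0 ≤ p.2 ∧ p.2 ≤ t) ∧ (p.1 ≤ p.2 ∧ p.2 ≤ p.1 + u)} with hS
  have hSm : MeasurableSet S := by
    refine IsClosed.measurableSet (IsClosed.inter (IsClosed.inter ?_ ?_) (IsClosed.inter ?_ ?_))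
    · exact isClosed_le continuous_const continuous_snd
    · exact isClosed_le continuous_snd continuous_const
    · exact isClosed_le continuous_fst continuous_snd
    · exact isClosed_le continuous_snd (continuous_fst.add continuous_const)
  have h1 : ∀ s, ENNReal.ofReal (sessionLength t s u) = volume (Prod.mk s ⁻¹' S) := fun s => by
    rw [sessionLength, ENNReal.ofReal_toReal]
    · congr 1
    · exact ((measure_mono Set.inter_subset_left).trans_lt measure_Icc_lt_top).ne
  have h2 : ∀ x, volume ((fun s => (s, x)) ⁻¹' S)
      = (Set.Icc 0 t).indicator (fun _ => ENNReal.ofReal u) x := fun x => by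
    by_cases hx : x ∈ Set.Icc 0 t
    · rw [Set.indicator_of_mem hx]
      have : (fun s => (s, x)) ⁻¹' S = Set.Icc (x - u) x := by
        ext s
        simp only [hS, Set.mem_preimage, Set.mem_ofPred_eq, Set.mem_Icc]
        constructor
        · rintro ⟨-, h3, h4⟩; exact ⟨by linarith, h3⟩
        · rintro ⟨h3, h4⟩; exact ⟨hx, h4, by linarith⟩
      rw [this, Real.volume_Icc]
      congr 1; ring
    · rw [Set.indicator_of_notMem hx]
      have : (fun s => (s, x)) ⁻¹' S = ∅ := by
        ext s
        simp only [hS, Set.mem_preimage, Set.mem_ofPred_eq, Set.mem_empty_iff_false, iff_false]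
        exact fun h => hx h.1
      rw [this, measure_empty]
  simp_rw [h1]
  rw [← Measure.prod_apply hSm, Measure.prod_apply_symm hSm]
  simp_rw [h2]
  rw [lintegral_indicator_const measurableSet_Icc, Real.volume_Icc, sub_zero,
    ← ENNReal.ofReal_mul hu, mul_comm]

theorem lintegral_smul_sessionLength (c : ℝ≥0∞) {t u r : ℝ} (ht : 0 ≤ t) (hu : 0 ≤ u)
    (hr : 0 ≤ r) :
    ∫⁻ s, ENNReal.ofReal (r * sessionLength t s u) ∂(c • (volume : Measure ℝ))
      = c * (ENNReal.ofReal t * (ENNReal.ofReal u * ENNReal.ofReal r)) := by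
  have hm : Measurable fun s => ENNReal.ofReal (sessionLength t s u) :=
    ((continuous_sessionLength t).comp
      (by fun_prop : Continuous fun s : ℝ => (s, u))).measurable.ennreal_ofReal
  simp_rw [ENNReal.ofReal_mul hr]
  rw [lintegral_smul_measure, lintegral_const_mul _ hm, lintegral_sessionLength hu,
    ENNReal.ofReal_mul ht, smul_eq_mul, mul_comm (ENNReal.ofReal r), mul_assoc]

/-! ### The load of a session under the mean measure -/

theorem ae_sessionIntensity {l : ℝ} {G H : Measure ℝ}
    [SFinite G] [SFinite H] (hG : ∀ᵐ u ∂G, 0 < u) (hH : ∀ᵐ r ∂H, 0 < r) :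
    ∀ᵐ x ∂(sessionIntensity l G H), 0 < x.2.1 ∧ 0 < x.2.2 := by
  have h2 : Measure.QuasiMeasurePreserving (Prod.snd : ℝ × ℝ × ℝ → ℝ × ℝ)
      (sessionIntensity l G H) (G.prod H) := Measure.quasiMeasurePreserving_snd
  exact (h2.ae (Measure.quasiMeasurePreserving_fst.ae hG)).and
    (h2.ae (Measure.quasiMeasurePreserving_snd.ae hH))

section Intensity

variable {l : ℝ} {G H : Measure ℝ} [IsProbabilityMeasure G] [IsProbabilityMeasure H]

theorem measurable_sessionLoad (t : ℝ) :
    Measurable fun x : ℝ × ℝ × ℝ => x.2.2 * sessionLength t x.1 x.2.1 := by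
  have h : Continuous fun x : ℝ × ℝ × ℝ => sessionLength t x.1 x.2.1 :=
    (continuous_sessionLength t).comp (by fun_prop : Continuous fun x : ℝ × ℝ × ℝ => (x.1, x.2.1))
  exact (continuous_snd.snd.mul h).measurable

theorem lintegral_sessionLoad (hG : ∀ᵐ u ∂G, 0 < u) (hH : ∀ᵐ r ∂H, 0 < r)
    (hGi : Integrable (fun u => u) G) (hHi : Integrable (fun r => r) H) {t : ℝ} (ht : 0 ≤ t) :
    ∫⁻ x, ENNReal.ofReal (x.2.2 * sessionLength t x.1 x.2.1) ∂(sessionIntensity l G H)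
      = ENNReal.ofReal l * (ENNReal.ofReal t * ENNReal.ofReal (mean G)
        * ENNReal.ofReal (mean H)) := by
  have hmean : ∀ F : Measure ℝ, (∀ᵐ u ∂F, 0 < u) → Integrable (fun u => u) F →
      ∫⁻ u, ENNReal.ofReal u ∂F = ENNReal.ofReal (mean F) := fun F hF hFi => by
    rw [mean, ofReal_integral_eq_lintegral_ofReal hFi (hF.mono fun _ h => h.le)]
  rw [sessionIntensity, lintegral_prod_symm _ (measurable_sessionLoad t).ennreal_ofReal.aemeasurable]
  have hinner : ∀ᵐ y ∂(G.prod H), ∫⁻ s, ENNReal.ofReal (y.2 * sessionLength t s y.1)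
        ∂(ENNReal.ofReal l • (volume : Measure ℝ))
      = ENNReal.ofReal l * (ENNReal.ofReal t * (ENNReal.ofReal y.1 * ENNReal.ofReal y.2)) := by
    have hG' : ∀ᵐ y ∂(G.prod H), 0 < y.1 := Measure.quasiMeasurePreserving_fst.ae hG
    have hH' : ∀ᵐ y ∂(G.prod H), 0 < y.2 := Measure.quasiMeasurePreserving_snd.ae hH
    filter_upwards [hG', hH'] with y hy1 hy2
    exact lintegral_smul_sessionLength _ ht hy1.le hy2.le
  rw [lintegral_congr_ae hinner, lintegral_const_mul _ (by fun_prop),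
    lintegral_const_mul _ (by fun_prop),
    lintegral_prod_mul (f := fun u => ENNReal.ofReal u) (g := fun r => ENNReal.ofReal r)
      (by fun_prop) (by fun_prop), hmean G hG hGi, hmean H hH hHi]
  ring

theorem integrable_sessionLoad (hG : ∀ᵐ u ∂G, 0 < u) (hH : ∀ᵐ r ∂H, 0 < r)
    (hGi : Integrable (fun u => u) G) (hHi : Integrable (fun r => r) H) {t : ℝ} (ht : 0 ≤ t) :
    Integrable (fun x : ℝ × ℝ × ℝ => x.2.2 * sessionLength t x.1 x.2.1)
      (sessionIntensity l G H) := by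
  refine ⟨(measurable_sessionLoad t).aestronglyMeasurable, ?_⟩
  rw [hasFiniteIntegral_iff_ofReal, lintegral_sessionLoad hG hH hGi hHi ht]
  · finiteness
  · filter_upwards [ae_sessionIntensity hG hH] with x hx
      using mul_nonneg hx.2.le (sessionLength_nonneg _ _ _)

theorem integral_sessionLoad (hl : 0 ≤ l) (hG : ∀ᵐ u ∂G, 0 < u) (hH : ∀ᵐ r ∂H, 0 < r)
    (hGi : Integrable (fun u => u) G) (hHi : Integrable (fun r => r) H) {t : ℝ} (ht : 0 ≤ t) :
    ∫ x, x.2.2 * sessionLength t x.1 x.2.1 ∂(sessionIntensity l G H)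
      = l * mean G * mean H * t := by
  have hGm : 0 ≤ mean G := integral_nonneg_of_ae (hG.mono fun _ h => h.le)
  have hHm : 0 ≤ mean H := integral_nonneg_of_ae (hH.mono fun _ h => h.le)
  rw [integral_eq_lintegral_of_nonneg_ae, lintegral_sessionLoad hG hH hGi hHi ht]
  · rw [ENNReal.toReal_mul, ENNReal.toReal_mul, ENNReal.toReal_mul, ENNReal.toReal_ofReal hl,
      ENNReal.toReal_ofReal ht, ENNReal.toReal_ofReal hGm, ENNReal.toReal_ofReal hHm]
    ring
  · filter_upwards [ae_sessionIntensity hG hH] with x hx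
      using mul_nonneg hx.2.le (sessionLength_nonneg _ _ _)
  · exact (measurable_sessionLoad t).aestronglyMeasurable

end Intensity

/-! ### The logarithm of the characteristic function of a stream -/

/-- The combined session length `∑ k, z k * L_{T t k}(s, u)`. -/
noncomputable def combinedLength {n : ℕ} (T : ℝ) (t : Fin n → ℝ≥0) (z : Fin n → ℝ) (p : ℝ × ℝ) :
    ℝ :=
  ∑ k, z k * sessionLength (T * t k) p.1 p.2

/-- The contribution of a session to `∑ k, z k * A (T t k) / a`. -/
noncomputable def combinedLoad {n : ℕ} (T a : ℝ) (t : Fin n → ℝ≥0) (z : Fin n → ℝ)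
    (x : ℝ × ℝ × ℝ) : ℝ :=
  x.2.2 * (combinedLength T t z (x.1, x.2.1) / a)

theorem continuous_combinedLength {n : ℕ} (T : ℝ) (t : Fin n → ℝ≥0) (z : Fin n → ℝ) :
    Continuous (combinedLength T t z) :=
  continuous_finsetSum _ fun _ _ => continuous_const.mul (continuous_sessionLength _)

theorem combinedLoad_eq_sum {n : ℕ} (T a : ℝ) (t : Fin n → ℝ≥0) (z : Fin n → ℝ)
    (x : ℝ × ℝ × ℝ) :
    combinedLoad T a t z x = ∑ k, z k / a * (x.2.2 * sessionLength (T * t k) x.1 x.2.1) := by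
  rw [combinedLoad, combinedLength, Finset.sum_div, Finset.mul_sum]
  exact Finset.sum_congr rfl fun k _ => by ring

theorem measurable_combinedLoad {n : ℕ} (T a : ℝ) (t : Fin n → ℝ≥0) (z : Fin n → ℝ) :
    Measurable (combinedLoad T a t z) := by
  have : combinedLoad T a t z
      = fun x => ∑ k, z k / a * (x.2.2 * sessionLength (T * t k) x.1 x.2.1) :=
    funext (combinedLoad_eq_sum T a t z)
  rw [this]
  exact Finset.measurable_sum _ fun k _ => (measurable_sessionLoad _).const_mul _

/-- The logarithm of the characteristic function of the centred combined load of a stream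
whose sessions have mean measure `m`. -/
noncomputable def streamExponent {n : ℕ} (m : Measure (ℝ × ℝ × ℝ)) (T a : ℝ) (t : Fin n → ℝ≥0)
    (z : Fin n → ℝ) : ℂ :=
  ∫ x, (Complex.exp (Complex.I * (combinedLoad T a t z x : ℂ)) - 1
    - Complex.I * (combinedLoad T a t z x : ℂ)) ∂m

theorem norm_compensated_le (x : ℝ) :
    ‖Complex.exp (Complex.I * (x : ℂ)) - 1 - Complex.I * (x : ℂ)‖ ≤ 2 * |x| := by
  have h := norm_cexp_sub_one_le_of_re_nonpos (w := Complex.I * (x : ℂ)) (by simp)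
  have hI : ‖Complex.I * (x : ℂ)‖ = |x| := by
    rw [norm_mul, Complex.norm_I, one_mul, Complex.norm_real, Real.norm_eq_abs]
  refine (norm_sub_le _ _).trans ?_
  rw [hI] at h ⊢
  linarith

section Stream

variable {l : ℝ} {G H : Measure ℝ} [IsProbabilityMeasure G] [IsProbabilityMeasure H]

theorem integrable_combinedLoad (hG : ∀ᵐ u ∂G, 0 < u) (hH : ∀ᵐ r ∂H, 0 < r)
    (hGi : Integrable (fun u => u) G) (hHi : Integrable (fun r => r) H) {n : ℕ} {T : ℝ}
    (hT : 0 < T) (a : ℝ) (t : Fin n → ℝ≥0) (z : Fin n → ℝ) :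
    Integrable (combinedLoad T a t z) (sessionIntensity l G H) := by
  have : combinedLoad T a t z
      = fun x => ∑ k, z k / a * (x.2.2 * sessionLength (T * t k) x.1 x.2.1) :=
    funext (combinedLoad_eq_sum T a t z)
  rw [this]
  exact integrable_finsetSum _ fun k _ =>
    (integrable_sessionLoad hG hH hGi hHi (by positivity)).const_mul _

theorem integrable_compensated_combinedLoad (hG : ∀ᵐ u ∂G, 0 < u) (hH : ∀ᵐ r ∂H, 0 < r)
    (hGi : Integrable (fun u => u) G) (hHi : Integrable (fun r => r) H) {n : ℕ} {T : ℝ}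
    (hT : 0 < T) (a : ℝ) (t : Fin n → ℝ≥0) (z : Fin n → ℝ) :
    Integrable (fun x => Complex.exp (Complex.I * (combinedLoad T a t z x : ℂ)) - 1
      - Complex.I * (combinedLoad T a t z x : ℂ)) (sessionIntensity l G H) := by
  refine ((integrable_combinedLoad hG hH hGi hHi hT a t z).abs.const_mul 2).mono' ?_
    (ae_of_all _ fun x => norm_compensated_le _)
  have := measurable_combinedLoad T a t z
  exact Measurable.aestronglyMeasurable (by fun_prop)

theorem continuous_streamExponent (hG : ∀ᵐ u ∂G, 0 < u) (hH : ∀ᵐ r ∂H, 0 < r)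
    (hGi : Integrable (fun u => u) G) (hHi : Integrable (fun r => r) H) {n : ℕ} {T : ℝ}
    (hT : 0 < T) (a : ℝ) (t : Fin n → ℝ≥0) :
    Continuous (streamExponent (n := n) (sessionIntensity l G H) T a t) := by
  have hcz : ∀ x, Continuous fun z : Fin n → ℝ => combinedLoad T a t z x := fun x => by
    simp only [combinedLoad_eq_sum]; fun_prop
  refine continuous_iff_continuousAt.2 fun z₀ => ?_
  refine continuousAt_of_dominated (bound := fun x => 2 * ((‖z₀‖ + 1) * ∑ k,
    |a⁻¹ * (x.2.2 * sessionLength (T * t k) x.1 x.2.1)|)) (Eventually.of_forall fun z =>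
    (integrable_compensated_combinedLoad hG hH hGi hHi hT a t z).aestronglyMeasurable) ?_ ?_ ?_
  · have hnear : ∀ᶠ z : Fin n → ℝ in 𝓝 z₀, ‖z‖ < ‖z₀‖ + 1 :=
      (continuous_norm.tendsto z₀).eventually_lt_const (lt_add_one _)
    filter_upwards [hnear] with z hz
    refine ae_of_all _ fun x => (norm_compensated_le _).trans ?_
    gcongr
    rw [combinedLoad_eq_sum, Finset.mul_sum]
    refine (Finset.abs_sum_le_sum_abs _ _).trans (Finset.sum_le_sum fun k _ => ?_)
    rw [div_eq_mul_inv, mul_assoc, abs_mul]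
    gcongr
    exact (norm_le_pi_norm z k).trans hz.le
  · exact ((integrable_finsetSum _ fun k _ =>
      ((integrable_sessionLoad hG hH hGi hHi (by positivity)).const_mul _).abs).const_mul _).const_mul 2
  · refine ae_of_all _ fun x => Continuous.continuousAt ?_
    have := hcz x
    fun_prop

theorem streamExponent_zero {n : ℕ} (m : Measure (ℝ × ℝ × ℝ)) (T a : ℝ) (t : Fin n → ℝ≥0) :
    streamExponent m T a t 0 = 0 := by
  simp [streamExponent, combinedLoad_eq_sum]

/-- Almost surely, a linear combination of the centred loads is an integral of `combinedLoad`
minus its mean. -/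
theorem sum_centredLoad_ae_eq {Ω : Type*} [MeasurableSpace Ω] {P : Measure Ω}
    [IsProbabilityMeasure P] {N : Ω → Measure (ℝ × ℝ × ℝ)} (hl : 0 ≤ l)
    (hN : IsPoissonRandomMeasure P N (sessionIntensity l G H))
    (hG : ∀ᵐ u ∂G, 0 < u) (hH : ∀ᵐ r ∂H, 0 < r)
    (hGi : Integrable (fun u => u) G) (hHi : Integrable (fun r => r) H) {n : ℕ} {T : ℝ}
    (hT : 0 < T) (a : ℝ) (t : Fin n → ℝ≥0) (z : Fin n → ℝ) :
    (fun ω => ∑ k, z k * centredLoad N l (mean G) (mean H) T a (t k) ω) =ᵐ[P]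
      fun ω => measurableIntegral (combinedLoad T a t z) (N ω)
        - ∫ x, combinedLoad T a t z x ∂(sessionIntensity l G H) := by
  have hi : ∀ k, Integrable (fun x : ℝ × ℝ × ℝ => x.2.2 * sessionLength (T * t k) x.1 x.2.1)
      (sessionIntensity l G H) := fun k => integrable_sessionLoad hG hH hGi hHi (by positivity)
  have hall : ∀ᵐ ω ∂P, ∀ k, Integrable
      (fun x : ℝ × ℝ × ℝ => x.2.2 * sessionLength (T * t k) x.1 x.2.1) (N ω) :=
    ae_all_iff.2 fun k => hN.ae_integrable (measurable_sessionLoad _) (hi k)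
  filter_upwards [hall, hN.integral_ae_eq (measurable_combinedLoad T a t z)
    (integrable_combinedLoad hG hH hGi hHi hT a t z)] with ω hω hω2
  rw [← hω2]
  simp only [combinedLoad_eq_sum]
  rw [integral_finsetSum _ fun k _ => (hω k).const_mul _,
    integral_finsetSum _ fun k _ => (hi k).const_mul _, ← Finset.sum_sub_distrib]
  refine Finset.sum_congr rfl fun k _ => ?_
  rw [integral_const_mul, integral_const_mul,
    integral_sessionLoad hl hG hH hGi hHi (by positivity), centredLoad, load]
  ring

theorem integral_cexp_centred {Ω : Type*} [MeasurableSpace Ω] {P : Measure Ω}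
    [IsProbabilityMeasure P] {N : Ω → Measure (ℝ × ℝ × ℝ)}
    (hN : IsPoissonRandomMeasure P N (sessionIntensity l G H))
    (hG : ∀ᵐ u ∂G, 0 < u) (hH : ∀ᵐ r ∂H, 0 < r)
    (hGi : Integrable (fun u => u) G) (hHi : Integrable (fun r => r) H) {n : ℕ} {T : ℝ}
    (hT : 0 < T) (a : ℝ) (t : Fin n → ℝ≥0) (z : Fin n → ℝ) :
    ∫ ω, Complex.exp (Complex.I * ((measurableIntegral (combinedLoad T a t z) (N ω)
        - ∫ x, combinedLoad T a t z x ∂(sessionIntensity l G H) : ℝ) : ℂ)) ∂P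
      = Complex.exp (streamExponent (sessionIntensity l G H) T a t z) := by
  have hfm := measurable_combinedLoad T a t z
  have hfi := integrable_combinedLoad (l := l) hG hH hGi hHi hT a t z
  set f := combinedLoad T a t z
  set m := sessionIntensity l G H
  have hfiC : Integrable (fun x => Complex.I * (f x : ℂ)) m := hfi.ofReal.const_mul _
  have hsplit : streamExponent m T a t z
      = ∫ x, (Complex.exp (Complex.I * (f x : ℂ)) - 1) ∂m - Complex.I * ((∫ x, f x ∂m : ℝ) : ℂ) := by
    have hexp : Integrable (fun x => Complex.exp (Complex.I * (f x : ℂ)) - 1) m := by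
      refine hfi.mono (Measurable.aestronglyMeasurable (by fun_prop)) (ae_of_all _ fun x => ?_)
      refine (norm_cexp_sub_one_le_of_re_nonpos (by simp)).trans ?_
      rw [norm_mul, Complex.norm_I, one_mul, Complex.norm_real]
    rw [streamExponent, integral_sub hexp hfiC, integral_const_mul, integral_complex_ofReal]
  calc _ = ∫ ω, Complex.exp (Complex.I * ((∫ x, f x ∂(N ω) : ℝ) : ℂ))
          * Complex.exp (-(Complex.I * ((∫ x, f x ∂m : ℝ) : ℂ))) ∂P := by
        refine integral_congr_ae ?_
        filter_upwards [hN.integral_ae_eq hfm hfi] with ω hω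
        rw [hω, ← Complex.exp_add]
        push_cast; ring_nf
    _ = _ := by
        rw [integral_mul_const, hN.integral_cexp hfm hfi, ← Complex.exp_add, hsplit, sub_eq_add_neg]

end Stream

/-! ### Asymptotics of the exponent of a stream -/

/-- The step function `s ↦ ∑ k, z k 1_{[0, t k]}(s)`. -/
noncomputable def stepFun {n : ℕ} (t : Fin n → ℝ≥0) (z : Fin n → ℝ) (s : ℝ) : ℝ :=
  ∑ k, z k * (Set.Icc (0 : ℝ) (t k)).indicator (fun _ => (1 : ℝ)) s

/-- `∫ ψ(∑ k, z k 1_{[0, t k]}(s)) ds`, where `ψ` is the stable exponent: the logarithm of the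
fidi characteristic function of a stable Lévy motion of scale one. -/
noncomputable def levyExponent {n : ℕ} (α : ℝ) (t : Fin n → ℝ≥0) (z : Fin n → ℝ) : ℂ :=
  ∫ s, stableExponent α (stepFun t z s)

theorem measurable_compensatedTransform (μ : Measure ℝ) [SFinite μ] :
    Measurable (compensatedTransform μ) := by
  have h : StronglyMeasurable (Function.uncurry fun y r : ℝ =>
      Complex.exp (Complex.I * ((r * y : ℝ) : ℂ)) - 1 - Complex.I * ((r * y : ℝ) : ℂ)) := by
    refine Measurable.stronglyMeasurable ?_
    unfold Function.uncurry
    fun_prop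
  exact h.integral_prod_right.measurable

theorem measurable_scaledTransform (μ : Measure ℝ) [SFinite μ] (n : ℝ) :
    Measurable (scaledTransform μ n) :=
  ((measurable_compensatedTransform μ).comp (measurable_id.div_const _)).const_mul _

/-- Integrating out the rates and rescaling the starting times by `T`. -/
theorem streamExponent_eq {l : ℝ} (hl : 0 ≤ l) {G H : Measure ℝ} [IsProbabilityMeasure G]
    [IsProbabilityMeasure H] (hG : ∀ᵐ u ∂G, 0 < u) (hH : ∀ᵐ r ∂H, 0 < r)
    (hGi : Integrable (fun u => u) G) (hHi : Integrable (fun r => r) H) {n : ℕ} {T : ℝ}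
    (hT : 0 < T) (a : ℝ) (t : Fin n → ℝ≥0) (z : Fin n → ℝ) :
    streamExponent (sessionIntensity l G H) T a t z
      = ((l * T : ℝ) : ℂ) * ∫ p : ℝ × ℝ,
          compensatedTransform H (combinedLength T t z (T * p.1, p.2) / a) ∂(volume.prod G) := by
  have hint := integrable_compensated_combinedLoad (l := l) hG hH hGi hHi hT a t z
  set ν : Measure ℝ := ENNReal.ofReal l • (volume : Measure ℝ) with hν
  have hmp : MeasurePreserving (MeasurableEquiv.prodAssoc : (ℝ × ℝ) × ℝ ≃ᵐ ℝ × ℝ × ℝ)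
      ((ν.prod G).prod H) (sessionIntensity l G H) := measurePreserving_prodAssoc ν G H
  have hcm : Measurable fun p : ℝ × ℝ =>
      compensatedTransform H (combinedLength T t z p / a) :=
    (measurable_compensatedTransform H).comp
      ((continuous_combinedLength T t z).measurable.div_const a)
  have hmap : ν.prod G
      = ENNReal.ofReal (l * T) • (volume.prod G).map (Prod.map (fun s => T * s) id) := by
    rw [← Measure.map_prod_map _ _ (measurable_const_mul T) measurable_id, Measure.map_id,
      Real.map_volume_mul_left hT.ne', abs_of_pos (inv_pos.2 hT), hν,
      Measure.prod_smul_left, Measure.prod_smul_left, smul_smul, ← ENNReal.ofReal_mul (by positivity),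
      mul_assoc, mul_inv_cancel₀ hT.ne', mul_one]
  have hint2 := (hmp.integrable_comp_emb
    (MeasurableEquiv.measurableEmbedding _)).2 hint
  calc streamExponent (sessionIntensity l G H) T a t z
      = ∫ p, compensatedTransform H (combinedLength T t z p / a) ∂(ν.prod G) := by
        rw [streamExponent, ← hmp.integral_comp (MeasurableEquiv.measurableEmbedding _)]
        exact integral_prod _ hint2
    _ = _ := by
        rw [hmap, integral_smul_measure, integral_map (by fun_prop) hcm.aestronglyMeasurable,
          ENNReal.toReal_ofReal (by positivity), Complex.real_smul]
        rfl

theorem abs_combinedLength_le {n : ℕ} {T : ℝ} (hT : 0 < T) (t : Fin n → ℝ≥0) (z : Fin n → ℝ)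
    {s u : ℝ} (hu : 0 ≤ u) :
    |combinedLength T t z (T * s, u)| ≤ (∑ k, |z k| * (1 + t k)) * (u * (1 + |s|)⁻¹) := by
  rw [combinedLength, Finset.sum_mul]
  refine (Finset.abs_sum_le_sum_abs _ _).trans (Finset.sum_le_sum fun k _ => ?_)
  rw [abs_mul, mul_assoc]
  gcongr
  rw [abs_of_nonneg (sessionLength_nonneg _ _ _)]
  refine (sessionLength_mul_le hT (NNReal.coe_nonneg (t k)) hu).trans (le_of_eq ?_)
  ring

theorem tendsto_combinedLength {n : ℕ} (t : Fin n → ℝ≥0) (z : Fin n → ℝ) {s u : ℝ} (hs : s ≠ 0)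
    (hst : ∀ k, s ≠ (t k : ℝ)) (hu : 0 ≤ u) :
    Tendsto (fun T => combinedLength T t z (T * s, u)) atTop (𝓝 (stepFun t z s * u)) := by
  rw [stepFun, Finset.sum_mul]
  refine tendsto_finsetSum _ fun k _ => ?_
  rw [mul_assoc]
  exact (tendsto_sessionLength_mul hs (hst k) hu).const_mul _

theorem integrable_rpow_mul_inv_rpow {G : Measure ℝ} [IsProbabilityMeasure G]
    {β : ℝ} (hβ : 1 < β) (hGi : Integrable (fun u => u ^ β) G) :
    Integrable (fun p : ℝ × ℝ => (1 + |p.1|) ^ (-β) * p.2 ^ β) (volume.prod G) := by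
  have h : Integrable fun s : ℝ => (1 + ‖s‖) ^ (-β) := integrable_one_add_norm (by simpa using hβ)
  exact h.mul_prod hGi

/-- Dominated convergence over starting times and durations. The majorant is integrable because
the rates have a heavier tail than the durations: an exponent strictly between the two indices
serves as moment order for the durations. -/
theorem tendsto_integral_scaledTransform {α δ : ℝ} (hα : 1 < α ∧ α < 2) (hδ : δ < 2)
    (hαδ : α < δ) {FR G : Measure ℝ} [IsProbabilityMeasure FR] [IsProbabilityMeasure G]
    (hFRpos : ∀ᵐ r ∂FR, 0 < r) (hFR : RegVar (rightTail FR) (-α))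
    (hGpos : ∀ᵐ u ∂G, 0 < u) (hG : RegVar (rightTail G) (-δ))
    {n : ℝ → ℝ} (hn : Tendsto n atTop atTop) {m : ℕ} (t : Fin m → ℝ≥0) (z : Fin m → ℝ) :
    Tendsto (fun T => ∫ p : ℝ × ℝ,
        scaledTransform FR (n T) (combinedLength T t z (T * p.1, p.2)) ∂(volume.prod G)) atTop
      (𝓝 (∫ p : ℝ × ℝ, ((stableScale α ^ α : ℝ) : ℂ) * stableExponent α (stepFun t z p.1 * p.2)
        ∂(volume.prod G))) := by
  obtain ⟨β, hβ1, hβ⟩ := exists_between hα.1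
  obtain ⟨γ, hγ, hγδ⟩ := exists_between hαδ
  obtain ⟨C, hC, hev⟩ := exists_norm_scaledTransform_le hFRpos hFR hβ1 hβ hγ (by linarith)
  set K : ℝ := ∑ k, |z k| * (1 + t k) with hK
  have hK0 : 0 ≤ K := Finset.sum_nonneg fun k _ => by positivity
  have hpos2 : ∀ᵐ p ∂((volume : Measure ℝ).prod G), 0 < p.2 :=
    Measure.quasiMeasurePreserving_snd.ae hGpos
  have hmaj : ∀ b, 1 < b → b < δ → Integrable
      (fun p : ℝ × ℝ => K ^ b * ((1 + |p.1|) ^ (-b) * p.2 ^ b)) (volume.prod G) :=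
    fun b hb1 hb => (integrable_rpow_mul_inv_rpow hb1
      (integrable_rpow_of_regVar hGpos hG (by linarith) hb)).const_mul _
  refine tendsto_integral_filter_of_dominated_convergence
    (fun p => C * (K ^ β * ((1 + |p.1|) ^ (-β) * p.2 ^ β)
      + K ^ γ * ((1 + |p.1|) ^ (-γ) * p.2 ^ γ))) (Eventually.of_forall fun T => ?_) ?_
    (((hmaj β hβ1 (by linarith)).add (hmaj γ (by linarith) hγδ)).const_mul C) ?_
  · have h : Measurable fun p : ℝ × ℝ => combinedLength T t z (T * p.1, p.2) :=
      (continuous_combinedLength T t z).measurable.comp (by fun_prop)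
    exact ((measurable_scaledTransform FR _).comp h).aestronglyMeasurable
  · filter_upwards [hn.eventually hev, eventually_gt_atTop 0] with T hT hT0
    filter_upwards [hpos2] with p hp
    refine (hT _).trans ?_
    have hle := abs_combinedLength_le hT0 t z (s := p.1) hp.le
    have hpow : ∀ b : ℝ, 0 < b → |combinedLength T t z (T * p.1, p.2)| ^ b
        ≤ K ^ b * ((1 + |p.1|) ^ (-b) * p.2 ^ b) := fun b hb => by
      refine (Real.rpow_le_rpow (abs_nonneg _) hle hb.le).trans (le_of_eq ?_)
      rw [Real.mul_rpow hK0 (by positivity), Real.mul_rpow hp.le (by positivity),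
        Real.inv_rpow (by positivity), Real.rpow_neg (by positivity)]
      ring
    gcongr
    · exact hpow β (by linarith)
    · exact hpow γ (by linarith)
  · have hs : ∀ᵐ s : ℝ, s ≠ 0 ∧ ∀ k, s ≠ (t k : ℝ) :=
      (Measure.ae_ne volume 0).and (ae_all_iff.2 fun k => Measure.ae_ne volume _)
    have hs2 : ∀ᵐ p ∂((volume : Measure ℝ).prod G), p.1 ≠ 0 ∧ ∀ k, p.1 ≠ (t k : ℝ) :=
      Measure.quasiMeasurePreserving_fst.ae hs
    filter_upwards [hs2, hpos2] with p hp1 hp2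
    exact tendsto_scaledTransform hFRpos hα hFR hn
      (tendsto_combinedLength t z hp1.1 hp1.2 hp2.le)

theorem stableExponent_mul {α : ℝ} {c u : ℝ} (hu : 0 < u) :
    stableExponent α (c * u) = stableExponent α c * ((u ^ α : ℝ) : ℂ) := by
  have hsign : Real.sign (c * u) = Real.sign c := by
    rcases lt_trichotomy c 0 with hc | rfl | hc
    · rw [Real.sign_of_neg hc, Real.sign_of_neg (mul_neg_of_neg_of_pos hc hu)]
    · simp
    · rw [Real.sign_of_pos hc, Real.sign_of_pos (mul_pos hc hu)]
  rw [stableExponent, stableExponent, hsign, abs_mul, abs_of_pos hu,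
    Real.mul_rpow (abs_nonneg _) hu.le]
  push_cast; ring

/-- The limiting exponent factorises by homogeneity of the stable exponent. -/
theorem integral_stableExponent_prod {α : ℝ} {G : Measure ℝ} [SFinite G] (hG : ∀ᵐ u ∂G, 0 < u)
    {m : ℕ} (t : Fin m → ℝ≥0) (z : Fin m → ℝ) :
    ∫ p : ℝ × ℝ, stableExponent α (stepFun t z p.1 * p.2) ∂(volume.prod G)
      = levyExponent α t z * ((∫ u, u ^ α ∂G : ℝ) : ℂ) := by
  have hpos2 : ∀ᵐ p ∂((volume : Measure ℝ).prod G), 0 < p.2 :=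
    Measure.quasiMeasurePreserving_snd.ae hG
  rw [levyExponent, ← integral_complex_ofReal, ← integral_prod_mul]
  refine integral_congr_ae ?_
  filter_upwards [hpos2] with p hp using stableExponent_mul hp

/-- The exponent of a stream, up to the factor `v`, the proportion of its sessions. -/
theorem tendsto_streamExponent {α δ : ℝ} (hα : 1 < α ∧ α < 2) (hδ : δ < 2)
    (hαδ : α < δ) {FR G : Measure ℝ} [IsProbabilityMeasure FR] [IsProbabilityMeasure G]
    (hFRpos : ∀ᵐ r ∂FR, 0 < r) (hFR : RegVar (rightTail FR) (-α))
    (hGpos : ∀ᵐ u ∂G, 0 < u) (hG : RegVar (rightTail G) (-δ))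
    {lam total : ℝ → ℝ} (hlam : ∀ T, 0 < T → 0 < lam T) (hle : ∀ T, 0 < T → lam T ≤ total T)
    (hn : Tendsto (fun T => total T * T) atTop atTop) {m : ℕ} (t : Fin m → ℝ≥0)
    (z : Fin m → ℝ) :
    Tendsto (fun T => streamExponent (sessionIntensity (lam T) G FR) T
        (quantile FR (total T * T)) t z
        - ((lam T / total T * (∫ u, u ^ α ∂G) * stableScale α ^ α : ℝ) : ℂ) * levyExponent α t z)
      atTop (𝓝 0) := by
  have hGi : Integrable (fun u => u) G := by
    simpa using integrable_rpow_of_regVar hGpos hG zero_lt_one (by linarith)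
  have hFRi : Integrable (fun u => u) FR := by
    simpa using integrable_rpow_of_regVar hFRpos hFR zero_lt_one (by linarith)
  have hlim := tendsto_integral_scaledTransform hα hδ hαδ hFRpos hFR hGpos hG hn t z
  rw [integral_const_mul, integral_stableExponent_prod hGpos] at hlim
  have hdiff := hlim.sub_const (((stableScale α ^ α : ℝ) : ℂ)
    * (levyExponent α t z * ((∫ u, u ^ α ∂G : ℝ) : ℂ)))
  rw [sub_self] at hdiff
  -- the proportion is at most one, so it does not spoil the convergence to zero
  have hbdd : ∀ᶠ T in atTop, ‖((lam T / total T : ℝ) : ℂ)‖ ≤ 1 := by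
    filter_upwards [eventually_gt_atTop 0] with T hT
    have h1 := hlam T hT
    have h2 := hle T hT
    rw [Complex.norm_real, Real.norm_of_nonneg (by apply div_nonneg <;> linarith)]
    exact div_le_one_of_le₀ h2 (by linarith)
  have hprod := Tendsto.zero_mul_isBoundedUnder_le hdiff
    (isBoundedUnder_of_eventually_le (f := atTop) (a := 1) (u := norm ∘ fun T =>
      ((lam T / total T : ℝ) : ℂ)) hbdd)
  refine hprod.congr' ?_
  filter_upwards [eventually_gt_atTop 0] with T hT
  have h1 := hlam T hT
  have htot : total T ≠ 0 := by linarith [hle T hT]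
  have htotC : (total T : ℂ) ≠ 0 := by exact_mod_cast htot
  rw [streamExponent_eq h1.le hGpos hFRpos hGi hFRi hT]
  simp only [scaledTransform]
  rw [integral_const_mul]
  push_cast
  field_simp

/-! ### Finite-dimensional distributions of stable Lévy motions -/

theorem stableExponent_zero {α : ℝ} (hα : α ≠ 0) : stableExponent α 0 = 0 := by
  simp [stableExponent, Real.zero_rpow hα]

theorem stableChf_eq (α σ z : ℝ) :
    stableChf α σ z = Complex.exp (((σ ^ α : ℝ) : ℂ) * stableExponent α z) := by
  rw [stableChf, stableExponent]
  congr 1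
  push_cast; ring

theorem eq_add_sum_increments {n : ℕ} (F : Fin (n + 1) → ℝ) (k : Fin (n + 1)) :
    F k = F 0 + ∑ i : Fin n, if i.castSucc < k then F i.succ - F i.castSucc else 0 := by
  induction k using Fin.induction with
  | zero => simp
  | succ j ih =>
    have hsplit : ∀ i : Fin n, (if i.castSucc < j.succ then F i.succ - F i.castSucc else 0)
        = (if i.castSucc < j.castSucc then F i.succ - F i.castSucc else 0)
          + if i = j then F i.succ - F i.castSucc else 0 := fun i => by
      rcases lt_trichotomy i j with h | h | h
      · rw [if_pos (Fin.castSucc_lt_succ_iff.2 h.le), if_pos (Fin.castSucc_lt_castSucc_iff.2 h),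
          if_neg h.ne, add_zero]
      · subst h; simp
      · rw [if_neg (fun h' => (Fin.castSucc_lt_succ_iff.1 h').not_gt h),
          if_neg (fun h' => (Fin.castSucc_lt_castSucc_iff.1 h').not_gt h), if_neg h.ne', add_zero]
    simp_rw [hsplit]
    rw [Finset.sum_add_distrib, ← add_assoc, ← ih]
    simp

/-- Summation by parts over the increments of a finite sequence that starts at zero. -/
theorem sum_mul_eq_sum_increments {n : ℕ} (F : Fin (n + 1) → ℝ) (h0 : F 0 = 0)
    (z : Fin n → ℝ) :
    ∑ k, z k * F k.succ
      = ∑ i : Fin n, (∑ k, if i ≤ k then z k else 0) * (F i.succ - F i.castSucc) := by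
  have hF : ∀ k : Fin n, F k.succ
      = ∑ i : Fin n, if i ≤ k then F i.succ - F i.castSucc else 0 := fun k => by
    rw [eq_add_sum_increments F k.succ, h0, zero_add]
    refine Finset.sum_congr rfl fun i _ => ?_
    simp only [Fin.castSucc_lt_succ_iff]
  simp_rw [Finset.sum_mul]
  rw [Finset.sum_comm]
  refine Finset.sum_congr rfl fun k _ => ?_
  rw [hF k, Finset.mul_sum]
  refine Finset.sum_congr rfl fun i _ => ?_
  split_ifs <;> simp

section Monotone

variable {n : ℕ} {t : Fin n → ℝ≥0}

theorem monotone_cons_zero (ht : Monotone t) : Monotone (Fin.cons 0 t : Fin (n + 1) → ℝ≥0) := by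
  intro i j hij
  cases i using Fin.cases with
  | zero => simp
  | succ i =>
    cases j using Fin.cases with
    | zero => exact absurd hij (by simp)
    | succ j => simpa using ht (by simpa using hij)

/-- For ordered times the step function is constant on each interval between them. -/
theorem stableExponent_stepFun {α : ℝ} (hα : α ≠ 0) (ht : Monotone t) (z : Fin n → ℝ) {s : ℝ}
    (hs : s ≠ 0) :
    stableExponent α (stepFun t z s) = ∑ i : Fin n,
      (Set.Ioc ((Fin.cons 0 t : Fin (n + 1) → ℝ≥0) i.castSucc : ℝ)
        ((Fin.cons 0 t : Fin (n + 1) → ℝ≥0) i.succ)).indicator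
        (fun _ => stableExponent α (∑ k, if i ≤ k then z k else 0)) s := by
  set τ : Fin (n + 1) → ℝ≥0 := Fin.cons 0 t with hτ
  have hτm : Monotone τ := monotone_cons_zero ht
  have hτ0 : τ 0 = 0 := rfl
  have hstep : stepFun t z s = ∑ i : Fin n, (∑ k, if i ≤ k then z k else 0) *
      (Set.Ioc (τ i.castSucc : ℝ) (τ i.succ)).indicator (fun _ => (1 : ℝ)) s := by
    have h := sum_mul_eq_sum_increments
      (fun i => (Set.Ioc (0 : ℝ) (τ i)).indicator (fun _ => (1 : ℝ)) s) (by simp [hτ0]) z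
    have hleft : stepFun t z s
        = ∑ k : Fin n, z k * (Set.Ioc (0 : ℝ) (τ k.succ)).indicator (fun _ => (1 : ℝ)) s := by
      refine Finset.sum_congr rfl fun k _ => ?_
      congr 1
      have : s ∈ Set.Icc (0 : ℝ) (t k) ↔ s ∈ Set.Ioc (0 : ℝ) (τ k.succ) := by
        simp only [Set.mem_Icc, Set.mem_Ioc, hτ, Fin.cons_succ]
        exact ⟨fun h => ⟨lt_of_le_of_ne h.1 hs.symm, h.2⟩, fun h => ⟨h.1.le, h.2⟩⟩
      by_cases hm : s ∈ Set.Icc (0 : ℝ) (t k)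
      · rw [Set.indicator_of_mem hm, Set.indicator_of_mem (this.1 hm)]
      · rw [Set.indicator_of_notMem hm, Set.indicator_of_notMem (fun h' => hm (this.2 h'))]
    rw [hleft, h]
    refine Finset.sum_congr rfl fun i _ => ?_
    congr 1
    have hle : (τ i.castSucc : ℝ) ≤ τ i.succ := by exact_mod_cast hτm i.castSucc_le_succ
    have h0 : (0 : ℝ) ≤ τ i.castSucc := NNReal.coe_nonneg _
    simp only [Set.indicator, Set.mem_Ioc]
    split_ifs with h1 h2 h3 h3 h4 h5 h5 <;> first | (exfalso; grind) | norm_num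
  by_cases hex : ∃ i : Fin n, s ∈ Set.Ioc (τ i.castSucc : ℝ) (τ i.succ)
  · obtain ⟨i, hi⟩ := hex
    have hother : ∀ j, j ≠ i → s ∉ Set.Ioc (τ j.castSucc : ℝ) (τ j.succ) := fun j hj hjm => by
      rcases lt_or_gt_of_ne hj with hlt | hlt
      · have h1 : (τ j.succ : ℝ) ≤ τ i.castSucc := by
          exact_mod_cast hτm (Fin.succ_le_castSucc_iff.2 hlt)
        linarith [hjm.2, hi.1]
      · have h1 : (τ i.succ : ℝ) ≤ τ j.castSucc := by
          exact_mod_cast hτm (Fin.succ_le_castSucc_iff.2 hlt)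
        linarith [hi.2, hjm.1]
    have hval : stepFun t z s = ∑ k, if i ≤ k then z k else 0 := by
      rw [hstep]
      refine (Finset.sum_eq_single i (fun j _ hj => ?_) (by simp)).trans ?_
      · rw [Set.indicator_of_notMem (hother j hj), mul_zero]
      · rw [Set.indicator_of_mem hi, mul_one]
    rw [hval]
    refine ((Finset.sum_eq_single i (fun j _ hj => ?_) (by simp)).trans ?_).symm
    · exact Set.indicator_of_notMem (hother j hj) _
    · exact Set.indicator_of_mem hi _
  · push Not at hex
    rw [hstep, Finset.sum_eq_zero, Finset.sum_eq_zero, stableExponent_zero hα]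
    · exact fun j _ => Set.indicator_of_notMem (hex j) _
    · exact fun j _ => by rw [Set.indicator_of_notMem (hex j), mul_zero]

theorem levyExponent_eq_sum {α : ℝ} (hα : α ≠ 0) (ht : Monotone t) (z : Fin n → ℝ) :
    levyExponent α t z = ∑ i : Fin n,
      ((((Fin.cons 0 t : Fin (n + 1) → ℝ≥0) i.succ : ℝ)
        - (Fin.cons 0 t : Fin (n + 1) → ℝ≥0) i.castSucc : ℝ) : ℂ)
        * stableExponent α (∑ k, if i ≤ k then z k else 0) := by
  set τ : Fin (n + 1) → ℝ≥0 := Fin.cons 0 t with hτ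
  have hτm : Monotone τ := monotone_cons_zero ht
  have hae : ∀ᵐ s : ℝ, stableExponent α (stepFun t z s) = ∑ i : Fin n,
      (Set.Ioc (τ i.castSucc : ℝ) (τ i.succ)).indicator
        (fun _ => stableExponent α (∑ k, if i ≤ k then z k else 0)) s := by
    filter_upwards [Measure.ae_ne volume (0 : ℝ)] with s hs
      using stableExponent_stepFun hα ht z hs
  rw [levyExponent, integral_congr_ae hae, integral_finsetSum]
  · refine Finset.sum_congr rfl fun i _ => ?_
    have hle : (τ i.castSucc : ℝ) ≤ τ i.succ := by exact_mod_cast hτm i.castSucc_le_succ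
    rw [integral_indicator_const _ measurableSet_Ioc, Measure.real, Real.volume_Ioc,
      ENNReal.toReal_ofReal (by linarith), Complex.real_smul]
  · intro i _
    rw [integrable_indicator_iff measurableSet_Ioc]
    exact integrableOn_const measure_Ioc_lt_top.ne

theorem IsStableLevyMotion.integral_cexp_of_monotone {Ω : Type*} [MeasurableSpace Ω]
    {P : Measure Ω} {L : ℝ≥0 → Ω → ℝ} {α σ : ℝ} (hα : 0 < α) (hσ : 0 ≤ σ)
    (hL : IsStableLevyMotion P L α σ) (ht : Monotone t) (z : Fin n → ℝ) :
    ∫ ω, Complex.exp (Complex.I * ((∑ k, z k * L (t k) ω : ℝ) : ℂ)) ∂P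
      = Complex.exp (((σ ^ α : ℝ) : ℂ) * levyExponent α t z) := by
  set τ : Fin (n + 1) → ℝ≥0 := Fin.cons 0 t with hτ
  have hτm : Monotone τ := monotone_cons_zero ht
  set c : Fin n → ℝ := fun i => ∑ k, if i ≤ k then z k else 0 with hc
  have hind := hL.indep n τ hτm
  have hmeas : ∀ i : Fin n, Measurable fun ω => L (τ i.succ) ω - L (τ i.castSucc) ω := fun i =>
    (hL.measurable _).sub (hL.measurable _)
  have hfactor : ∀ i : Fin n, ∫ ω, Complex.exp (Complex.I *
      ((c i * (L (τ i.succ) ω - L (τ i.castSucc) ω) : ℝ) : ℂ)) ∂P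
      = Complex.exp (((σ ^ α : ℝ) : ℂ) * ((((τ i.succ : ℝ) - τ i.castSucc : ℝ) : ℂ)
        * stableExponent α (c i))) := fun i => by
    have hle : τ i.castSucc ≤ τ i.succ := hτm i.castSucc_le_succ
    have hle' : (0 : ℝ) ≤ (τ i.succ : ℝ) - τ i.castSucc := sub_nonneg.2 (by exact_mod_cast hle)
    have h := hL.stable _ _ hle (c i)
    rw [stableChf_eq, Real.mul_rpow hσ (by positivity), ← Real.rpow_mul hle',
      one_div_mul_cancel hα.ne', Real.rpow_one, charFun_apply_real,
      integral_map (hmeas i).aemeasurable (by fun_prop)] at h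
    rw [← mul_assoc, ← Complex.ofReal_mul, ← h]
    congr 1; ext ω
    push_cast; ring_nf
  rw [levyExponent_eq_sum hα.ne' ht, Finset.mul_sum, Complex.exp_sum]
  calc ∫ ω, Complex.exp (Complex.I * ((∑ k, z k * L (t k) ω : ℝ) : ℂ)) ∂P
      = ∫ ω, ∏ i : Fin n, Complex.exp (Complex.I *
          ((c i * (L (τ i.succ) ω - L (τ i.castSucc) ω) : ℝ) : ℂ)) ∂P := by
        refine integral_congr_ae ?_
        filter_upwards [hL.zero] with ω hω
        have h := sum_mul_eq_sum_increments (fun i => L (τ i) ω) hω z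
        have h' : ∑ k, z k * L (t k) ω
            = ∑ i : Fin n, c i * (L (τ i.succ) ω - L (τ i.castSucc) ω) := by
          simpa only [hτ, Fin.cons_succ] using h
        rw [h', ← Complex.exp_sum, ← Finset.mul_sum]
        push_cast; rfl
    _ = ∏ i : Fin n, ∫ ω, Complex.exp (Complex.I *
          ((c i * (L (τ i.succ) ω - L (τ i.castSucc) ω) : ℝ) : ℂ)) ∂P :=
        hind.integral_fun_prod_comp
          (f := fun i (x : ℝ) => Complex.exp (Complex.I * ((c i * x : ℝ) : ℂ)))
          (fun i => (hmeas i).aemeasurable)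
          (fun i => Measurable.aestronglyMeasurable (by fun_prop))
    _ = _ := Finset.prod_congr rfl fun i _ => hfactor i

end Monotone

theorem levyExponent_comp_perm {n : ℕ} (α : ℝ) (t : Fin n → ℝ≥0) (z : Fin n → ℝ)
    (e : Equiv.Perm (Fin n)) : levyExponent α (t ∘ e) (z ∘ e) = levyExponent α t z := by
  have h : ∀ s, stepFun (t ∘ e) (z ∘ e) s = stepFun t z s := fun s =>
    Equiv.sum_comp e fun k => z k * (Set.Icc (0 : ℝ) (t k)).indicator (fun _ => (1 : ℝ)) s
  simp only [levyExponent, h]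

/-- The fidi characteristic functions of a stable Lévy motion. -/
theorem IsStableLevyMotion.integral_cexp {Ω : Type*} [MeasurableSpace Ω]
    {P : Measure Ω} {L : ℝ≥0 → Ω → ℝ} {α σ : ℝ} (hα : 0 < α) (hσ : 0 ≤ σ)
    (hL : IsStableLevyMotion P L α σ) {n : ℕ} (t : Fin n → ℝ≥0) (z : Fin n → ℝ) :
    ∫ ω, Complex.exp (Complex.I * ((∑ k, z k * L (t k) ω : ℝ) : ℂ)) ∂P
      = Complex.exp (((σ ^ α : ℝ) : ℂ) * levyExponent α t z) := by
  set e := Tuple.sort t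
  have h := hL.integral_cexp_of_monotone hα hσ (Tuple.monotone_sort t) (z ∘ e)
  rw [levyExponent_comp_perm] at h
  rw [← h]
  congr 1; ext ω
  congr 3
  exact (Equiv.sum_comp e fun k => z k * L (t k) ω).symm

theorem stableExponent_eq_pos_neg {α : ℝ} (hα : 0 < α) (y : ℝ) : stableExponent α y =
    -((1 - Complex.I * (Real.tan (Real.pi * α / 2) : ℂ)) * (((max y 0) ^ α : ℝ) : ℂ)
      + (1 + Complex.I * (Real.tan (Real.pi * α / 2) : ℂ)) * (((max (-y) 0) ^ α : ℝ) : ℂ)) := by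
  rcases lt_trichotomy y 0 with hy | rfl | hy
  · rw [stableExponent, Real.sign_of_neg hy, abs_of_neg hy, max_eq_right hy.le,
      max_eq_left (by linarith), Real.zero_rpow hα.ne']
    push_cast; ring
  · simp [stableExponent, Real.zero_rpow hα.ne']
  · rw [stableExponent, Real.sign_of_pos hy, abs_of_pos hy, max_eq_left hy.le,
      max_eq_right (by linarith), Real.zero_rpow hα.ne']
    push_cast; ring

theorem continuous_stableExponent {α : ℝ} (hα : 0 < α) : Continuous (stableExponent α) := by
  rw [funext (stableExponent_eq_pos_neg hα)]
  have hc : ∀ f : ℝ → ℝ, Continuous f → Continuous fun y => (((f y) ^ α : ℝ) : ℂ) := fun f hf =>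
    Complex.continuous_ofReal.comp (hf.rpow_const fun _ => Or.inr hα.le)
  have h1 := hc (fun y => max y 0) (by fun_prop)
  have h2 := hc (fun y => max (-y) 0) (by fun_prop)
  fun_prop

theorem continuous_levyExponent {α : ℝ} (hα : 0 < α) {n : ℕ} (t : Fin n → ℝ≥0) :
    Continuous (levyExponent α t) := by
  have h : levyExponent α t = fun z => _ := funext fun z =>
    (levyExponent_comp_perm α t z (Tuple.sort t)).symm.trans
      (levyExponent_eq_sum hα.ne' (Tuple.monotone_sort t) (z ∘ Tuple.sort t))
  rw [h]
  refine continuous_finsetSum _ fun i _ => continuous_const.mul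
    ((continuous_stableExponent hα).comp ?_)
  refine continuous_finsetSum _ fun k _ => ?_
  split_ifs
  · exact continuous_apply _
  · exact continuous_const

theorem stableExponent_mul_of_nonneg {α : ℝ} (hα : 0 < α) (y : ℝ) {c : ℝ} (hc : 0 ≤ c) :
    stableExponent α (c * y) = ((c ^ α : ℝ) : ℂ) * stableExponent α y := by
  rcases hc.eq_or_lt with rfl | hc
  · simp [stableExponent_zero hα.ne', Real.zero_rpow hα.ne']
  · rw [mul_comm, stableExponent_mul hc, mul_comm]

theorem stepFun_smul {n : ℕ} (t : Fin n → ℝ≥0) (z : Fin n → ℝ) (c s : ℝ) :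
    stepFun t (fun k => c * z k) s = c * stepFun t z s := by
  simp only [stepFun, Finset.mul_sum, mul_assoc]

theorem levyExponent_smul {α : ℝ} (hα : 0 < α) {n : ℕ} (t : Fin n → ℝ≥0) (z : Fin n → ℝ) {c : ℝ}
    (hc : 0 ≤ c) :
    levyExponent α t (fun k => c * z k) = ((c ^ α : ℝ) : ℂ) * levyExponent α t z := by
  simp only [levyExponent, stepFun_smul, stableExponent_mul_of_nonneg hα _ hc]
  rw [integral_const_mul]

/-- The fidi characteristic functions of a combination of independent stable Lévy motions. -/
theorem fidiChf_sum_levy {p : ℕ} {Ω : Type*} [MeasurableSpace Ω] {P : Measure Ω}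
    {L : Fin p → ℝ≥0 → Ω → ℝ} {α σ : ℝ} (hα : 0 < α) (hσ : 0 ≤ σ)
    (hL : ∀ j, IsStableLevyMotion P (L j) α σ) (hind : iIndepFun (fun j ω t => L j t ω) P)
    {c : Fin p → ℝ} (hc : ∀ j, 0 ≤ c j) {n : ℕ} (t : Fin n → ℝ≥0) (z : Fin n → ℝ) :
    fidiChf P (fun s ω => ∑ j, c j * L j s ω) t z
      = Complex.exp (((∑ j, c j ^ α * σ ^ α : ℝ) : ℂ) * levyExponent α t z) := by
  have hfactor : ∀ j, ∫ ω, Complex.exp (Complex.I * ((∑ k, (c j * z k) * L j (t k) ω : ℝ) : ℂ)) ∂P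
      = Complex.exp (((c j ^ α * σ ^ α : ℝ) : ℂ) * levyExponent α t z) := fun j => by
    rw [(hL j).integral_cexp hα hσ t, levyExponent_smul hα t z (hc j)]
    congr 1; push_cast; ring
  rw [Complex.ofReal_sum, Finset.sum_mul, Complex.exp_sum]
  calc fidiChf P (fun s ω => ∑ j, c j * L j s ω) t z
      = ∫ ω, ∏ j, Complex.exp (Complex.I * ((∑ k, (c j * z k) * L j (t k) ω : ℝ) : ℂ)) ∂P := by
        rw [fidiChf]
        congr 1; ext ω
        rw [← Complex.exp_sum, ← Finset.mul_sum]
        congr 2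
        rw [← Complex.ofReal_sum]
        congr 1
        simp_rw [Finset.mul_sum]
        rw [Finset.sum_comm]
        refine Finset.sum_congr rfl fun j _ => Finset.sum_congr rfl fun k _ => by ring
    _ = ∏ j, ∫ ω, Complex.exp (Complex.I * ((∑ k, (c j * z k) * L j (t k) ω : ℝ) : ℂ)) ∂P :=
        hind.integral_fun_prod_comp
          (f := fun j (x : ℝ≥0 → ℝ) => Complex.exp (Complex.I *
            ((∑ k, (c j * z k) * x (t k) : ℝ) : ℂ)))
          (fun j => (measurable_pi_lambda _ fun s => (hL j).measurable s).aemeasurable)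
          (fun j => Measurable.aestronglyMeasurable (by fun_prop))
    _ = _ := Finset.prod_congr rfl fun j _ => hfactor j

/-! ### Integrals with respect to stable random measures -/

section RandomMeasure

variable {Ω E : Type*} [MeasurableSpace Ω] [MeasurableSpace E] {P : Measure Ω}
  {M : Set E → Ω → ℝ} {α : ℝ} {m : Measure E}

/-- The partial sums `(n + 1) M ∅` of a constant sequence can converge only if `M ∅ = 0`. -/
theorem IsStableRandomMeasure.ae_empty (hM : IsStableRandomMeasure P M α m) :
    ∀ᵐ ω ∂P, M ∅ ω = 0 := by
  have h := hM.sigma_additive (fun _ => ∅) (fun _ => MeasurableSet.empty)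
    (fun _ _ _ => disjoint_bot_left) (by simp)
  filter_upwards [h] with ω hω
  simp only [Set.iUnion_empty, Finset.sum_const, Finset.card_range, nsmul_eq_mul] at hω
  have h1 := (tendsto_add_atTop_iff_nat 1).2 hω
  have h2 := h1.sub hω
  simp only [Nat.cast_add, Nat.cast_one, add_mul, one_mul, add_sub_cancel_left, sub_self] at h2
  exact tendsto_nhds_unique tendsto_const_nhds h2

theorem IsStableRandomMeasure.ae_union (hM : IsStableRandomMeasure P M α m) {A B : Set E}
    (hA : MeasurableSet A) (hB : MeasurableSet B) (hAB : Disjoint A B) (hmA : m A ≠ ∞)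
    (hmB : m B ≠ ∞) : ∀ᵐ ω ∂P, M (A ∪ B) ω = M A ω + M B ω := by
  set C : ℕ → Set E := fun i => if i = 0 then A else if i = 1 then B else ∅ with hC
  have hU : ⋃ i, C i = A ∪ B := by
    ext x
    simp only [Set.mem_iUnion, Set.mem_union]
    constructor
    · rintro ⟨i, hi⟩
      simp only [hC] at hi
      split_ifs at hi
      · exact Or.inl hi
      · exact Or.inr hi
      · exact hi.elim
    · rintro (h | h)
      · exact ⟨0, by simpa [hC] using h⟩
      · exact ⟨1, by simpa [hC] using h⟩
  have hCm : ∀ i, MeasurableSet (C i) := fun i => by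
    simp only [hC]; split_ifs <;> first | assumption | exact MeasurableSet.empty
  have hCd : Pairwise fun i k => Disjoint (C i) (C k) := fun i k hik => by
    simp only [hC]
    split_ifs <;> first | exact hAB | exact hAB.symm | (exfalso; omega) | simp
  have h := hM.sigma_additive C hCm hCd (by rw [hU]; exact (measure_union_lt_top hmA.lt_top
    hmB.lt_top).ne)
  filter_upwards [h, hM.ae_empty] with ω hω h0
  rw [hU] at hω
  refine tendsto_nhds_unique hω (tendsto_const_nhds.congr' ?_)
  filter_upwards [eventually_ge_atTop 2] with n hn
  obtain ⟨k, rfl⟩ := Nat.exists_eq_add_of_le hn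
  rw [Finset.sum_range_add, Finset.sum_eq_zero (s := Finset.range k)]
  · simp [Finset.sum_range_succ, hC]
  · intro i _
    have : C (2 + i) = ∅ := by
      simp only [hC]
      rw [if_neg (by omega), if_neg (by omega)]
    rw [this, h0]

theorem IsStableRandomMeasure.ae_biUnion (hM : IsStableRandomMeasure P M α m) {ι : Type*}
    (s : Finset ι) (A : ι → Set E) (hA : ∀ i, MeasurableSet (A i))
    (hd : Pairwise fun i k => Disjoint (A i) (A k)) (hm : ∀ i ∈ s, m (A i) ≠ ∞) :
    ∀ᵐ ω ∂P, M (⋃ i ∈ s, A i) ω = ∑ i ∈ s, M (A i) ω := by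
  classical
  induction s using Finset.induction_on with
  | empty =>
    filter_upwards [hM.ae_empty] with ω hω
    simpa using hω
  | insert a s ha ih =>
    have hm' : ∀ i ∈ s, m (A i) ≠ ∞ := fun i hi => hm i (Finset.mem_insert_of_mem hi)
    have hfin : m (⋃ i ∈ s, A i) ≠ ∞ := by
      refine ((measure_biUnion_finset_le s A).trans_lt ?_).ne
      exact ENNReal.sum_lt_top.2 fun i hi => (hm' i hi).lt_top
    have hdis : Disjoint (A a) (⋃ i ∈ s, A i) := by
      simp only [Set.disjoint_iUnion_right]
      exact fun i hi => hd fun h => ha (h ▸ hi)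
    filter_upwards [ih hm', hM.ae_union (hA a) (Finset.measurableSet_biUnion s fun i _ => hA i)
      hdis (hm a (Finset.mem_insert_self a s)) hfin] with ω h1 h2
    rw [Finset.set_biUnion_insert, h2, h1, Finset.sum_insert ha]

/-- The integral of `φ ∘ g` may be computed over the values of `g`, although distinct values of `g`
may be identified by `φ`: this is where finite additivity is used. -/
theorem IsStableRandomMeasure.simpleIntegral_map (hM : IsStableRandomMeasure P M α m)
    {F : Type*} [Zero F] (g : SimpleFunc E F) (hg : g.FinMeasSupp m) (φ : F → ℝ) (hφ : φ 0 = 0) :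
    ∀ᵐ ω ∂P, simpleIntegral M (g.map φ) ω = ∑ y ∈ g.range, φ y * M (g ⁻¹' {y}) ω := by
  classical
  have hunion : ∀ y ∈ g.range, ∀ᵐ ω ∂P, φ y * M ((g.map φ) ⁻¹' {φ y}) ω
      = ∑ j ∈ g.range with φ j = φ y, φ j * M (g ⁻¹' {j}) ω := fun y _ => by
    by_cases hy : φ y = 0
    · refine ae_of_all _ fun ω => ?_
      rw [hy, zero_mul]
      refine (Finset.sum_eq_zero fun j hj => ?_).symm
      rw [(Finset.mem_filter.1 hj).2, zero_mul]
    · have hset : (g.map φ) ⁻¹' {φ y} = ⋃ j ∈ {j ∈ g.range | φ j = φ y}, g ⁻¹' {j} := by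
        ext x
        simp
      have hfin : ∀ j ∈ {j ∈ g.range | φ j = φ y}, m (g ⁻¹' {j}) ≠ ∞ := fun j hj => by
        refine (hg.meas_preimage_singleton_ne_zero fun h0 => hy ?_).ne
        rw [← (Finset.mem_filter.1 hj).2, h0, hφ]
      filter_upwards [hM.ae_biUnion {j ∈ g.range | φ j = φ y} (fun j => g ⁻¹' {j})
        (fun j => g.measurableSet_preimage _)
        (fun i k hik => Disjoint.preimage _ (Set.disjoint_singleton.2 hik)) hfin] with ω hω
      rw [hset, hω, Finset.mul_sum]
      exact Finset.sum_congr rfl fun j hj => by rw [(Finset.mem_filter.1 hj).2]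
  have hall : ∀ᵐ ω ∂P, ∀ y ∈ g.range, φ y * M ((g.map φ) ⁻¹' {φ y}) ω
      = ∑ j ∈ g.range with φ j = φ y, φ j * M (g ⁻¹' {j}) ω :=
    (ae_ball_iff g.range.countable_toSet).2 hunion
  filter_upwards [hall] with ω hω
  rw [simpleIntegral, SimpleFunc.range_map]
  exact Finset.sum_image' _ fun i hi => hω i hi

theorem IsStableRandomMeasure.simpleIntegral_add (hM : IsStableRandomMeasure P M α m)
    {g h : SimpleFunc E ℝ} (hg : g.FinMeasSupp m) (hh : h.FinMeasSupp m) :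
    ∀ᵐ ω ∂P, simpleIntegral M (g + h) ω = simpleIntegral M g ω + simpleIntegral M h ω := by
  have hp := hg.pair hh
  filter_upwards [hM.simpleIntegral_map (g.pair h) hp (fun p => p.1 + p.2) (by simp),
    hM.simpleIntegral_map (g.pair h) hp Prod.fst rfl,
    hM.simpleIntegral_map (g.pair h) hp Prod.snd rfl] with ω h1 h2 h3
  rw [SimpleFunc.map_fst_pair] at h2
  rw [SimpleFunc.map_snd_pair] at h3
  rw [SimpleFunc.add_eq_map₂, h1, h2, h3, ← Finset.sum_add_distrib]
  exact Finset.sum_congr rfl fun p _ => by ring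

theorem IsStableRandomMeasure.simpleIntegral_const_mul (hM : IsStableRandomMeasure P M α m)
    {g : SimpleFunc E ℝ} (hg : g.FinMeasSupp m) (c : ℝ) :
    ∀ᵐ ω ∂P, simpleIntegral M (g.map fun y => c * y) ω = c * simpleIntegral M g ω := by
  filter_upwards [hM.simpleIntegral_map g hg (fun y => c * y) (by simp)] with ω h1
  rw [h1, simpleIntegral, Finset.mul_sum]
  exact Finset.sum_congr rfl fun p _ => by ring

theorem IsStableRandomMeasure.measurable_simpleIntegral (hM : IsStableRandomMeasure P M α m)
    {g : SimpleFunc E ℝ} (hg : g.FinMeasSupp m) : Measurable (simpleIntegral M g) := by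
  refine Finset.measurable_sum _ fun y _ => ?_
  by_cases hy : y = 0
  · simp [hy]
  · exact (hM.measurable _ (g.measurableSet_preimage _)
      (hg.meas_preimage_singleton_ne_zero hy).ne).const_mul y

/-- The characteristic function of the integral of a simple function. -/
theorem IsStableRandomMeasure.integral_cexp_simpleIntegral
    (hM : IsStableRandomMeasure P M α m) (hα : 0 < α) {g : SimpleFunc E ℝ}
    (hg : g.FinMeasSupp m) :
    ∫ ω, Complex.exp (Complex.I * (simpleIntegral M g ω : ℂ)) ∂P
      = Complex.exp (∫ x, stableExponent α (g x) ∂m) := by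
  classical
  have hgi := SimpleFunc.integrable_iff_finMeasSupp.2 hg
  have h0 := stableExponent_zero hα.ne'
  set s : Finset ℝ := {y ∈ g.range | y ≠ 0} with hs
  have hright : ∫ x, stableExponent α (g x) ∂m
      = ∑ y ∈ s, (m.real (g ⁻¹' {y}) : ℂ) * stableExponent α y := by
    have hfi : Integrable (g.map (stableExponent α)) m :=
      SimpleFunc.integrable_iff_finMeasSupp.2 (hg.map h0)
    rw [show (∫ x, stableExponent α (g x) ∂m) = ∫ x, (g.map (stableExponent α)) x ∂m from rfl,
      ← SimpleFunc.integral_eq_integral _ hfi, SimpleFunc.map_integral g _ hgi h0,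
      hs, Finset.sum_filter_of_ne]
    · simp
    · rintro y - hy rfl
      simp [h0] at hy
  have hleft : ∀ ω, simpleIntegral M g ω = ∑ y ∈ s, y * M (g ⁻¹' {y}) ω := fun ω => by
    rw [simpleIntegral, hs, Finset.sum_filter_of_ne]
    rintro y - hy rfl
    simp at hy
  set e := s.equivFin
  set A : Fin s.card → Set E := fun i => g ⁻¹' {((e.symm i : s) : ℝ)} with hA
  have hAm : ∀ i, MeasurableSet (A i) := fun i => g.measurableSet_preimage _
  have hne : ∀ i, ((e.symm i : s) : ℝ) ≠ 0 := fun i =>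
    (Finset.mem_filter.1 (e.symm i : s).2).2
  have hfin : ∀ i, m (A i) ≠ ∞ := fun i => (hg.meas_preimage_singleton_ne_zero (hne i)).ne
  have hind := hM.indep _ A hAm hfin (fun i k hik => by
    refine Disjoint.preimage _ (Set.disjoint_singleton.2 fun h => hik ?_)
    exact e.symm.injective (Subtype.ext h))
  have hmeas : ∀ i, Measurable (M (A i)) := fun i => hM.measurable _ (hAm i) (hfin i)
  have hsumC : ∀ F : ℝ → ℂ, ∑ y ∈ s, F y = ∑ i, F (e.symm i : s) := fun F => by
    rw [← Finset.sum_coe_sort s]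
    exact (Equiv.sum_comp e.symm (fun y : s => F y)).symm
  have hfactor : ∀ i, ∫ ω, Complex.exp (Complex.I *
      ((((e.symm i : s) : ℝ) * M (A i) ω : ℝ) : ℂ)) ∂P
      = Complex.exp ((m.real (A i) : ℂ) * stableExponent α ((e.symm i : s) : ℝ)) := fun i => by
    have h := hM.stable (A i) (hAm i) (hfin i) ((e.symm i : s) : ℝ)
    rw [stableChf_eq, ← Real.rpow_mul ENNReal.toReal_nonneg, one_div_mul_cancel hα.ne',
      Real.rpow_one, charFun_apply_real, integral_map (hmeas i).aemeasurable (by fun_prop)] at h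
    rw [Measure.real, ← h]
    congr 1; ext ω
    push_cast; ring_nf
  rw [hright, hsumC, Complex.exp_sum]
  calc ∫ ω, Complex.exp (Complex.I * (simpleIntegral M g ω : ℂ)) ∂P
      = ∫ ω, ∏ i, Complex.exp (Complex.I * ((((e.symm i : s) : ℝ) * M (A i) ω : ℝ) : ℂ)) ∂P := by
        congr 1; ext ω
        rw [hleft, ← Complex.exp_sum, ← Finset.mul_sum, Complex.ofReal_sum, hsumC]
    _ = ∏ i, ∫ ω, Complex.exp (Complex.I * ((((e.symm i : s) : ℝ) * M (A i) ω : ℝ) : ℂ)) ∂P :=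
        hind.integral_fun_prod_comp
          (f := fun i (x : ℝ) => Complex.exp (Complex.I * ((((e.symm i : s) : ℝ) * x : ℝ) : ℂ)))
          (fun i => (hmeas i).aemeasurable)
          (fun i => Measurable.aestronglyMeasurable (by fun_prop))
    _ = _ := Finset.prod_congr rfl fun i _ => hfactor i

/-- `X` is an almost sure limit of integrals of simple functions that converge to `f` in `L^α`.
Unlike convergence in probability, this is visibly stable under linear combinations. -/
def IsAELimitIntegral (P : Measure Ω) (M : Set E → Ω → ℝ) (α : ℝ) (m : Measure E) (f : E → ℝ)
    (X : Ω → ℝ) : Prop :=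
  ∃ g : ℕ → SimpleFunc E ℝ, (∀ n, (g n).FinMeasSupp m) ∧
    Tendsto (fun n => eLpNorm (fun x => g n x - f x) (ENNReal.ofReal α) m) atTop (𝓝 0) ∧
    ∀ᵐ ω ∂P, Tendsto (fun n => simpleIntegral M (g n) ω) atTop (𝓝 (X ω))

theorem lintegral_abs_rpow_eq (hα : 0 < α) (h : E → ℝ) :
    ∫⁻ x, ENNReal.ofReal (|h x| ^ α) ∂m = eLpNorm h (ENNReal.ofReal α) m ^ α := by
  have hp0 : ENNReal.ofReal α ≠ 0 := by simpa using hα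
  rw [eLpNorm_eq_lintegral_rpow_enorm_toReal hp0 ENNReal.ofReal_ne_top,
    ENNReal.toReal_ofReal hα.le, ← ENNReal.rpow_mul, one_div_mul_cancel hα.ne', ENNReal.rpow_one]
  refine lintegral_congr fun x => ?_
  rw [← ENNReal.ofReal_rpow_of_nonneg (abs_nonneg _) hα.le, ← Real.norm_eq_abs, ofReal_norm]

/-- A subsequence of the approximating integrals converges almost surely. -/
theorem IsStableIntegral.isAELimitIntegral (hα : 0 < α) {f : E → ℝ} {X : Ω → ℝ}
    (h : IsStableIntegral P M α m f X) : IsAELimitIntegral P M α m f X := by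
  obtain ⟨g, hg, hlim, hX⟩ := h
  obtain ⟨ns, hns, hae⟩ := hX.exists_seq_tendsto_ae
  refine ⟨fun n => g (ns n), fun n => hg _, ?_, hae⟩
  simp_rw [lintegral_abs_rpow_eq hα] at hlim
  have h1 : Tendsto (fun y : ℝ≥0∞ => y ^ (1 / α)) (𝓝 0) (𝓝 (0 ^ (1 / α))) :=
    (ENNReal.continuous_rpow_const).tendsto 0
  rw [ENNReal.zero_rpow_of_pos (by positivity)] at h1
  refine ((h1.comp hlim).comp hns.tendsto_atTop).congr fun n => ?_
  simp only [Function.comp]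
  rw [← ENNReal.rpow_mul, mul_one_div_cancel hα.ne', ENNReal.rpow_one]

theorem IsAELimitIntegral.add (hM : IsStableRandomMeasure P M α m) (hα : 1 ≤ α)
    {f f' : E → ℝ} {X X' : Ω → ℝ} (hf : Measurable f) (hf' : Measurable f')
    (h : IsAELimitIntegral P M α m f X) (h' : IsAELimitIntegral P M α m f' X') :
    IsAELimitIntegral P M α m (fun x => f x + f' x) (fun ω => X ω + X' ω) := by
  obtain ⟨g, hg, hlim, hX⟩ := h
  obtain ⟨g', hg', hlim', hX'⟩ := h'
  have hsum := hlim.add hlim'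
  rw [add_zero] at hsum
  refine ⟨fun n => g n + g' n, fun n => (hg n).add (hg' n), ?_, ?_⟩
  · refine tendsto_of_tendsto_of_tendsto_of_le_of_le tendsto_const_nhds hsum
      (fun n => zero_le) fun n => ?_
    have heq : (fun x => (g n + g' n) x - (f x + f' x))
        = (fun x => g n x - f x) + fun x => g' n x - f' x := by
      ext x; simp only [SimpleFunc.coe_add, Pi.add_apply]; ring
    simp only [heq]
    exact eLpNorm_add_le ((g n).measurable.sub hf).aestronglyMeasurable
      ((g' n).measurable.sub hf').aestronglyMeasurable (by simpa using hα)
  · have hadd : ∀ᵐ ω ∂P, ∀ n, simpleIntegral M (g n + g' n) ω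
        = simpleIntegral M (g n) ω + simpleIntegral M (g' n) ω :=
      ae_all_iff.2 fun n => hM.simpleIntegral_add (hg n) (hg' n)
    filter_upwards [hX, hX', hadd] with ω h1 h2 h3
    simp only [h3]
    exact h1.add h2

theorem IsAELimitIntegral.const_mul (hM : IsStableRandomMeasure P M α m)
    {f : E → ℝ} {X : Ω → ℝ} (c : ℝ) (h : IsAELimitIntegral P M α m f X) :
    IsAELimitIntegral P M α m (fun x => c * f x) (fun ω => c * X ω) := by
  obtain ⟨g, hg, hlim, hX⟩ := h
  refine ⟨fun n => (g n).map fun y => c * y, fun n => (hg n).map (by simp), ?_, ?_⟩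
  · have h1 := ENNReal.Tendsto.const_mul (a := ‖c‖ₑ) hlim (Or.inr enorm_ne_top)
    rw [mul_zero] at h1
    refine h1.congr fun n => ?_
    rw [← eLpNorm_const_smul]
    congr 1; ext x
    simp [mul_sub]
  · have hmul : ∀ᵐ ω ∂P, ∀ n, simpleIntegral M ((g n).map fun y => c * y) ω
        = c * simpleIntegral M (g n) ω :=
      ae_all_iff.2 fun n => hM.simpleIntegral_const_mul (hg n) c
    filter_upwards [hX, hmul] with ω h1 h2
    simp only [h2]
    exact h1.const_mul c

theorem IsAELimitIntegral.zero : IsAELimitIntegral P M α m (fun _ => 0) (fun _ => 0) := by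
  refine ⟨fun _ => 0, fun _ => SimpleFunc.finMeasSupp_iff.2 fun y hy => ?_, by simp, ?_⟩
  · have : ((0 : SimpleFunc E ℝ) : E → ℝ) ⁻¹' {y} = ∅ := by
      ext x; simp [hy.symm]
    change m (((0 : SimpleFunc E ℝ) : E → ℝ) ⁻¹' {y}) < ∞
    rw [this, measure_empty]
    exact ENNReal.zero_lt_top
  · refine ae_of_all _ fun ω => tendsto_const_nhds.congr fun n => ?_
    rw [simpleIntegral, Finset.sum_eq_zero]
    intro y hy
    obtain ⟨x, rfl⟩ := SimpleFunc.mem_range.1 hy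
    simp

theorem IsAELimitIntegral.sum (hM : IsStableRandomMeasure P M α m) (hα : 1 ≤ α) {ι : Type*}
    (s : Finset ι) {f : ι → E → ℝ} {X : ι → Ω → ℝ} (hf : ∀ i, Measurable (f i))
    (h : ∀ i, IsAELimitIntegral P M α m (f i) (X i)) :
    IsAELimitIntegral P M α m (fun x => ∑ i ∈ s, f i x) (fun ω => ∑ i ∈ s, X i ω) := by
  classical
  induction s using Finset.induction_on with
  | empty => simpa using IsAELimitIntegral.zero
  | insert a s ha ih =>
    simp only [Finset.sum_insert ha]
    exact (h a).add hM hα (hf a) (Finset.measurable_sum _ fun i _ => hf i) ih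

theorem memLp_posPart {p : ℝ≥0∞} {f : E → ℝ} (hf : MemLp f p m) :
    MemLp (fun x => max (f x) 0) p m :=
  hf.mono (hf.1.aemeasurable.max aemeasurable_const).aestronglyMeasurable
    (ae_of_all _ fun x => by
      simp only [Real.norm_eq_abs]
      rw [abs_of_nonneg (le_max_right _ _)]
      exact max_le (le_abs_self _) (abs_nonneg _))

theorem integrable_posPart_rpow (hα : 0 < α) {f : E → ℝ} (hf : MemLp f (ENNReal.ofReal α) m) :
    Integrable (fun x => (max (f x) 0) ^ α) m := by
  have h := (memLp_posPart hf).integrable_norm_rpow (by simpa using hα) ENNReal.ofReal_ne_top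
  simpa only [ENNReal.toReal_ofReal hα.le, Real.norm_eq_abs,
    abs_of_nonneg (le_max_right _ (0 : ℝ))] using h

/-- The integrals of `(f⁺) ^ α` depend continuously on `f` in `L^α`, by the triangle
inequality for the norm of `f⁺`. -/
theorem tendsto_integral_posPart_rpow (hα : 1 ≤ α) {g : ℕ → E → ℝ} {f : E → ℝ}
    (hg : ∀ n, MemLp (g n) (ENNReal.ofReal α) m) (hf : MemLp f (ENNReal.ofReal α) m)
    (hlim : Tendsto (fun n => eLpNorm (fun x => g n x - f x) (ENNReal.ofReal α) m) atTop (𝓝 0)) :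
    Tendsto (fun n => ∫ x, (max (g n x) 0) ^ α ∂m) atTop (𝓝 (∫ x, (max (f x) 0) ^ α ∂m)) := by
  have hα0 : 0 < α := by linarith
  have h1p : 1 ≤ ENNReal.ofReal α := by simpa using hα
  set p := ENNReal.ofReal α
  have hint : ∀ h : E → ℝ, AEStronglyMeasurable h m → ∫ x, (max (h x) 0) ^ α ∂m
      = (eLpNorm (fun x => max (h x) 0) p m ^ α).toReal := fun h hh => by
    rw [integral_eq_lintegral_of_nonneg_ae (ae_of_all _ fun x => by positivity),
      ← lintegral_abs_rpow_eq hα0]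
    · simp only [abs_of_nonneg (le_max_right _ (0 : ℝ))]
    · exact ((hh.aemeasurable.max aemeasurable_const).pow_const α).aestronglyMeasurable
  simp_rw [fun n => hint (g n) (hg n).1, hint f hf.1]
  have hle : ∀ u v : E → ℝ, MemLp u p m → MemLp v p m →
      eLpNorm (fun x => max (u x) 0) p m
        ≤ eLpNorm (fun x => max (v x) 0) p m + eLpNorm (fun x => u x - v x) p m := by
    intro u v hu hv
    have heq : (fun x => max (u x) 0)
        = (fun x => max (v x) 0) + fun x => max (u x) 0 - max (v x) 0 := by
      ext x; simp
    rw [heq]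
    refine (eLpNorm_add_le (memLp_posPart hv).1 ((memLp_posPart hu).sub (memLp_posPart hv)).1
      h1p).trans ?_
    gcongr
    refine eLpNorm_mono fun x => ?_
    simp only [Real.norm_eq_abs, Pi.sub_apply]
    exact abs_max_sub_max_le_abs (u x) (v x) 0
  have hnorm : Tendsto (fun n => eLpNorm (fun x => max (g n x) 0) p m) atTop
      (𝓝 (eLpNorm (fun x => max (f x) 0) p m)) := by
    have hup := hlim.const_add (eLpNorm (fun x => max (f x) 0) p m)
    have hlow := ENNReal.Tendsto.sub (tendsto_const_nhds
      (x := eLpNorm (fun x => max (f x) 0) p m)) hlim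
      (Or.inl (memLp_posPart hf).2.ne)
    rw [add_zero] at hup
    rw [tsub_zero] at hlow
    refine tendsto_of_tendsto_of_tendsto_of_le_of_le hlow hup (fun n => ?_) fun n =>
      hle _ _ (hg n) hf
    refine tsub_le_iff_right.2 ((hle f (g n) hf (hg n)).trans (le_of_eq ?_))
    congr 1
    rw [← eLpNorm_neg]
    congr 1; ext x
    simp
  refine (ENNReal.tendsto_toReal ?_).comp
    ((ENNReal.continuous_rpow_const.tendsto _).comp hnorm)
  exact ENNReal.rpow_ne_top_of_nonneg hα0.le (memLp_posPart hf).2.ne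

/-- The stable exponent is a combination of the `α`-th powers of the positive and negative parts. -/
theorem tendsto_integral_stableExponent (hα : 1 ≤ α) {g : ℕ → E → ℝ} {f : E → ℝ}
    (hg : ∀ n, MemLp (g n) (ENNReal.ofReal α) m) (hf : MemLp f (ENNReal.ofReal α) m)
    (hlim : Tendsto (fun n => eLpNorm (fun x => g n x - f x) (ENNReal.ofReal α) m) atTop (𝓝 0)) :
    Tendsto (fun n => ∫ x, stableExponent α (g n x) ∂m) atTop
      (𝓝 (∫ x, stableExponent α (f x) ∂m)) := by
  have hα0 : 0 < α := by linarith
  have hsplit : ∀ h : E → ℝ, MemLp h (ENNReal.ofReal α) m → ∫ x, stableExponent α (h x) ∂m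
      = -((1 - Complex.I * (Real.tan (Real.pi * α / 2) : ℂ)) * ((∫ x, (max (h x) 0) ^ α ∂m : ℝ) : ℂ)
        + (1 + Complex.I * (Real.tan (Real.pi * α / 2) : ℂ))
          * ((∫ x, (max (-h x) 0) ^ α ∂m : ℝ) : ℂ)) := fun h hh => by
    simp_rw [stableExponent_eq_pos_neg hα0]
    rw [integral_neg, integral_add, integral_const_mul, integral_const_mul,
      integral_complex_ofReal, integral_complex_ofReal]
    · exact (integrable_posPart_rpow hα0 hh).ofReal.const_mul _
    · exact (integrable_posPart_rpow hα0 hh.neg).ofReal.const_mul _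
  simp_rw [fun n => hsplit (g n) (hg n), hsplit f hf]
  have hpos := tendsto_integral_posPart_rpow hα hg hf hlim
  have hneg := tendsto_integral_posPart_rpow (g := fun n x => -g n x) (f := fun x => -f x) hα
    (fun n => (hg n).neg) hf.neg (by
      refine hlim.congr fun n => ?_
      rw [← eLpNorm_neg]
      congr 1; ext x
      simp; ring)
  exact ((hpos.ofReal.const_mul _).add (hneg.ofReal.const_mul _)).neg

/-- The characteristic function of an integral with respect to a stable random measure. -/
theorem IsAELimitIntegral.integral_cexp [IsProbabilityMeasure P]
    (hM : IsStableRandomMeasure P M α m) (hα : 1 ≤ α)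
    {f : E → ℝ} {X : Ω → ℝ} (hf : Measurable f) (h : IsAELimitIntegral P M α m f X) :
    ∫ ω, Complex.exp (Complex.I * (X ω : ℂ)) ∂P
      = Complex.exp (∫ x, stableExponent α (f x) ∂m) := by
  obtain ⟨g, hg, hlim, hX⟩ := h
  have hα0 : 0 < α := by linarith
  have hgL : ∀ n, MemLp (g n) (ENNReal.ofReal α) m := fun n =>
    (SimpleFunc.memLp_iff_finMeasSupp (by simpa using hα0) ENNReal.ofReal_ne_top).2 (hg n)
  have hfL : MemLp f (ENNReal.ofReal α) m := by
    obtain ⟨n, hn⟩ := (hlim.eventually_lt_const one_pos).exists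
    have hsub : MemLp (fun x => g n x - f x) (ENNReal.ofReal α) m :=
      ⟨((g n).measurable.sub hf).aestronglyMeasurable, hn.trans ENNReal.one_lt_top⟩
    have := (hgL n).sub hsub
    refine this.congr_norm hf.aestronglyMeasurable (ae_of_all _ fun x => ?_)
    simp
  have hright := (Complex.continuous_exp.tendsto _).comp
    (tendsto_integral_stableExponent hα hgL hfL hlim)
  have hexp : Continuous fun x : ℝ => Complex.exp (Complex.I * (x : ℂ)) := by fun_prop
  have hleft : Tendsto (fun n => ∫ ω, Complex.exp (Complex.I * (simpleIntegral M (g n) ω : ℂ)) ∂P)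
      atTop (𝓝 (∫ ω, Complex.exp (Complex.I * (X ω : ℂ)) ∂P)) := by
    refine tendsto_integral_of_dominated_convergence (fun _ => (1 : ℝ)) (fun n => ?_)
      (integrable_const _) (fun n => ae_of_all _ fun ω => (norm_cexp_I_mul _).le) ?_
    · exact (hexp.measurable.comp (hM.measurable_simpleIntegral (hg n))).aestronglyMeasurable
    · filter_upwards [hX] with ω hω using (hexp.tendsto _).comp hω
  refine tendsto_nhds_unique hleft (hright.congr fun n => ?_)
  exact (hM.integral_cexp_simpleIntegral hα0 (hg n)).symm

theorem IsStableIntegral.aemeasurable (hM : IsStableRandomMeasure P M α m) {f : E → ℝ} {X : Ω → ℝ}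
    (h : IsStableIntegral P M α m f X) : AEMeasurable X P := by
  obtain ⟨g, hg, -, hX⟩ := h
  exact hX.aemeasurable fun n => (hM.measurable_simpleIntegral (hg n)).aemeasurable

end RandomMeasure

/-- The fidi characteristic functions of `∫∫ 1_{[0,t]}(s) u M(ds, du)`. -/
theorem fidiChf_stableIntegralProcess {Ω : Type*} [MeasurableSpace Ω] {P : Measure Ω}
    [IsProbabilityMeasure P] {M : Set (ℝ × ℝ) → Ω → ℝ} {α : ℝ} (hα : 1 ≤ α) {G : Measure ℝ}
    [SFinite G] (hG : ∀ᵐ u ∂G, 0 < u) {I : ℝ≥0 → Ω → ℝ}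
    (hI : IsStableIntegralProcess P M α G I) {c : ℝ} (hc : 0 ≤ c) {n : ℕ} (t : Fin n → ℝ≥0)
    (z : Fin n → ℝ) :
    fidiChf P (fun s ω => c * I s ω) t z
      = Complex.exp (((c ^ α * ∫ u, u ^ α ∂G : ℝ) : ℂ) * levyExponent α t z) := by
  have hα0 : 0 < α := by linarith
  obtain ⟨hM, hint⟩ := hI
  have hfm : ∀ r : ℝ≥0, Measurable fun x : ℝ × ℝ =>
      (Set.Icc (0 : ℝ) r).indicator (fun _ => (1 : ℝ)) x.1 * x.2 := fun r =>
    ((measurable_const.indicator measurableSet_Icc).comp measurable_fst).mul measurable_snd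
  have hsum := IsAELimitIntegral.sum hM hα Finset.univ
    (f := fun (k : Fin n) x => (c * z k) *
      ((Set.Icc (0 : ℝ) (t k)).indicator (fun _ => (1 : ℝ)) x.1 * x.2))
    (X := fun k ω => (c * z k) * I (t k) ω) (fun k => (hfm (t k)).const_mul _)
    (fun k => ((hint (t k)).isAELimitIntegral hα0).const_mul hM (c * z k))
  have h := hsum.integral_cexp hM hα (Finset.measurable_sum _ fun k _ => (hfm (t k)).const_mul _)
  have hX : ∀ ω, ∑ k, z k * (c * I (t k) ω) = ∑ k, (c * z k) * I (t k) ω := fun ω =>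
    Finset.sum_congr rfl fun k _ => by ring
  have hf : ∀ x : ℝ × ℝ, ∑ k, (c * z k) *
      ((Set.Icc (0 : ℝ) (t k)).indicator (fun _ => (1 : ℝ)) x.1 * x.2)
      = stepFun t (fun k => c * z k) x.1 * x.2 := fun x => by
    rw [stepFun, Finset.sum_mul]
    exact Finset.sum_congr rfl fun k _ => by ring
  simp only [fidiChf, hX, h, hf]
  rw [integral_stableExponent_prod hG, levyExponent_smul hα0 t z hc]
  congr 1; push_cast; ring

/-! ### Characteristic functions determine finite-dimensional distributions -/

theorem charFun_map_eq_fidiChf {Ω : Type*} [MeasurableSpace Ω] {P : Measure Ω}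
    {X : ℝ≥0 → Ω → ℝ} (hX : ∀ s, AEMeasurable (X s) P) {n : ℕ}
    (t : Fin n → ℝ≥0) (z : EuclideanSpace ℝ (Fin n)) :
    charFun (P.map fun ω => (WithLp.toLp 2 fun k => X (t k) ω : EuclideanSpace ℝ (Fin n))) z
      = fidiChf P X t z := by
  have hm : AEMeasurable
      (fun ω => (WithLp.toLp 2 fun k => X (t k) ω : EuclideanSpace ℝ (Fin n))) P :=
    (by fun_prop : Measurable (WithLp.toLp 2 : (Fin n → ℝ) →
      EuclideanSpace ℝ (Fin n))).comp_aemeasurable (aemeasurable_pi_lambda _ fun k => hX (t k))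
  rw [charFun_apply, integral_map hm (by fun_prop), fidiChf]
  congr 1; ext ω
  rw [mul_comm, PiLp.inner_apply]
  simp

section Fidi

variable {Ω' : Type*} [MeasurableSpace Ω'] {P' : Measure Ω'} [IsProbabilityMeasure P']
  {Y : ℝ≥0 → Ω' → ℝ}

theorem sameFidi_of_fidiChf_eq {Ω : Type*} [MeasurableSpace Ω] {P : Measure Ω}
    [IsProbabilityMeasure P] {X : ℝ≥0 → Ω → ℝ} (hX : ∀ s, AEMeasurable (X s) P)
    (hY : ∀ s, AEMeasurable (Y s) P')
    (h : ∀ (n : ℕ) (t : Fin n → ℝ≥0) (z : Fin n → ℝ), fidiChf P X t z = fidiChf P' Y t z) :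
    SameFidi P X P' Y := by
  intro n t
  have hto : Measurable (WithLp.toLp 2 : (Fin n → ℝ) → EuclideanSpace ℝ (Fin n)) := by fun_prop
  have hof : Measurable (WithLp.ofLp : EuclideanSpace ℝ (Fin n) → (Fin n → ℝ)) := by fun_prop
  have hXm := aemeasurable_pi_lambda (μ := P) (fun ω k => X (t k) ω) fun k => hX (t k)
  have hYm := aemeasurable_pi_lambda (μ := P') (fun ω k => Y (t k) ω) fun k => hY (t k)
  have hEq : P.map (fun ω => (WithLp.toLp 2 fun k => X (t k) ω : EuclideanSpace ℝ (Fin n)))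
      = P'.map fun ω => (WithLp.toLp 2 fun k => Y (t k) ω : EuclideanSpace ℝ (Fin n)) := by
    refine Measure.ext_of_charFun (funext fun z => ?_)
    rw [charFun_map_eq_fidiChf hX, charFun_map_eq_fidiChf hY, h]
  have hmap := congrArg (Measure.map WithLp.ofLp) hEq
  exact (AEMeasurable.map_map_of_aemeasurable hof.aemeasurable
    (hto.comp_aemeasurable hXm)).symm.trans (hmap.trans
      (AEMeasurable.map_map_of_aemeasurable hof.aemeasurable (hto.comp_aemeasurable hYm)))

/-- Lévy's continuity theorem for finite-dimensional distributions. -/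
theorem FidiChfTendsto.fidiTendsto {Ω : ℝ → Type*} [∀ T, MeasurableSpace (Ω T)]
    {P : ∀ T, Measure (Ω T)} [∀ T, IsProbabilityMeasure (P T)] {X : ∀ T, ℝ≥0 → Ω T → ℝ}
    (hX : ∀ T, 0 < T → ∀ s, AEMeasurable (X T s) (P T)) (hY : ∀ s, AEMeasurable (Y s) P')
    (h : FidiChfTendsto P X P' Y) : FidiTendsto P X P' Y := by
  intro n t f
  have hto : Measurable (WithLp.toLp 2 : (Fin n → ℝ) → EuclideanSpace ℝ (Fin n)) := by fun_prop
  refine tendsto_of_seq_tendsto fun u hu => ?_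
  -- only the times `T > 0` matter in the limit
  set v : ℕ → ℝ := fun k => max (u k) 1 with hv
  have hv0 : ∀ k, 0 < v k := fun k => one_pos.trans_le (le_max_right _ _)
  have hvu : ∀ᶠ k in atTop, v k = u k := by
    filter_upwards [hu.eventually_ge_atTop 1] with k hk using max_eq_left hk
  have hvlim : Tendsto v atTop atTop := hu.congr' (hvu.mono fun _ h => h.symm)
  have hXm : ∀ k, AEMeasurable
      (fun ω => (WithLp.toLp 2 fun i => X (v k) (t i) ω : EuclideanSpace ℝ (Fin n))) (P (v k)) :=
    fun k => hto.comp_aemeasurable (aemeasurable_pi_lambda _ fun i => hX (v k) (hv0 k) (t i))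
  have hYm : AEMeasurable
      (fun ω => (WithLp.toLp 2 fun i => Y (t i) ω : EuclideanSpace ℝ (Fin n))) P' :=
    hto.comp_aemeasurable (aemeasurable_pi_lambda _ fun i => hY (t i))
  let μ : ℕ → ProbabilityMeasure (EuclideanSpace ℝ (Fin n)) := fun k =>
    ⟨_, Measure.isProbabilityMeasure_map (hXm k)⟩
  let μ₀ : ProbabilityMeasure (EuclideanSpace ℝ (Fin n)) :=
    ⟨_, Measure.isProbabilityMeasure_map hYm⟩
  have hlim : Tendsto μ atTop (𝓝 μ₀) := by
    refine ProbabilityMeasure.tendsto_of_tendsto_charFun fun z => ?_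
    have hμ : ∀ k, charFun (μ k : Measure (EuclideanSpace ℝ (Fin n))) z
        = fidiChf (P (v k)) (X (v k)) t z := fun k =>
      charFun_map_eq_fidiChf (hX (v k) (hv0 k)) t z
    have hμ₀ : charFun (μ₀ : Measure (EuclideanSpace ℝ (Fin n))) z = fidiChf P' Y t z :=
      charFun_map_eq_fidiChf hY t z
    simp only [hμ, hμ₀]
    exact (h n t z).comp hvlim
  let F : EuclideanSpace ℝ (Fin n) →ᵇ ℝ :=
    f.compContinuous ⟨WithLp.ofLp, PiLp.continuous_ofLp 2 _⟩
  have hF := (ProbabilityMeasure.tendsto_iff_forall_integral_tendsto.1 hlim) F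
  have h0 : ∫ x, F x ∂(μ₀ : Measure (EuclideanSpace ℝ (Fin n)))
      = ∫ ω, f (fun k => Y (t k) ω) ∂P' :=
    integral_map hYm F.continuous.measurable.aestronglyMeasurable
  rw [h0] at hF
  refine hF.congr' ?_
  filter_upwards [hvu] with k hk
  rw [Function.comp_apply, ← hk]
  exact integral_map (hXm k) F.continuous.measurable.aestronglyMeasurable

end Fidi

/-! ### The fidi characteristic functions of the traffic processes -/

section Streams

variable {Ω : Type*} [MeasurableSpace Ω] {P : Measure Ω} [IsProbabilityMeasure P] {H : Measure ℝ}
  [IsProbabilityMeasure H]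

theorem fidiChf_centredLoad {l : ℝ} {G : Measure ℝ} [IsProbabilityMeasure G]
    {N : Ω → Measure (ℝ × ℝ × ℝ)} (hl : 0 ≤ l)
    (hN : IsPoissonRandomMeasure P N (sessionIntensity l G H))
    (hG : ∀ᵐ u ∂G, 0 < u) (hH : ∀ᵐ r ∂H, 0 < r)
    (hGi : Integrable (fun u => u) G) (hHi : Integrable (fun r => r) H) {n : ℕ} {T : ℝ}
    (hT : 0 < T) (a : ℝ) (t : Fin n → ℝ≥0) (z : Fin n → ℝ) :
    fidiChf P (centredLoad N l (mean G) (mean H) T a) t z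
      = Complex.exp (streamExponent (sessionIntensity l G H) T a t z) := by
  rw [← integral_cexp_centred hN hG hH hGi hHi hT a t z, fidiChf]
  refine integral_congr_ae ?_
  filter_upwards [sum_centredLoad_ae_eq hl hN hG hH hGi hHi hT a t z] with ω hω
  rw [hω]

theorem aemeasurable_centredLoad {l : ℝ} {G : Measure ℝ} [IsProbabilityMeasure G]
    {N : Ω → Measure (ℝ × ℝ × ℝ)} (hN : IsPoissonRandomMeasure P N (sessionIntensity l G H))
    (hG : ∀ᵐ u ∂G, 0 < u) (hH : ∀ᵐ r ∂H, 0 < r)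
    (hGi : Integrable (fun u => u) G) (hHi : Integrable (fun r => r) H) {T : ℝ}
    (hT : 0 < T) (μD μR a : ℝ) (t : ℝ≥0) : AEMeasurable (centredLoad N l μD μR T a t) P :=
  ((hN.aemeasurable_integral (measurable_sessionLoad (T * t))
    (integrable_sessionLoad hG hH hGi hHi (by positivity))).sub_const _).div_const a

variable {p : ℕ} {N : Fin p → Ω → Measure (ℝ × ℝ × ℝ)} {l : Fin p → ℝ} {G : Fin p → Measure ℝ}
  [∀ j, IsProbabilityMeasure (G j)]

/-- The centred load of a superposition is the sum of the centred loads. -/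
theorem centredLoad_sum_ae_eq
    (hN : ∀ j, IsPoissonRandomMeasure P (N j) (sessionIntensity (l j) (G j) H))
    (hG : ∀ j, ∀ᵐ u ∂(G j), 0 < u) (hH : ∀ᵐ r ∂H, 0 < r)
    (hGi : ∀ j, Integrable (fun u => u) (G j)) (hHi : Integrable (fun r => r) H) {Λ : ℝ}
    (hΛ : Fin p → Λ ≠ 0) {T : ℝ} (hT : 0 < T) (a : ℝ) (t : ℝ≥0) :
    centredLoad (fun ω => ∑ j, N j ω) Λ (∑ j, l j / Λ * mean (G j)) (mean H) T a t
      =ᵐ[P] fun ω => ∑ j, centredLoad (N j) (l j) (mean (G j)) (mean H) T a t ω := by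
  have hall : ∀ᵐ ω ∂P, ∀ j, Integrable
      (fun x : ℝ × ℝ × ℝ => x.2.2 * sessionLength (T * t) x.1 x.2.1) (N j ω) :=
    ae_all_iff.2 fun j => (hN j).ae_integrable (measurable_sessionLoad _)
      (integrable_sessionLoad (hG j) hH (hGi j) hHi (by positivity))
  have hmean : Λ * ∑ j, l j / Λ * mean (G j) = ∑ j, l j * mean (G j) := by
    rw [Finset.mul_sum]
    refine Finset.sum_congr rfl fun j _ => ?_
    have := hΛ j
    field_simp
  filter_upwards [hall] with ω hω
  simp only [centredLoad, load]
  rw [integral_finsetSum_measure fun j _ => hω j, hmean, Finset.sum_mul, Finset.sum_mul,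
    ← Finset.sum_sub_distrib, Finset.sum_div]

theorem fidiChf_centredLoad_sum (hl : ∀ j, 0 ≤ l j)
    (hN : ∀ j, IsPoissonRandomMeasure P (N j) (sessionIntensity (l j) (G j) H))
    (hind : iIndepFun N P)
    (hG : ∀ j, ∀ᵐ u ∂(G j), 0 < u) (hH : ∀ᵐ r ∂H, 0 < r)
    (hGi : ∀ j, Integrable (fun u => u) (G j)) (hHi : Integrable (fun r => r) H) {Λ : ℝ}
    (hΛ : Fin p → Λ ≠ 0) {T : ℝ} (hT : 0 < T) (a : ℝ) {n : ℕ} (t : Fin n → ℝ≥0)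
    (z : Fin n → ℝ) :
    fidiChf P (centredLoad (fun ω => ∑ j, N j ω) Λ (∑ j, l j / Λ * mean (G j)) (mean H) T a) t z
      = Complex.exp (∑ j, streamExponent (sessionIntensity (l j) (G j) H) T a t z) := by
  have hall : ∀ᵐ ω ∂P, ∀ k, centredLoad (fun ω => ∑ j, N j ω) Λ (∑ j, l j / Λ * mean (G j))
      (mean H) T a (t k) ω = ∑ j, centredLoad (N j) (l j) (mean (G j)) (mean H) T a (t k) ω :=
    ae_all_iff.2 fun k => centredLoad_sum_ae_eq hN hG hH hGi hHi hΛ hT a (t k)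
  have hall' : ∀ᵐ ω ∂P, ∀ j, ∑ k, z k * centredLoad (N j) (l j) (mean (G j)) (mean H) T a (t k) ω
      = measurableIntegral (combinedLoad T a t z) (N j ω)
        - ∫ x, combinedLoad T a t z x ∂(sessionIntensity (l j) (G j) H) :=
    ae_all_iff.2 fun j => sum_centredLoad_ae_eq (hl j) (hN j) (hG j) hH (hGi j) hHi hT a t z
  have hfm := measurable_measurableIntegral (measurable_combinedLoad T a t z)
  rw [Complex.exp_sum]
  calc _ = ∫ ω, ∏ j, Complex.exp (Complex.I *
          ((measurableIntegral (combinedLoad T a t z) (N j ω)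
            - ∫ x, combinedLoad T a t z x ∂(sessionIntensity (l j) (G j) H) : ℝ) : ℂ)) ∂P := by
        rw [fidiChf]
        refine integral_congr_ae ?_
        filter_upwards [hall, hall'] with ω h1 h2
        rw [← Complex.exp_sum, ← Finset.mul_sum, ← Complex.ofReal_sum]
        simp_rw [← h2, h1, Finset.mul_sum]
        rw [Finset.sum_comm]
    _ = ∏ j, ∫ ω, Complex.exp (Complex.I *
          ((measurableIntegral (combinedLoad T a t z) (N j ω)
            - ∫ x, combinedLoad T a t z x ∂(sessionIntensity (l j) (G j) H) : ℝ) : ℂ)) ∂P :=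
        hind.integral_fun_prod_comp
          (f := fun j ν => Complex.exp (Complex.I * ((measurableIntegral (combinedLoad T a t z) ν
            - ∫ x, combinedLoad T a t z x ∂(sessionIntensity (l j) (G j) H) : ℝ) : ℂ)))
          (fun j => (hN j).measurable.aemeasurable)
          (fun j => Measurable.aestronglyMeasurable (by fun_prop))
    _ = _ := Finset.prod_congr rfl fun j _ =>
        integral_cexp_centred (hN j) (hG j) hH (hGi j) hHi hT a t z

end Streams

/-! ### The fidi characteristic functions of the stable processes -/

theorem levyExponent_zero {α : ℝ} (hα : α ≠ 0) {n : ℕ} (t : Fin n → ℝ≥0) :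
    levyExponent α t 0 = 0 := by
  simp [levyExponent, stepFun, stableExponent_zero hα]

theorem integral_rpow_nonneg {G : Measure ℝ} (hG : ∀ᵐ u ∂G, 0 < u) (α : ℝ) :
    0 ≤ ∫ u, u ^ α ∂G :=
  integral_nonneg_of_ae (hG.mono fun _ h => Real.rpow_nonneg h.le _)

theorem momentNorm_nonneg {G : Measure ℝ} (hG : ∀ᵐ u ∂G, 0 < u) (α : ℝ) :
    0 ≤ momentNorm α G :=
  Real.rpow_nonneg (integral_rpow_nonneg hG α) _

theorem rpow_mul_momentNorm_rpow {G : Measure ℝ} (hG : ∀ᵐ u ∂G, 0 < u) {α : ℝ} (hα : α ≠ 0)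
    {v : ℝ} (hv : 0 ≤ v) :
    (v ^ (1 / α) * momentNorm α G) ^ α = v * ∫ u, u ^ α ∂G := by
  have h := integral_rpow_nonneg hG α
  rw [Real.mul_rpow (Real.rpow_nonneg hv _) (momentNorm_nonneg hG α), momentNorm,
    ← Real.rpow_mul hv, ← Real.rpow_mul h, one_div_mul_cancel hα, Real.rpow_one, Real.rpow_one]

theorem fidiChf_const_mul_levy {Ω : Type*} [MeasurableSpace Ω] {P : Measure Ω}
    {L : ℝ≥0 → Ω → ℝ} {α σ : ℝ} (hα : 0 < α) (hσ : 0 ≤ σ) (hL : IsStableLevyMotion P L α σ)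
    {c : ℝ} (hc : 0 ≤ c) {n : ℕ} (t : Fin n → ℝ≥0) (z : Fin n → ℝ) :
    fidiChf P (fun s ω => c * L s ω) t z
      = Complex.exp (((c ^ α * σ ^ α : ℝ) : ℂ) * levyExponent α t z) := by
  have h : ∀ ω, ∑ k, z k * (c * L (t k) ω) = ∑ k, (c * z k) * L (t k) ω := fun ω =>
    Finset.sum_congr rfl fun k _ => by ring
  simp only [fidiChf, h]
  rw [hL.integral_cexp hα hσ t, levyExponent_smul hα t z hc]
  congr 1; push_cast; ring

section Limit

variable {p : ℕ} {α : ℝ} {F : Fin p → Measure ℝ} {w : Fin p → ℝ}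

theorem fidiChf_stableSum {Ω : Type*} [MeasurableSpace Ω] {P : Measure Ω}
    {L : Fin p → ℝ≥0 → Ω → ℝ} {σ : ℝ} (hα : 0 < α) (hσ : 0 ≤ σ)
    (hL : ∀ j, IsStableLevyMotion P (L j) α σ) (hind : iIndepFun (fun j ω t => L j t ω) P)
    (hF : ∀ j, ∀ᵐ u ∂(F j), 0 < u) (hw : ∀ j, 0 ≤ w j) {n : ℕ} (t : Fin n → ℝ≥0)
    (z : Fin n → ℝ) :
    fidiChf P (stableSum α w F L) t z
      = Complex.exp (((∑ j, w j * (∫ u, u ^ α ∂(F j)) * σ ^ α : ℝ) : ℂ) * levyExponent α t z) := by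
  have h := fidiChf_sum_levy hα hσ hL hind (c := fun j => w j ^ (1 / α) * momentNorm α (F j))
    (fun j => mul_nonneg (Real.rpow_nonneg (hw j) _) (momentNorm_nonneg (hF j) α)) t z
  simp only [rpow_mul_momentNorm_rpow (hF _) hα.ne' (hw _)] at h
  exact h

theorem integral_mixture (hw : ∀ j, 0 ≤ w j) {f : ℝ → ℝ} (hf : ∀ j, Integrable f (F j)) :
    ∫ u, f u ∂(mixture w F) = ∑ j, w j * ∫ u, f u ∂(F j) := by
  rw [mixture, integral_finsetSum_measure fun j _ => (hf j).smul_measure ENNReal.ofReal_ne_top]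
  refine Finset.sum_congr rfl fun j _ => ?_
  rw [integral_smul_measure, ENNReal.toReal_ofReal (hw j), smul_eq_mul]

theorem ae_mixture {q : ℝ → Prop} (hF : ∀ j, ∀ᵐ u ∂(F j), q u) : ∀ᵐ u ∂(mixture w F), q u := by
  rw [mixture, ae_iff, Measure.finsetSum_apply]
  refine Finset.sum_eq_zero fun j _ => ?_
  rw [Measure.smul_apply, ae_iff.1 (hF j), smul_zero]

/-- The stable integral over the mixture of the duration laws has the same law as the
weighted sum of independent Lévy motions. -/
theorem sameFidi_stableSum_stableIntegral {Ω Ω' : Type*} [MeasurableSpace Ω] [MeasurableSpace Ω']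
    {P : Measure Ω} [IsProbabilityMeasure P] {Q : Measure Ω'} [IsProbabilityMeasure Q]
    [∀ j, IsFiniteMeasure (F j)] {L : Fin p → ℝ≥0 → Ω → ℝ} {σ : ℝ} (hα : 1 ≤ α) (hσ : 0 ≤ σ)
    (hL : ∀ j, IsStableLevyMotion P (L j) α σ) (hind : iIndepFun (fun j ω t => L j t ω) P)
    (hF : ∀ j, ∀ᵐ u ∂(F j), 0 < u) (hFi : ∀ j, Integrable (fun u => u ^ α) (F j))
    (hw : ∀ j, 0 ≤ w j) {M : Set (ℝ × ℝ) → Ω' → ℝ} {I : ℝ≥0 → Ω' → ℝ}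
    (hI : IsStableIntegralProcess Q M α (mixture w F) I) :
    SameFidi P (stableSum α w F L) Q (fun t ω => σ * I t ω) := by
  have hfin : SFinite (mixture w F) := by
    have : ∀ j, IsFiniteMeasure (ENNReal.ofReal (w j) • F j) := fun j =>
      Measure.smul_finite _ ENNReal.ofReal_ne_top
    unfold mixture
    infer_instance
  refine sameFidi_of_fidiChf_eq (fun s => ?_)
    (fun s => ((hI.2 s).aemeasurable hI.1).const_mul σ) fun n t z => ?_
  · exact (Finset.measurable_sum _ fun j _ => ((hL j).measurable s).const_mul _).aemeasurable
  · rw [fidiChf_stableSum (by linarith) hσ hL hind hF hw,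
      fidiChf_stableIntegralProcess hα (ae_mixture hF) hI hσ, integral_mixture hw hFi,
      ← Finset.sum_mul, mul_comm (σ ^ α)]

end Limit

/-! ### Limits of the traffic processes -/

theorem proportion_nonneg {p : ℕ} {lam : Fin p → ℝ → ℝ} {T : ℝ} (h : ∀ j, 0 < lam j T)
    (j : Fin p) : 0 ≤ proportion lam j T :=
  div_nonneg (h j).le (Finset.sum_nonneg fun i _ => (h i).le)

theorem le_totalRate {p : ℕ} {lam : Fin p → ℝ → ℝ} {T : ℝ} (h : ∀ j, 0 < lam j T)
    (j : Fin p) : lam j T ≤ totalRate lam T :=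
  Finset.single_le_sum (f := fun i => lam i T) (fun i _ => (h i).le) (Finset.mem_univ j)

theorem isLogChf_levy {n : ℕ} {α : ℝ} (hα : 0 < α) (t : Fin n → ℝ≥0) {φ : (Fin n → ℝ) → ℂ}
    (c : ℂ) (h : ∀ z, φ z = Complex.exp (c * levyExponent α t z)) :
    IsLogChf φ fun z => c * levyExponent α t z :=
  ⟨continuous_const.mul (continuous_levyExponent hα t),
    by rw [levyExponent_zero hα.ne', mul_zero], fun z => (h z).symm⟩

end Traffic

theorem mainTheorem3
    {p : ℕ} (αR : ℝ) (hαR : 1 < αR ∧ αR < 2)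
    (αD : Fin p → ℝ) (hαD : ∀ j, 1 < αD j ∧ αD j < 2) (hlt : ∀ j, αR < αD j)
    -- the common law of the rates and the laws of the durations
    (FR : Measure ℝ) [IsProbabilityMeasure FR] (hFRpos : ∀ᵐ r ∂FR, 0 < r)
    (hFR : Traffic.RegVar (Traffic.rightTail FR) (-αR))
    (FD : Fin p → Measure ℝ) [∀ j, IsProbabilityMeasure (FD j)]
    (hFDpos : ∀ j, ∀ᵐ u ∂(FD j), 0 < u)
    (hFD : ∀ j, Traffic.RegVar (Traffic.rightTail (FD j)) (-αD j))
    -- the arrival intensities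
    (lam : Fin p → ℝ → ℝ) (hlam : ∀ j T, 0 < T → 0 < lam j T)
    (hgrowth : Tendsto (fun T => Traffic.totalRate lam T * T) atTop atTop)
    -- the model at time scale `T`: independent Poisson random measures of sessions
    {Ω : ℝ → Type*} [∀ T, MeasurableSpace (Ω T)] (P : ∀ T, Measure (Ω T))
    [∀ T, IsProbabilityMeasure (P T)]
    (N : ∀ T, Fin p → Ω T → Measure (ℝ × ℝ × ℝ))
    (hN : ∀ T, 0 < T → ∀ j, Traffic.IsPoissonRandomMeasure (P T) (N T j)
      (Traffic.sessionIntensity (lam j T) (FD j) FR))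
    (hNindep : ∀ T, 0 < T → iIndepFun (N T) (P T))
    -- independent stable Lévy motions
    {Ω' : Type*} [MeasurableSpace Ω'] (P' : Measure Ω') [IsProbabilityMeasure P']
    (L : Fin p → ℝ≥0 → Ω' → ℝ)
    (hL : ∀ j, Traffic.IsStableLevyMotion P' (L j) αR (Traffic.stableScale αR))
    (hLindep : iIndepFun (fun j ω t => L j t ω) P')
    -- a probability space that carries stable random measures
    {Ω'' : Type*} [MeasurableSpace Ω''] (Q : Measure Ω'') [IsProbabilityMeasure Q] :
    -- each stream
    (∀ j, Traffic.LogFidiChfAsymptotic P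
      (fun T => Traffic.streamInput (N T) lam FD FR j T) P'
      (fun T t ω =>
        Traffic.proportion lam j T ^ (1 / αR) * Traffic.momentNorm αR (FD j) * L j t ω)) ∧
    -- the aggregate
    Traffic.LogFidiChfAsymptotic P
      (fun T => Traffic.aggregateInput (N T) lam FD FR T) P'
      (fun T => Traffic.stableSum αR (fun j => Traffic.proportion lam j T) FD L) ∧
    -- the stable integral representation of the approximating process
    (∀ T, 0 < T → ∀ (M : Set (ℝ × ℝ) → Ω'' → ℝ) (I : ℝ≥0 → Ω'' → ℝ),
      Traffic.IsStableIntegralProcess Q M αR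
        (Traffic.mixture (fun j => Traffic.proportion lam j T) FD) I →
      Traffic.SameFidi P'
        (Traffic.stableSum αR (fun j => Traffic.proportion lam j T) FD L)
        Q (fun t ω => Traffic.stableScale αR * I t ω)) ∧
    -- convergence of the aggregate when the proportions converge
    (∀ w : Fin p → ℝ,
      (∀ j, Tendsto (fun T => Traffic.proportion lam j T) atTop (𝓝 (w j))) →
      Traffic.FidiChfTendsto P (fun T => Traffic.aggregateInput (N T) lam FD FR T) P'
        (Traffic.stableSum αR w FD L) ∧
      Traffic.FidiTendsto P (fun T => Traffic.aggregateInput (N T) lam FD FR T) P'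
        (Traffic.stableSum αR w FD L) ∧
      ∀ (M : Set (ℝ × ℝ) → Ω'' → ℝ) (I : ℝ≥0 → Ω'' → ℝ),
        Traffic.IsStableIntegralProcess Q M αR (Traffic.mixture w FD) I →
        Traffic.SameFidi P' (Traffic.stableSum αR w FD L)
          Q (fun t ω => Traffic.stableScale αR * I t ω)) := by
  have hα0 : 0 < αR := by linarith [hαR.1]
  have hσ : 0 ≤ Traffic.stableScale αR := (Traffic.stableScale_pos hαR).le
  have hFRi : Integrable (fun r => r) FR := by
    simpa using Traffic.integrable_rpow_of_regVar hFRpos hFR zero_lt_one hαR.1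
  have hFDi : ∀ j, Integrable (fun u => u) (FD j) := fun j => by
    simpa using Traffic.integrable_rpow_of_regVar (hFDpos j) (hFD j) zero_lt_one (hαD j).1
  have hFDα : ∀ j, Integrable (fun u => u ^ αR) (FD j) := fun j =>
    Traffic.integrable_rpow_of_regVar (hFDpos j) (hFD j) hα0 (hlt j)
  have hpos : ∀ T, 0 < T → ∀ j, 0 < lam j T := fun T hT j => hlam j T hT
  have htot : ∀ T, 0 < T → Fin p → Traffic.totalRate lam T ≠ 0 := fun T hT j =>
    ((hpos T hT j).trans_le (Traffic.le_totalRate (hpos T hT) j)).ne'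
  -- the logarithms of the characteristic functions of the streams and their limits
  let ψ : ∀ (_ : Fin p) (n : ℕ) (_ : Fin n → ℝ≥0) (_ : ℝ) (_ : Fin n → ℝ), ℂ := fun j n t T z =>
    Traffic.streamExponent (Traffic.sessionIntensity (lam j T) (FD j) FR) T
      (Traffic.quantile FR (Traffic.totalRate lam T * T)) t z
  let m : Fin p → ℝ := fun j => (∫ u, u ^ αR ∂(FD j))
  let κ : ℝ := Traffic.stableScale αR ^ αR
  have hψcont : ∀ j n t T, 0 < T → Continuous (ψ j n t T) := fun j n t T hT =>
    Traffic.continuous_streamExponent (hFDpos j) hFRpos (hFDi j) hFRi hT _ t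
  have hψ0 : ∀ j n t T, ψ j n t T 0 = 0 := fun j n t T => Traffic.streamExponent_zero _ _ _ _
  have hlim : ∀ j n (t : Fin n → ℝ≥0) z, Tendsto (fun T => ψ j n t T z
      - ((Traffic.proportion lam j T * m j * κ : ℝ) : ℂ) * Traffic.levyExponent αR t z)
      atTop (𝓝 0) := fun j n t z =>
    Traffic.tendsto_streamExponent hαR (hαD j).2 (hlt j) hFRpos hFR (hFDpos j) (hFD j)
      (fun T hT => hpos T hT j) (fun T hT => Traffic.le_totalRate (hpos T hT) j) hgrowth t z
  have hagg : ∀ T, 0 < T → ∀ (n : ℕ) (t : Fin n → ℝ≥0) (z : Fin n → ℝ),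
      Traffic.fidiChf (P T) (Traffic.aggregateInput (N T) lam FD FR T) t z
        = Complex.exp (∑ j, ψ j n t T z) := fun T hT n t z =>
    Traffic.fidiChf_centredLoad_sum (fun j => (hpos T hT j).le) (hN T hT) (hNindep T hT) hFDpos
      hFRpos hFDi hFRi (htot T hT) hT _ t z
  have hsum : ∀ n (t : Fin n → ℝ≥0) z, Tendsto (fun T => (∑ j, ψ j n t T z)
      - ((∑ j, Traffic.proportion lam j T * m j * κ : ℝ) : ℂ) * Traffic.levyExponent αR t z)
      atTop (𝓝 0) := fun n t z => by
    have h := tendsto_finsetSum Finset.univ fun j _ => hlim j n t z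
    rw [Finset.sum_const_zero] at h
    refine h.congr fun T => ?_
    rw [Finset.sum_sub_distrib, Complex.ofReal_sum, Finset.sum_mul]
  refine ⟨fun j n t => ⟨ψ j n t, fun T z =>
    ((Traffic.proportion lam j T * m j * κ : ℝ) : ℂ) * Traffic.levyExponent αR t z,
    fun T hT => ⟨hψcont j n t T hT, hψ0 j n t T, fun z => ?_⟩, fun T hT => ?_, hlim j n t⟩,
    fun n t => ⟨fun T z => ∑ j, ψ j n t T z, fun T z =>
    ((∑ j, Traffic.proportion lam j T * m j * κ : ℝ) : ℂ) * Traffic.levyExponent αR t z,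
    fun T hT => ⟨continuous_finsetSum _ fun j _ => hψcont j n t T hT, ?_, fun z => ?_⟩,
    fun T hT => ?_, hsum n t⟩, fun T hT M I hI => ?_, fun w hw => ?_⟩
  · exact (Traffic.fidiChf_centredLoad (hpos T hT j).le (hN T hT j) (hFDpos j) hFRpos (hFDi j)
      hFRi hT _ t z).symm
  · have hv := Traffic.proportion_nonneg (hpos T hT) j
    refine Traffic.isLogChf_levy hα0 t _ fun z => ?_
    rw [Traffic.fidiChf_const_mul_levy hα0 hσ (hL j) (mul_nonneg (Real.rpow_nonneg hv _)
      (Traffic.momentNorm_nonneg (hFDpos j) αR)) t z,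
      Traffic.rpow_mul_momentNorm_rpow (hFDpos j) hα0.ne' hv]
  · exact Finset.sum_eq_zero fun j _ => hψ0 j n t T
  · exact (hagg T hT n t z).symm
  · exact Traffic.isLogChf_levy hα0 t _ fun z => Traffic.fidiChf_stableSum hα0 hσ hL hLindep hFDpos
      (Traffic.proportion_nonneg (hpos T hT)) t z
  · exact Traffic.sameFidi_stableSum_stableIntegral hαR.1.le hσ hL hLindep hFDpos hFDα
      (Traffic.proportion_nonneg (hpos T hT)) hI
  · have hw0 : ∀ j, 0 ≤ w j := fun j => ge_of_tendsto (hw j) <| by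
      filter_upwards [eventually_gt_atTop 0] with T hT using Traffic.proportion_nonneg (hpos T hT) j
    have hchf : Traffic.FidiChfTendsto P (fun T => Traffic.aggregateInput (N T) lam FD FR T) P'
        (Traffic.stableSum αR w FD L) := fun n t z => by
      rw [Traffic.fidiChf_stableSum hα0 hσ hL hLindep hFDpos hw0]
      have hcoef : Tendsto (fun T => ∑ j, Traffic.proportion lam j T * m j * κ) atTop
          (𝓝 (∑ j, w j * m j * κ)) :=
        tendsto_finsetSum _ fun j _ => ((hw j).mul_const _).mul_const _
      have h := (hsum n t z).add (hcoef.ofReal.mul_const (Traffic.levyExponent αR t z))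
      simp only [sub_add_cancel, zero_add] at h
      refine ((Complex.continuous_exp.tendsto _).comp h).congr' ?_
      filter_upwards [eventually_gt_atTop 0] with T hT using (hagg T hT n t z).symm
    refine ⟨hchf, hchf.fidiTendsto (fun T hT s => ?_) fun s => ?_, fun M I hI =>
      Traffic.sameFidi_stableSum_stableIntegral hαR.1.le hσ hL hLindep hFDpos hFDα hw0 hI⟩
    · refine AEMeasurable.congr ?_ (Traffic.centredLoad_sum_ae_eq (hN T hT) hFDpos hFRpos hFDi hFRi
        (htot T hT) hT (Traffic.quantile FR (Traffic.totalRate lam T * T)) s).symm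
      exact Finset.aemeasurable_fun_sum _ fun j _ => Traffic.aemeasurable_centredLoad (hN T hT j)
        (hFDpos j) hFRpos (hFDi j) hFRi hT _ _ _ s
    · exact (Finset.measurable_sum _ fun j _ => ((hL j).measurable s).const_mul _).aemeasurable
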